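/- **Theorem 2.** Fix $\tau\in(0,1)$, real numbers $q_0,q_1,q_2,q_3\ge 0$ and $M$. Put $\mathbf q=\max\{3q_1,q_1+q_2,q_3\}$, $\bar{\mathbf q}_0=2\lceil q_0\mathbf q/2\rceil$, $q^*=2^{(\bar{\mathbf q}_0+4)/2}$. There is a constant $C_0=C_0(\tau,q_0,q_1,q_2,q_3,M)>0$ such that the following holds for all integers $n\ge1$ and $p,d$ with $\tau\le p/n\le 1/\tau$. *Setting.* Let $\ell_1,\dots,\ell_n:\mathbb R\to\mathbb R$ and $R:\mathbb R^p\to\mathbb R$ be convex (and non-random), and for $A\in\mathbb R^{n\times p}$ with rows $A_1,\dots,A_n$ let $H_\ell(w,A)=\frac1n\sum_{i=1}^n\ell_i(A_i^\top w)+R(w)$. *Loss.* Let $\bar\rho\in(0,1]$, $L_{\ell_i}\ge1$, and $\mathcal M_\ell,\mathcal D_\ell:(0,\bar\rho)\to[0,\infty)$ with $\mathcal M_\ell\le1\le\mathcal D_\ell$ be such that $|\ell_i(x)|\le L_{\ell_i}(1+|x|^{q_0})$ for all $i$ and $x\in\mathbb R$, and such that for every $\rho\in(0,\bar\rho)$ and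 $i$ there is $\ell_{i;\rho}\in C^3(\mathbb R)$ with values in $[0,\infty)$, $\|\ell_{i;\rho}-\ell_i\|_\infty\le\mathcal M_\ell(\rho)$, and $|\partial^k\ell_{i;\rho}(x)|\le\mathcal D_\ell(\rho)\,(1+|\ell_{i;\rho}(x)|^{q_k})$ for $k=1,2,3$ and all $x$. *Covariates.* Let $X_1,\dots,X_n$ be i.i.d. random vectors in $\mathbb R^p$ with $E[X_i]=0$ and $E[X_iX_i^\top]=\Sigma/n$, where $\Sigma$ is positive definite, $\lambda_{\max}(\Sigma)\le M$ and $\big(E|\sqrt n\,X_{i,j}|^{q^*}\big)^{1/q^*}\le M$ for all $i,j$. Suppose that $X_i$ is $d$-block dependent: there is a partition of $\{1,\dots,p\}$ into cells $B_1,\dots,B_k$, $k\le p$, of size at most $d$, such that the subvectors $(X_{i,j})_{j\in B_1},\dots,(X_{i,j})_{j\in B_k}$ are independent. Let $G_1,\dots,G_n$ be i.i.d. $N(0,\Sigma/n)$, and let $\mathbf X,\mathbf G\in\mathbb R^{n\times p}$ be the matrices with rows $X_i$ and $G_i$. Let $\hat w_{\mathbf X}$, $\hat w_{\mathbf G}$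 be random vectors that almost surely minimize $H_\ell(\cdot,\mathbf X)$, respectively $H_\ell(\cdot,\mathbf G)$, over $\mathbb R^p$. *Rate.* Let $$\sigma_n=\frac{p\,d^{3+\bar{\mathbf q}_0/2}}{n^{5/2}}+\frac{p\,d^2}{n^{3/2}}+\frac{p\,d^{\bar{\mathbf q}_0+2}}{n^{(\bar{\mathbf q}_0+3)/2}},\qquad \omega_n=n^{-(q_0q_1+3)/2}\sigma_n,$$ $\mathcal M_R(L,\delta)=\sup\{|R(w)-R(w')|:w,w'\in[-L,L]^p,\ \|w-w'\|_\infty\le\delta\}$, $\mathrm{Av}=\frac1n\sum_{i=1}^nL_{\ell_i}^{\mathbf q}$, $\log_+x=\max\{1,\log x\}$, and $$r_R(L)=\inf_{0<\rho<\bar\rho}\Big\{\mathcal M_\ell(\rho)+\mathcal D_\ell(\rho)^3\inf_{0<\delta<\omega_n}\Big[\mathcal M_R(L,\delta)+\mathrm{Av}^{1/3}L^{(\bar{\mathbf q}_0+3)/3}\big(\log_+(L/\delta)\big)^{2/3}\sigma_n^{1/3}\Big]\Big\}.$$ *Claim.* Let $\mathcal S_n\subset\mathbb R^p$ be measurable,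 and let $z\in\mathbb R$, $\rho_0>0$, $L_n\ge1$ and $\varepsilon_n\in[0,1/4)$ satisfy (i) $\max\{\Pr(\|\hat w_{\mathbf G}\|_\infty>L_n),\ \Pr(\|\hat w_{\mathbf X}\|_\infty>L_n)\}\le\varepsilon_n$; (ii) $\max\{\Pr(\inf_{w\in\mathbb R^p}H_\ell(w,\mathbf G)\ge z+\rho_0),\ \Pr(\inf_{w\in\mathcal S_n}H_\ell(w,\mathbf G)\le z+2\rho_0)\}\le\varepsilon_n$. Then $$\Pr(\hat w_{\mathbf X}\in\mathcal S_n)\le4\varepsilon_n+C_0\max\{1,\rho_0^{-3}\}\,r_R(L_n).$$ -/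

import Mathlib

open MeasureTheory ProbabilityTheory Set
open scoped ENNReal

noncomputable section

namespace BlockUniversality

/-! ### Risk, regularizer modulus and minimal risk

Vectors live in `Fin p → ℝ`, whose norm is the sup norm. -/

/-- The empirical risk `H_ℓ(w, A) = n⁻¹ ∑ i, ℓ_i(A_iᵀ w) + R(w)`, where `A_i` is the `i`-th row
of the design matrix `A`. -/
def risk {n p : ℕ} (ℓ : Fin n → ℝ → ℝ) (R : (Fin p → ℝ) → ℝ) (w : Fin p → ℝ)
    (A : Matrix (Fin n) (Fin p) ℝ) : ℝ :=
  (1 / (n : ℝ)) * ∑ i, ℓ i ((A.mulVec w) i) + R w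

/-- `w` is a global minimizer of the empirical risk with design matrix `A`. -/
def IsRiskMinimizer {n p : ℕ} (ℓ : Fin n → ℝ → ℝ) (R : (Fin p → ℝ) → ℝ)
    (A : Matrix (Fin n) (Fin p) ℝ) (w : Fin p → ℝ) : Prop :=
  ∀ w' : Fin p → ℝ, risk ℓ R w A ≤ risk ℓ R w' A

/-- The minimum of the risk over `S`, as an infimum in `[-∞, ∞]` (so it is `+∞` for empty `S`). -/
def minRisk {n p : ℕ} (ℓ : Fin n → ℝ → ℝ) (R : (Fin p → ℝ) → ℝ) (S : Set (Fin p → ℝ))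
    (A : Matrix (Fin n) (Fin p) ℝ) : EReal :=
  ⨅ w ∈ S, ((risk ℓ R w A : ℝ) : EReal)

/-- The design matrix whose `i`-th row is `X i ω`. -/
def designMatrix {Ω : Type*} {n p : ℕ} (X : Fin n → Ω → Fin p → ℝ) (ω : Ω) :
    Matrix (Fin n) (Fin p) ℝ :=
  Matrix.of fun i => X i ω

/-- The modulus of continuity of `R` on the cube `[-L, L]^p` for the sup norm. -/
def regModulus {p : ℕ} (R : (Fin p → ℝ) → ℝ) (L δ : ℝ) : ℝ :=
  sSup {x : ℝ | ∃ w w' : Fin p → ℝ, ‖w‖ ≤ L ∧ ‖w'‖ ≤ L ∧ ‖w - w'‖ ≤ δ ∧ x = |R w - R w'|}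

/-! ### Exponents -/

/-- `𝐪 = max {3 q₁, q₁ + q₂, q₃}`. -/
def bigQ (q : Fin 4 → ℝ) : ℝ := max (3 * q 1) (max (q 1 + q 2) (q 3))

/-- `q̄₀ = 2 ⌈q₀ 𝐪 / 2⌉`. -/
def qBar (q : Fin 4 → ℝ) : ℕ := 2 * ⌈q 0 * bigQ q / 2⌉₊

/-- `q* = 2 ^ ((q̄₀ + 4) / 2)`; the division is exact since `q̄₀` is even. -/
def qStar (q : Fin 4 → ℝ) : ℕ := 2 ^ ((qBar q + 4) / 2)

/-! ### Assumptions on the loss and on the covariates -/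

/-- Polynomial growth of the losses `ℓ_i`, and existence of nonnegative `C³` approximations
`ℓ_{i;ρ}` at sup-distance at most `Mℓ ρ`, with derivatives of orders `1, 2, 3` self-bounded by
`Dℓ ρ`. -/
structure LossAssumption {n : ℕ} (q : Fin 4 → ℝ) (ρbar : ℝ) (Lℓ : Fin n → ℝ) (Dℓ Mℓ : ℝ → ℝ)
    (ℓ : Fin n → ℝ → ℝ) : Prop where
  rhoBar_mem : ρbar ∈ Ioc (0 : ℝ) 1
  one_le_L : ∀ i, 1 ≤ Lℓ i
  M_mem : ∀ ρ ∈ Ioo 0 ρbar, 0 ≤ Mℓ ρ ∧ Mℓ ρ ≤ 1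
  one_le_D : ∀ ρ ∈ Ioo 0 ρbar, 1 ≤ Dℓ ρ
  growth : ∀ i x, |ℓ i x| / (1 + |x| ^ q 0) ≤ Lℓ i
  smooth_approx : ∃ ℓs : Fin n → ℝ → ℝ → ℝ, ∀ ρ ∈ Ioo 0 ρbar, ∀ i,
    (∀ x, 0 ≤ ℓs i ρ x) ∧
    ContDiff ℝ 3 (ℓs i ρ) ∧
    (∀ x, |ℓs i ρ x - ℓ i x| ≤ Mℓ ρ) ∧
    ∀ k : Fin 4, k ≠ 0 → ∀ x,
      |iteratedDeriv (k : ℕ) (ℓs i ρ) x| / (1 + |ℓs i ρ x| ^ q k) ≤ Dℓ ρ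

/-- A random vector `V` in `ℝ^p` is `d`-block dependent: its coordinates can be partitioned into
`k ≤ p` cells of size at most `d` such that the subvectors of `V` indexed by the different cells
are independent. -/
def IsBlockDependent {Ω : Type*} [MeasurableSpace Ω] {p : ℕ} (μ : Measure Ω)
    (V : Ω → Fin p → ℝ) (d : ℕ) : Prop :=
  ∃ k ≤ p, ∃ B : Fin k → Finset (Fin p),
    (∀ a b, a ≠ b → Disjoint (B a) (B b)) ∧
    (∀ j, ∃ a, j ∈ B a) ∧
    (∀ a, (B a).card ≤ d) ∧
    iIndepFun (fun (a : Fin k) (ω : Ω) (j : B a) => V ω j) μ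

/-- Largest eigenvalue of a real symmetric matrix. -/
def lambdaMax {p : ℕ} (A : Matrix (Fin p) (Fin p) ℝ) : ℝ := sSup (spectrum ℝ A)

/-- The rows `X_1, …, X_n` are i.i.d., centred with `E[X_i X_iᵀ] = Σ / n`, and `d`-block dependent;
the entries of `√n X_i` have `L^{q*}`-norm at most `M`, and `λ_max(Σ) ≤ M`. -/
structure CovariateAssumption {Ω : Type*} [MeasurableSpace Ω] {n p : ℕ} (μ : Measure Ω)
    (X : Fin n → Ω → Fin p → ℝ) (Sig : Matrix (Fin p) (Fin p) ℝ) (q : Fin 4 → ℝ) (M : ℝ)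
    (d : ℕ) : Prop where
  measurable : ∀ i, Measurable (X i)
  indep : iIndepFun X μ
  identDistrib : ∀ i j, IdentDistrib (X i) (X j) μ μ
  posDef : Sig.PosDef
  mean : ∀ i j, ∫ ω, X i ω j ∂μ = 0
  second_moment : ∀ i j k, ∫ ω, X i ω j * X i ω k ∂μ = Sig j k / n
  moment_le : ∀ i j, eLpNorm (fun ω => Real.sqrt n * X i ω j) (qStar q : ℝ≥0∞) μ ≤ ENNReal.ofReal M
  lambdaMax_le : lambdaMax Sig ≤ M
  blockDependent : ∀ i, IsBlockDependent μ (X i) d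

/-- The rows `G_1, …, G_n` are i.i.d. with law `N(0, Σ / n)`. -/
structure IsGaussianDesign {Ω : Type*} [MeasurableSpace Ω] {n p : ℕ} (μ : Measure Ω)
    (G : Fin n → Ω → Fin p → ℝ) (Sig : Matrix (Fin p) (Fin p) ℝ) : Prop where
  measurable : ∀ i, Measurable (G i)
  indep : iIndepFun G μ
  law : ∀ i, μ.map (fun ω => WithLp.toLp 2 (G i ω)) =
    multivariateGaussian (0 : EuclideanSpace ℝ (Fin p)) ((1 / (n : ℝ)) • Sig)

/-! ### The rate -/

/-- `log₊ x = max {1, log x}`. -/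
def logPlus (x : ℝ) : ℝ := max 1 (Real.log x)

/-- The rate `σ_n`. -/
def sigmaRate (n p d : ℕ) (q : Fin 4 → ℝ) : ℝ :=
  (p : ℝ) * (d : ℝ) ^ (3 + (qBar q : ℝ) / 2) / (n : ℝ) ^ ((5 : ℝ) / 2)
    + (p : ℝ) * (d : ℝ) ^ 2 / (n : ℝ) ^ ((3 : ℝ) / 2)
    + (p : ℝ) * (d : ℝ) ^ (qBar q + 2) / (n : ℝ) ^ (((qBar q : ℝ) + 3) / 2)

/-- `ω_n = n ^ (-(q₀ q₁ + 3) / 2) σ_n`. -/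
def omegaRate (n p d : ℕ) (q : Fin 4 → ℝ) : ℝ :=
  (n : ℝ) ^ (-(q 0 * q 1 + 3) / 2) * sigmaRate n p d q

/-- The average `Av({L_{ℓ_i}^𝐪}) = n⁻¹ ∑ i, L_{ℓ_i} ^ 𝐪`. -/
def avgL {n : ℕ} (q : Fin 4 → ℝ) (Lℓ : Fin n → ℝ) : ℝ :=
  (1 / (n : ℝ)) * ∑ i, Lℓ i ^ bigQ q

/-- The universality rate `r_R(L)`. -/
def rate {n p : ℕ} (d : ℕ) (q : Fin 4 → ℝ) (ρbar : ℝ) (Lℓ : Fin n → ℝ) (Dℓ Mℓ : ℝ → ℝ)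
    (R : (Fin p → ℝ) → ℝ) (L : ℝ) : ℝ :=
  ⨅ ρ : Ioo (0 : ℝ) ρbar, (Mℓ ρ + Dℓ ρ ^ 3 *
    ⨅ δ : Ioo (0 : ℝ) (omegaRate n p d q), (regModulus R L δ +
      avgL q Lℓ ^ ((1 : ℝ) / 3) * L ^ (((qBar q : ℝ) + 3) / 3) *
        logPlus (L / δ) ^ ((2 : ℝ) / 3) * sigmaRate n p d q ^ ((1 : ℝ) / 3)))

end BlockUniversality

end

/-!
The minimum of the risk over the ball `‖w‖ ≤ L` is replaced by the Gibbs free energy of a finite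
net, at inverse temperature `n * s`, and the indicator of an event by a smooth test function. The
rows of the two designs are then exchanged one at a time, and within a row one block at a time.
Since the two row laws share their first two moments and the blocks are independent, each exchange
costs a third-order Taylor remainder; the self-bounding condition `|ℓ⁽ᵏ⁾| ≤ D * (1 + |ℓ| ^ q k)`
controls it by moments of the rows.

Passing from the net to the ball costs the modulus of `R` together with a random Lipschitz constant
of the loss, which Markov's inequality controls because the mesh is smaller than `ω_n`. Choosing `s`
so that the entropy `log |net| / (n * s)` balances the Lindeberg error `s ^ 2 * σ_n` gives the
exponent `1 / 3`.

A minimizer of the risk of `X` lying in `S` forces the minimum over `S` not to exceed the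
minimum over the ball, so one of two events separated by a gap of order `ρ₀` fails, and each failure
is as unlikely for `X` as for `G`, up to the comparison error.
-/

namespace BlockUniversality

section Gibbs

variable {ι : Type*} {N : Finset ι} {w f g : ι → ℝ}

/-- The average of `f` over `N` with respect to the probability weights proportional to `w`; it is
`0` when the total weight vanishes. -/
noncomputable def gibbsAvg (N : Finset ι) (w f : ι → ℝ) : ℝ := (∑ u ∈ N, w u * f u) / ∑ u ∈ N, w u

theorem gibbsAvg_mono (hw : ∀ u ∈ N, 0 ≤ w u) (h : ∀ u ∈ N, f u ≤ g u) :
    gibbsAvg N w f ≤ gibbsAvg N w g :=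
  div_le_div_of_nonneg_right
    (Finset.sum_le_sum fun u hu => mul_le_mul_of_nonneg_left (h u hu) (hw u hu))
    (Finset.sum_nonneg hw)

theorem gibbsAvg_nonneg (hw : ∀ u ∈ N, 0 ≤ w u) (h : ∀ u ∈ N, 0 ≤ f u) : 0 ≤ gibbsAvg N w f :=
  div_nonneg (Finset.sum_nonneg fun u hu => mul_nonneg (hw u hu) (h u hu)) (Finset.sum_nonneg hw)

theorem gibbsAvg_const_mul (a : ℝ) : gibbsAvg N w (fun u => a * f u) = a * gibbsAvg N w f := by
  simp only [gibbsAvg, mul_left_comm _ a, ← Finset.mul_sum, mul_div_assoc]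

theorem gibbsAvg_add :
    gibbsAvg N w (fun u => f u + g u) = gibbsAvg N w f + gibbsAvg N w g := by
  simp only [gibbsAvg, mul_add, Finset.sum_add_distrib, add_div]

theorem gibbsAvg_sum {κ : Type*} (s : Finset κ) (f : κ → ι → ℝ) :
    gibbsAvg N w (fun u => ∑ j ∈ s, f j u) = ∑ j ∈ s, gibbsAvg N w (f j) := by
  simp only [gibbsAvg, Finset.mul_sum, ← Finset.sum_div]
  rw [Finset.sum_comm]

theorem gibbsAvg_const (hw : ∑ u ∈ N, w u ≠ 0) (a : ℝ) : gibbsAvg N w (fun _ => a) = a := by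
  rw [gibbsAvg, ← Finset.sum_mul, mul_div_cancel_left₀ _ hw]

theorem gibbsAvg_le_of_le {a : ℝ} (hw : ∀ u ∈ N, 0 ≤ w u) (hpos : ∑ u ∈ N, w u ≠ 0)
    (h : ∀ u ∈ N, f u ≤ a) : gibbsAvg N w f ≤ a :=
  (gibbsAvg_mono hw h).trans_eq (gibbsAvg_const hpos a)

theorem abs_gibbsAvg_le (hw : ∀ u ∈ N, 0 ≤ w u) (h : ∀ u ∈ N, |f u| ≤ g u) :
    |gibbsAvg N w f| ≤ gibbsAvg N w g := by
  rw [gibbsAvg, abs_div, abs_of_nonneg (Finset.sum_nonneg hw)]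
  refine div_le_div_of_nonneg_right ((Finset.abs_sum_le_sum_abs _ _).trans ?_)
    (Finset.sum_nonneg hw)
  refine Finset.sum_le_sum fun u hu => ?_
  rw [abs_mul, abs_of_nonneg (hw u hu)]
  exact mul_le_mul_of_nonneg_left (h u hu) (hw u hu)

/-- The covariance of `f` and `g` under the probability weights proportional to `w`. -/
noncomputable def gibbsCov (N : Finset ι) (w f g : ι → ℝ) : ℝ :=
  gibbsAvg N w (fun u => f u * g u) - gibbsAvg N w f * gibbsAvg N w g

/-- The third cumulant of `f` under the probability weights proportional to `w`, written with raw
moments. -/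
noncomputable def gibbsCumulantThree (N : Finset ι) (w f : ι → ℝ) : ℝ :=
  gibbsAvg N w (fun u => f u ^ 3) - 3 * (gibbsAvg N w (fun u => f u ^ 2) * gibbsAvg N w f) +
    2 * gibbsAvg N w f ^ 3

theorem sum_mul_sum_le_of_monovaryOn (hw : ∀ u ∈ N, 0 ≤ w u) (h : MonovaryOn f g N) :
    (∑ u ∈ N, w u * f u) * (∑ u ∈ N, w u * g u) ≤
      (∑ u ∈ N, w u) * ∑ u ∈ N, w u * (f u * g u) := by
  have nonneg : 0 ≤ ∑ u ∈ N, ∑ v ∈ N, w u * w v * ((f v - f u) * (g v - g u)) :=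
    Finset.sum_nonneg fun u hu => Finset.sum_nonneg fun v hv =>
      mul_nonneg (mul_nonneg (hw u hu) (hw v hv))
        (monovaryOn_iff_forall_mul_nonneg.1 h hu hv)
  have expand : ∑ u ∈ N, ∑ v ∈ N, w u * w v * ((f v - f u) * (g v - g u)) =
      2 * ((∑ u ∈ N, w u) * ∑ u ∈ N, w u * (f u * g u)) -
        2 * ((∑ u ∈ N, w u * f u) * (∑ u ∈ N, w u * g u)) := by
    calc _ = ∑ u ∈ N, ∑ v ∈ N, (w u * (w v * (f v * g v)) + w u * (f u * g u) * w v -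
          w u * f u * (w v * g v) - w u * g u * (w v * f v)) :=
          Finset.sum_congr rfl fun u _ => Finset.sum_congr rfl fun v _ => by ring
      _ = _ := by
          simp only [Finset.sum_sub_distrib, Finset.sum_add_distrib, ← Finset.sum_mul_sum]
          ring
  linarith

theorem gibbsAvg_mul_gibbsAvg_le_of_monovaryOn (hw : ∀ u ∈ N, 0 ≤ w u) (hpos : 0 < ∑ u ∈ N, w u)
    (h : MonovaryOn f g N) :
    gibbsAvg N w f * gibbsAvg N w g ≤ gibbsAvg N w (fun u => f u * g u) := by
  rw [gibbsAvg, gibbsAvg, gibbsAvg, div_mul_div_comm, div_le_div_iff₀ (by positivity) hpos]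
  nlinarith [sum_mul_sum_le_of_monovaryOn hw h]

theorem gibbsAvg_mul_le_of_antivaryOn {c e : ι → ℝ} (hc : ∀ u ∈ N, 0 ≤ c u)
    (hpos : 0 < ∑ u ∈ N, c u) (hpos' : 0 < ∑ u ∈ N, c u * e u) (h : AntivaryOn f e N) :
    gibbsAvg N (fun u => c u * e u) f ≤ gibbsAvg N c f := by
  have chebyshev := sum_mul_sum_le_of_monovaryOn hc h.neg_right
  simp only [Pi.neg_apply, mul_neg, Finset.sum_neg_distrib] at chebyshev
  rw [gibbsAvg, gibbsAvg, div_le_div_iff₀ hpos' hpos]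
  simp only [mul_assoc, mul_comm (e _)]
  linarith

theorem gibbsAvg_rpow_mul_le {v : ι → ℝ} {a b : ℝ} (hw : ∀ u ∈ N, 0 ≤ w u)
    (hpos : 0 < ∑ u ∈ N, w u) (hv : ∀ u ∈ N, 0 < v u) (ha : 0 ≤ a) (hb : 0 ≤ b) :
    gibbsAvg N w (fun u => v u ^ a) * gibbsAvg N w (fun u => v u ^ b) ≤
      gibbsAvg N w (fun u => v u ^ (a + b)) := by
  have monovary : MonovaryOn (fun u => v u ^ a) (fun u => v u ^ b) N := by
    refine monovaryOn_iff_forall_mul_nonneg.2 fun u hu u' hu' => ?_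
    rcases le_total (v u) (v u') with h | h
    · exact mul_nonneg (sub_nonneg.2 (Real.rpow_le_rpow (hv u hu).le h ha))
        (sub_nonneg.2 (Real.rpow_le_rpow (hv u hu).le h hb))
    · exact mul_nonneg_of_nonpos_of_nonpos
        (sub_nonpos.2 (Real.rpow_le_rpow (hv u' hu').le h ha))
        (sub_nonpos.2 (Real.rpow_le_rpow (hv u' hu').le h hb))
  exact (gibbsAvg_mul_gibbsAvg_le_of_monovaryOn hw hpos monovary).trans
    (gibbsAvg_mono hw fun u hu => (Real.rpow_add (hv u hu) a b).ge)

end Gibbs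

section PowerBounds

variable {ι : Type*} {N : Finset ι} {w v f g : ι → ℝ} {a b J K : ℝ}

theorem abs_gibbsAvg_le_rpow (hw : ∀ u ∈ N, 0 ≤ w u) (hf : ∀ u ∈ N, |f u| ≤ J * v u ^ a) :
    |gibbsAvg N w f| ≤ J * gibbsAvg N w (fun u => v u ^ a) :=
  (abs_gibbsAvg_le hw hf).trans_eq (gibbsAvg_const_mul J)

theorem abs_mul_le_rpow_add {x y r : ℝ} (hr : 0 < r) (hx : |x| ≤ J * r ^ a)
    (hy : |y| ≤ K * r ^ b) : |x * y| ≤ J * K * r ^ (a + b) :=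
  calc |x * y| = |x| * |y| := abs_mul x y
    _ ≤ (J * r ^ a) * (K * r ^ b) :=
      mul_le_mul hx hy (abs_nonneg _) ((abs_nonneg _).trans hx)
    _ = J * K * r ^ (a + b) := by rw [Real.rpow_add hr]; ring

theorem abs_gibbsAvg_mul_le (hw : ∀ u ∈ N, 0 ≤ w u) (hv : ∀ u ∈ N, 0 < v u)
    (hf : ∀ u ∈ N, |f u| ≤ J * v u ^ a) (hg : ∀ u ∈ N, |g u| ≤ K * v u ^ b) :
    |gibbsAvg N w (fun u => f u * g u)| ≤ J * K * gibbsAvg N w (fun u => v u ^ (a + b)) :=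
  abs_gibbsAvg_le_rpow hw fun u hu => abs_mul_le_rpow_add (hv u hu) (hf u hu) (hg u hu)

theorem abs_gibbsAvg_mul_gibbsAvg_le (hw : ∀ u ∈ N, 0 ≤ w u) (hpos : 0 < ∑ u ∈ N, w u)
    (hv : ∀ u ∈ N, 0 < v u) (ha : 0 ≤ a) (hb : 0 ≤ b) (hJ : 0 ≤ J) (hK : 0 ≤ K)
    (hf : ∀ u ∈ N, |f u| ≤ J * v u ^ a) (hg : ∀ u ∈ N, |g u| ≤ K * v u ^ b) :
    |gibbsAvg N w f * gibbsAvg N w g| ≤ J * K * gibbsAvg N w (fun u => v u ^ (a + b)) :=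
  calc |gibbsAvg N w f * gibbsAvg N w g|
      = |gibbsAvg N w f| * |gibbsAvg N w g| := abs_mul _ _
    _ ≤ (J * gibbsAvg N w (fun u => v u ^ a)) * (K * gibbsAvg N w (fun u => v u ^ b)) :=
        mul_le_mul (abs_gibbsAvg_le_rpow hw hf) (abs_gibbsAvg_le_rpow hw hg) (abs_nonneg _)
          ((abs_nonneg _).trans (abs_gibbsAvg_le_rpow hw hf))
    _ = J * K * (gibbsAvg N w (fun u => v u ^ a) * gibbsAvg N w (fun u => v u ^ b)) := by ring
    _ ≤ J * K * gibbsAvg N w (fun u => v u ^ (a + b)) := by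
        gcongr; exact gibbsAvg_rpow_mul_le hw hpos hv ha hb

theorem abs_gibbsCov_le (hw : ∀ u ∈ N, 0 ≤ w u) (hpos : 0 < ∑ u ∈ N, w u)
    (hv : ∀ u ∈ N, 0 < v u) (ha : 0 ≤ a) (hb : 0 ≤ b) (hJ : 0 ≤ J) (hK : 0 ≤ K)
    (hf : ∀ u ∈ N, |f u| ≤ J * v u ^ a) (hg : ∀ u ∈ N, |g u| ≤ K * v u ^ b) :
    |gibbsCov N w f g| ≤ 2 * (J * K * gibbsAvg N w (fun u => v u ^ (a + b))) := by
  refine (abs_sub _ _).trans ?_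
  linarith [abs_gibbsAvg_mul_le hw hv hf hg,
    abs_gibbsAvg_mul_gibbsAvg_le hw hpos hv ha hb hJ hK hf hg]

theorem abs_gibbsAvg_pow_three_le (hw : ∀ u ∈ N, 0 ≤ w u) (hpos : 0 < ∑ u ∈ N, w u)
    (hv : ∀ u ∈ N, 0 < v u) (ha : 0 ≤ a) (hJ : 0 ≤ J) (hf : ∀ u ∈ N, |f u| ≤ J * v u ^ a) :
    |gibbsAvg N w f| ^ 3 ≤ J ^ 3 * gibbsAvg N w (fun u => v u ^ (3 * a)) := by
  set E : ℝ → ℝ := fun b => gibbsAvg N w (fun u => v u ^ b)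
  have E_nonneg : 0 ≤ E a := gibbsAvg_nonneg hw fun u hu => (Real.rpow_pos_of_pos (hv u hu) a).le
  have mul_E {b : ℝ} (hb : 0 ≤ b) : E a * E b ≤ E (a + b) := gibbsAvg_rpow_mul_le hw hpos hv ha hb
  calc |gibbsAvg N w f| ^ 3 ≤ (J * E a) ^ 3 := by gcongr; exact abs_gibbsAvg_le_rpow hw hf
    _ = J ^ 3 * (E a * (E a * E a)) := by ring
    _ ≤ J ^ 3 * (E a * E (a + a)) := by gcongr; exact mul_E ha
    _ ≤ J ^ 3 * E (a + (a + a)) := by gcongr; exact mul_E (by positivity)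
    _ = J ^ 3 * E (3 * a) := by congr 2; ring

theorem abs_gibbsAvg_sq_mul_le (hw : ∀ u ∈ N, 0 ≤ w u) (hpos : 0 < ∑ u ∈ N, w u)
    (hv : ∀ u ∈ N, 0 < v u) (ha : 0 ≤ a) (hJ : 0 ≤ J) (hf : ∀ u ∈ N, |f u| ≤ J * v u ^ a) :
    |gibbsAvg N w (fun u => f u ^ 2) * gibbsAvg N w f| ≤
      J ^ 3 * gibbsAvg N w (fun u => v u ^ (3 * a)) := by
  have hf₂ : ∀ u ∈ N, |f u ^ 2| ≤ (J * J) * v u ^ (a + a) := fun u hu => by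
    rw [sq]; exact abs_mul_le_rpow_add (hv u hu) (hf u hu) (hf u hu)
  refine (abs_gibbsAvg_mul_gibbsAvg_le hw hpos hv (add_nonneg ha ha) ha (mul_nonneg hJ hJ) hJ
    hf₂ hf).trans_eq ?_
  rw [show a + a + a = 3 * a by ring]
  ring

theorem abs_gibbsCumulantThree_le (hw : ∀ u ∈ N, 0 ≤ w u) (hpos : 0 < ∑ u ∈ N, w u)
    (hv : ∀ u ∈ N, 0 < v u) (ha : 0 ≤ a) (hJ : 0 ≤ J) (hf : ∀ u ∈ N, |f u| ≤ J * v u ^ a) :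
    |gibbsCumulantThree N w f| ≤ 6 * (J ^ 3 * gibbsAvg N w (fun u => v u ^ (3 * a))) := by
  have cube : |gibbsAvg N w (fun u => f u ^ 3)| ≤
      J ^ 3 * gibbsAvg N w (fun u => v u ^ (3 * a)) :=
    abs_gibbsAvg_le_rpow hw fun u hu => by
      calc |f u ^ 3| = |f u| ^ 3 := abs_pow _ _
        _ ≤ (J * v u ^ a) ^ 3 := by gcongr; exact hf u hu
        _ = J ^ 3 * v u ^ (3 * a) := by
          rw [mul_pow, mul_comm 3 a, Real.rpow_mul (hv u hu).le]; norm_num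
  have sq_mul := abs_gibbsAvg_sq_mul_le hw hpos hv ha hJ hf
  have pow_three := abs_gibbsAvg_pow_three_le hw hpos hv ha hJ hf
  rw [← abs_pow] at pow_three
  rw [gibbsCumulantThree, abs_le]
  rw [abs_le] at cube sq_mul pow_three
  constructor <;> linarith

end PowerBounds

section ThreeDerivs

/-- A function `f` on the line together with its derivatives `f₁, f₂, f₃` of orders one to three,
kept as data so that they can be computed by hand. -/
structure HasThreeDerivs (f f₁ f₂ f₃ : ℝ → ℝ) : Prop where
  first : ∀ x, HasDerivAt f (f₁ x) x
  second : ∀ x, HasDerivAt f₁ (f₂ x) x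
  third : ∀ x, HasDerivAt f₂ (f₃ x) x

theorem hasThreeDerivs_of_contDiff {f : ℝ → ℝ} (hf : ContDiff ℝ 3 f) :
    HasThreeDerivs f (iteratedDeriv 1 f) (iteratedDeriv 2 f) (iteratedDeriv 3 f) := by
  have step (k : ℕ) (hk : k < 3) (x : ℝ) :
      HasDerivAt (iteratedDeriv k f) (iteratedDeriv (k + 1) f x) x := by
    rw [iteratedDeriv_succ]
    exact (hf.differentiable_iteratedDeriv k (by exact_mod_cast hk) x).hasDerivAt
  exact ⟨fun x => by simpa using step 0 (by norm_num) x, step 1 (by norm_num),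
    step 2 (by norm_num)⟩

variable {f f₁ f₂ f₃ φ φ₁ φ₂ φ₃ : ℝ → ℝ}

theorem HasThreeDerivs.comp (hφ : HasThreeDerivs φ φ₁ φ₂ φ₃) (hf : HasThreeDerivs f f₁ f₂ f₃) :
    HasThreeDerivs (fun t => φ (f t)) (fun t => φ₁ (f t) * f₁ t)
      (fun t => φ₂ (f t) * f₁ t ^ 2 + φ₁ (f t) * f₂ t)
      (fun t => φ₃ (f t) * f₁ t ^ 3 + 3 * φ₂ (f t) * (f₁ t * f₂ t) + φ₁ (f t) * f₃ t) := by
  have dφ₁ (t : ℝ) := (hφ.second (f t)).comp t (hf.first t)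
  have dφ₂ (t : ℝ) := (hφ.third (f t)).comp t (hf.first t)
  refine ⟨fun t => (hφ.first (f t)).comp t (hf.first t), fun t => ?_, fun t => ?_⟩
  · exact ((dφ₁ t).mul (hf.second t)).congr_deriv (by rw [Function.comp_apply]; ring)
  · refine (((dφ₂ t).mul ((hf.second t).pow 2)).add ((dφ₁ t).mul (hf.third t))).congr_deriv ?_
    simp only [Function.comp_apply, Pi.pow_apply]
    ring

theorem hasThreeDerivs_line (b y : ℝ) :
    HasThreeDerivs (fun t => b + t * y) (fun _ => y) (fun _ => 0) (fun _ => 0) :=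
  ⟨fun t => by simpa using ((hasDerivAt_id t).mul_const y).const_add b,
    fun t => hasDerivAt_const t y, fun t => hasDerivAt_const t 0⟩

theorem HasThreeDerivs.comp_line (hf : HasThreeDerivs f f₁ f₂ f₃) (b y : ℝ) :
    HasThreeDerivs (fun t => f (b + t * y)) (fun t => f₁ (b + t * y) * y)
      (fun t => f₂ (b + t * y) * y ^ 2) (fun t => f₃ (b + t * y) * y ^ 3) := by
  simpa using hf.comp (hasThreeDerivs_line b y)

theorem abs_sub_apply_zero_le {F F' : ℝ → ℝ} {K : ℝ} (hF : ∀ t, HasDerivAt F (F' t) t)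
    (hK : ∀ t ∈ Icc (0 : ℝ) 1, |F' t| ≤ K) {t : ℝ} (ht : t ∈ Icc (0 : ℝ) 1) :
    |F t - F 0| ≤ K := by
  have mean_value := (convex_Icc (0 : ℝ) 1).norm_image_sub_le_of_norm_hasDerivWithin_le
    (fun x _ => (hF x).hasDerivWithinAt) hK (left_mem_Icc.2 zero_le_one) ht
  rw [Real.norm_eq_abs, Real.norm_eq_abs, sub_zero, abs_of_nonneg ht.1] at mean_value
  exact mean_value.trans (mul_le_of_le_one_right ((abs_nonneg _).trans (hK t ht)) ht.2)

theorem HasThreeDerivs.abs_taylor_le (hf : HasThreeDerivs f f₁ f₂ f₃) {K : ℝ}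
    (hK : ∀ t ∈ Icc (0 : ℝ) 1, |f₃ t| ≤ K) : |f 1 - f 0 - f₁ 0 - f₂ 0 / 2| ≤ K := by
  have bound₂ (t : ℝ) (ht : t ∈ Icc (0 : ℝ) 1) : |f₂ t - f₂ 0| ≤ K :=
    abs_sub_apply_zero_le hf.third hK ht
  have bound₁ (t : ℝ) (ht : t ∈ Icc (0 : ℝ) 1) : |f₁ t - f₁ 0 - f₂ 0 * t| ≤ K := by
    have := abs_sub_apply_zero_le (F := fun t => f₁ t - f₂ 0 * t)
      (fun t => ((hf.second t).fun_sub ((hasDerivAt_id t).const_mul (f₂ 0))).congr_deriv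
        (by rw [mul_one])) bound₂ ht
    simpa [sub_right_comm] using this
  have bound₀ := abs_sub_apply_zero_le (F := fun t => f t - f₁ 0 * t - f₂ 0 * (t ^ 2 / 2))
    (fun t => (((hf.first t).fun_sub ((hasDerivAt_id t).const_mul (f₁ 0))).fun_sub
      ((((hasDerivAt_id t).fun_pow 2).div_const 2).const_mul (f₂ 0))).congr_deriv (by simp))
    bound₁ (right_mem_Icc.2 zero_le_one)
  convert bound₀ using 2
  ring

end ThreeDerivs

section FreeEnergy

variable {ι : Type*} {N : Finset ι} {c : ι → ℝ} {s : ℝ}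

/-- The Gibbs weight `c u * exp (-s * z u)` with a priori weight `c`, inverse temperature `s` and
energy `z`. -/
noncomputable def gibbsWeight (c : ι → ℝ) (s : ℝ) (z : ι → ℝ) (u : ι) : ℝ :=
  c u * Real.exp (-s * z u)

/-- The soft minimum of `z` over `N` at inverse temperature `s`. -/
noncomputable def freeEnergy (N : Finset ι) (c : ι → ℝ) (s : ℝ) (z : ι → ℝ) : ℝ :=
  -(1 / s) * Real.log (∑ u ∈ N, gibbsWeight c s z u)

theorem gibbsWeight_pos (hc : ∀ u ∈ N, 0 < c u) (z : ι → ℝ) : ∀ u ∈ N, 0 < gibbsWeight c s z u :=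
  fun u hu => mul_pos (hc u hu) (Real.exp_pos _)

theorem sum_gibbsWeight_pos (hN : N.Nonempty) (hc : ∀ u ∈ N, 0 < c u) (z : ι → ℝ) :
    0 < ∑ u ∈ N, gibbsWeight c s z u :=
  Finset.sum_pos (gibbsWeight_pos hc z) hN

theorem gibbsAvg_gibbsWeight_rpow_le {ℓ : ι → ℝ} {Q : ℝ} (hN : N.Nonempty)
    (hc : ∀ u ∈ N, 0 < c u) (hs : 0 ≤ s) (hQ : 0 ≤ Q) (hℓ : ∀ u ∈ N, 0 ≤ 1 + ℓ u) :
    gibbsAvg N (gibbsWeight c s ℓ) (fun u => (1 + ℓ u) ^ Q) ≤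
      gibbsAvg N c (fun u => (1 + ℓ u) ^ Q) := by
  refine gibbsAvg_mul_le_of_antivaryOn (fun u hu => (hc u hu).le) (Finset.sum_pos hc hN)
    (sum_gibbsWeight_pos hN hc ℓ) fun u _ v hv huv => ?_
  have hle : ℓ v ≤ ℓ u := by
    by_contra! hlt
    exact (Real.exp_lt_exp.1 huv).not_ge (by nlinarith)
  exact Real.rpow_le_rpow (hℓ v hv) (by linarith) hQ

variable {f f₁ f₂ f₃ : ι → ℝ → ℝ}

theorem hasDerivAt_gibbsWeight {u : ι} {t : ℝ} (hf : HasDerivAt (f u) (f₁ u t) t) :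
    HasDerivAt (fun t => gibbsWeight c s (f · t) u)
      (-s * (f₁ u t * gibbsWeight c s (f · t) u)) t :=
  (((hf.const_mul (-s)).exp).const_mul (c u)).congr_deriv (by rw [gibbsWeight]; ring)

theorem hasDerivAt_sum_gibbsWeight {t : ℝ} (hf : ∀ u ∈ N, HasDerivAt (f u) (f₁ u t) t) :
    HasDerivAt (fun t => ∑ u ∈ N, gibbsWeight c s (f · t) u)
      (-s * ∑ u ∈ N, gibbsWeight c s (f · t) u * f₁ u t) t := by
  refine (HasDerivAt.fun_sum fun u hu => hasDerivAt_gibbsWeight (hf u hu)).congr_deriv ?_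
  rw [Finset.mul_sum]
  exact Finset.sum_congr rfl fun u _ => by ring

theorem hasDerivAt_gibbsAvg {g g₁ : ι → ℝ → ℝ} {t : ℝ} (hN : N.Nonempty)
    (hc : ∀ u ∈ N, 0 < c u) (hf : ∀ u ∈ N, HasDerivAt (f u) (f₁ u t) t)
    (hg : ∀ u ∈ N, HasDerivAt (g u) (g₁ u t) t) :
    HasDerivAt (fun t => gibbsAvg N (gibbsWeight c s (f · t)) (g · t))
      (gibbsAvg N (gibbsWeight c s (f · t)) (g₁ · t) -
        s * gibbsCov N (gibbsWeight c s (f · t)) (f₁ · t) (g · t)) t := by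
  have hne := (sum_gibbsWeight_pos (s := s) hN hc (f · t)).ne'
  have numerator : HasDerivAt (fun t => ∑ u ∈ N, gibbsWeight c s (f · t) u * g u t)
      (∑ u ∈ N, gibbsWeight c s (f · t) u * g₁ u t -
        s * ∑ u ∈ N, gibbsWeight c s (f · t) u * (f₁ u t * g u t)) t := by
    refine (HasDerivAt.fun_sum fun u hu =>
      (hasDerivAt_gibbsWeight (hf u hu)).mul (hg u hu)).congr_deriv ?_
    rw [Finset.mul_sum, ← Finset.sum_sub_distrib]
    exact Finset.sum_congr rfl fun u _ => by ring
  refine (numerator.div (hasDerivAt_sum_gibbsWeight hf) hne).congr_deriv ?_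
  simp only [gibbsCov, gibbsAvg]
  field_simp
  ring

theorem hasDerivAt_freeEnergy {t : ℝ} (hN : N.Nonempty) (hc : ∀ u ∈ N, 0 < c u) (hs : s ≠ 0)
    (hf : ∀ u ∈ N, HasDerivAt (f u) (f₁ u t) t) :
    HasDerivAt (fun t => freeEnergy N c s (f · t))
      (gibbsAvg N (gibbsWeight c s (f · t)) (f₁ · t)) t := by
  have hne := (sum_gibbsWeight_pos (s := s) hN hc (f · t)).ne'
  refine (((hasDerivAt_sum_gibbsWeight hf).log hne).const_mul (-(1 / s))).congr_deriv ?_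
  rw [gibbsAvg]
  field_simp

theorem hasDerivAt_gibbsCov_self {t : ℝ} (hN : N.Nonempty) (hc : ∀ u ∈ N, 0 < c u)
    (hf : ∀ u ∈ N, HasDerivAt (f u) (f₁ u t) t) (hf₁ : ∀ u ∈ N, HasDerivAt (f₁ u) (f₂ u t) t) :
    HasDerivAt (fun t => gibbsCov N (gibbsWeight c s (f · t)) (f₁ · t) (f₁ · t))
      (2 * gibbsCov N (gibbsWeight c s (f · t)) (f₁ · t) (f₂ · t) -
        s * gibbsCumulantThree N (gibbsWeight c s (f · t)) (f₁ · t)) t := by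
  have second_moment := hasDerivAt_gibbsAvg (s := s) (g := fun u t => f₁ u t * f₁ u t)
    (g₁ := fun u t => f₂ u t * f₁ u t + f₁ u t * f₂ u t) hN hc hf
    (fun u hu => (hf₁ u hu).fun_mul (hf₁ u hu))
  have mean := hasDerivAt_gibbsAvg (s := s) hN hc hf hf₁
  refine (second_moment.fun_sub (mean.fun_mul mean)).congr_deriv ?_
  have fold_twice :
      gibbsAvg N (gibbsWeight c s (f · t)) (fun u => f₂ u t * f₁ u t + f₁ u t * f₂ u t) =
      2 * gibbsAvg N (gibbsWeight c s (f · t)) (fun u => f₁ u t * f₂ u t) := by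
    rw [← gibbsAvg_const_mul]
    exact congrArg _ (funext fun u => by ring)
  simp only [fold_twice, gibbsCov, gibbsCumulantThree, pow_succ, pow_zero, one_mul, mul_assoc]
  ring

theorem hasThreeDerivs_freeEnergy (hN : N.Nonempty) (hc : ∀ u ∈ N, 0 < c u) (hs : s ≠ 0)
    (hf : ∀ u ∈ N, HasThreeDerivs (f u) (f₁ u) (f₂ u) (f₃ u)) :
    HasThreeDerivs (fun t => freeEnergy N c s (f · t))
      (fun t => gibbsAvg N (gibbsWeight c s (f · t)) (f₁ · t))
      (fun t => gibbsAvg N (gibbsWeight c s (f · t)) (f₂ · t) -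
        s * gibbsCov N (gibbsWeight c s (f · t)) (f₁ · t) (f₁ · t))
      (fun t => gibbsAvg N (gibbsWeight c s (f · t)) (f₃ · t) -
        3 * s * gibbsCov N (gibbsWeight c s (f · t)) (f₁ · t) (f₂ · t) +
        s ^ 2 * gibbsCumulantThree N (gibbsWeight c s (f · t)) (f₁ · t)) := by
  have d₀ (t : ℝ) : ∀ u ∈ N, HasDerivAt (f u) (f₁ u t) t := fun u hu => (hf u hu).first t
  have d₁ (t : ℝ) : ∀ u ∈ N, HasDerivAt (f₁ u) (f₂ u t) t := fun u hu => (hf u hu).second t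
  have d₂ (t : ℝ) : ∀ u ∈ N, HasDerivAt (f₂ u) (f₃ u t) t := fun u hu => (hf u hu).third t
  refine ⟨fun t => hasDerivAt_freeEnergy hN hc hs (d₀ t), fun t =>
    hasDerivAt_gibbsAvg hN hc (d₀ t) (d₁ t), fun t => ?_⟩
  refine ((hasDerivAt_gibbsAvg hN hc (d₀ t) (d₂ t)).fun_sub
    ((hasDerivAt_gibbsCov_self hN hc (d₀ t) (d₁ t)).const_mul s)).congr_deriv ?_
  ring

end FreeEnergy

section ThirdDerivative

variable {ι : Type*} {N : Finset ι} {w v f₁ f₂ f₃ : ι → ℝ} {a b e Q J₁ J₂ J₃ s : ℝ}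

theorem gibbsAvg_rpow_le_rpow (hw : ∀ u ∈ N, 0 ≤ w u) (hv : ∀ u ∈ N, 1 ≤ v u) (h : a ≤ Q) :
    gibbsAvg N w (fun u => v u ^ a) ≤ gibbsAvg N w (fun u => v u ^ Q) :=
  gibbsAvg_mono hw fun u hu => Real.rpow_le_rpow_of_exponent_le (hv u hu) h

theorem abs_freeEnergy_deriv_mul_deriv_two_le (hw : ∀ u ∈ N, 0 ≤ w u) (hpos : 0 < ∑ u ∈ N, w u)
    (hv : ∀ u ∈ N, 1 ≤ v u) (hs : 0 ≤ s) (ha : 0 ≤ a) (hb : 0 ≤ b) (h₁ : 3 * a ≤ Q)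
    (h₂ : a + b ≤ Q) (hJ₁ : 0 ≤ J₁) (hJ₂ : 0 ≤ J₂) (hf₁ : ∀ u ∈ N, |f₁ u| ≤ J₁ * v u ^ a)
    (hf₂ : ∀ u ∈ N, |f₂ u| ≤ J₂ * v u ^ b) :
    |gibbsAvg N w f₁ * (gibbsAvg N w f₂ - s * gibbsCov N w f₁ f₁)| ≤
      (J₁ * J₂ + 2 * s * J₁ ^ 3) * gibbsAvg N w (fun u => v u ^ Q) := by
  have hv₀ : ∀ u ∈ N, 0 < v u := fun u hu => one_pos.trans_le (hv u hu)
  set E := gibbsAvg N w (fun u => v u ^ Q)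
  have cube_le : J₁ ^ 3 * gibbsAvg N w (fun u => v u ^ (3 * a)) ≤ J₁ ^ 3 * E := by
    gcongr; exact gibbsAvg_rpow_le_rpow hw hv h₁
  have cross : |gibbsAvg N w f₁ * gibbsAvg N w f₂| ≤ J₁ * J₂ * E :=
    (abs_gibbsAvg_mul_gibbsAvg_le hw hpos hv₀ ha hb hJ₁ hJ₂ hf₁ hf₂).trans
      (by gcongr; exact gibbsAvg_rpow_le_rpow hw hv h₂)
  have sq_mul := (abs_gibbsAvg_sq_mul_le hw hpos hv₀ ha hJ₁ hf₁).trans cube_le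
  have cube := (abs_gibbsAvg_pow_three_le hw hpos hv₀ ha hJ₁ hf₁).trans cube_le
  have cov : |gibbsAvg N w f₁ * gibbsCov N w f₁ f₁| ≤ 2 * (J₁ ^ 3 * E) := by
    rw [← abs_pow] at cube
    have split : gibbsAvg N w f₁ * gibbsCov N w f₁ f₁ =
        gibbsAvg N w (fun u => f₁ u ^ 2) * gibbsAvg N w f₁ - gibbsAvg N w f₁ ^ 3 := by
      simp only [gibbsCov, sq]; ring
    rw [split]
    exact (abs_sub _ _).trans (by linarith)
  calc _ = |gibbsAvg N w f₁ * gibbsAvg N w f₂ -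
          s * (gibbsAvg N w f₁ * gibbsCov N w f₁ f₁)| := by congr 1; ring
    _ ≤ |gibbsAvg N w f₁ * gibbsAvg N w f₂| + s * |gibbsAvg N w f₁ * gibbsCov N w f₁ f₁| := by
        rw [← abs_of_nonneg hs, ← abs_mul, abs_of_nonneg hs]; exact abs_sub _ _
    _ ≤ J₁ * J₂ * E + s * (2 * (J₁ ^ 3 * E)) := by gcongr
    _ = _ := by ring

theorem abs_freeEnergy_deriv_three_le (hw : ∀ u ∈ N, 0 ≤ w u) (hpos : 0 < ∑ u ∈ N, w u)
    (hv : ∀ u ∈ N, 1 ≤ v u) (hs : 0 ≤ s) (ha : 0 ≤ a) (hb : 0 ≤ b) (h₁ : 3 * a ≤ Q)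
    (h₂ : a + b ≤ Q) (h₃ : e ≤ Q) (hJ₁ : 0 ≤ J₁) (hJ₂ : 0 ≤ J₂) (hJ₃ : 0 ≤ J₃)
    (hf₁ : ∀ u ∈ N, |f₁ u| ≤ J₁ * v u ^ a) (hf₂ : ∀ u ∈ N, |f₂ u| ≤ J₂ * v u ^ b)
    (hf₃ : ∀ u ∈ N, |f₃ u| ≤ J₃ * v u ^ e) :
    |gibbsAvg N w f₃ - 3 * s * gibbsCov N w f₁ f₂ + s ^ 2 * gibbsCumulantThree N w f₁| ≤
      (J₃ + 6 * s * (J₁ * J₂) + 6 * s ^ 2 * J₁ ^ 3) * gibbsAvg N w (fun u => v u ^ Q) := by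
  have hv₀ : ∀ u ∈ N, 0 < v u := fun u hu => one_pos.trans_le (hv u hu)
  have mono {x : ℝ} (hx : x ≤ Q) := gibbsAvg_rpow_le_rpow hw hv hx
  set E := gibbsAvg N w (fun u => v u ^ Q)
  have mean : |gibbsAvg N w f₃| ≤ J₃ * E :=
    (abs_gibbsAvg_le_rpow hw hf₃).trans (by gcongr; exact mono h₃)
  have cov : |gibbsCov N w f₁ f₂| ≤ 2 * (J₁ * J₂ * E) :=
    (abs_gibbsCov_le hw hpos hv₀ ha hb hJ₁ hJ₂ hf₁ hf₂).trans (by gcongr; exact mono h₂)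
  have cumulant : |gibbsCumulantThree N w f₁| ≤ 6 * (J₁ ^ 3 * E) :=
    (abs_gibbsCumulantThree_le hw hpos hv₀ ha hJ₁ hf₁).trans (by gcongr; exact mono h₁)
  calc _ ≤ |gibbsAvg N w f₃| + |3 * s * gibbsCov N w f₁ f₂| +
          |s ^ 2 * gibbsCumulantThree N w f₁| :=
        (abs_add_le _ _).trans (add_le_add_left (abs_sub _ _) _)
    _ = |gibbsAvg N w f₃| + 3 * s * |gibbsCov N w f₁ f₂| +
          s ^ 2 * |gibbsCumulantThree N w f₁| := by
        rw [abs_mul, abs_mul (s ^ 2), abs_of_nonneg (by positivity : 0 ≤ 3 * s),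
          abs_of_nonneg (by positivity : 0 ≤ s ^ 2)]
    _ ≤ J₃ * E + 3 * s * (2 * (J₁ * J₂ * E)) + s ^ 2 * (6 * (J₁ ^ 3 * E)) := by gcongr
    _ = _ := by ring

theorem abs_comp_freeEnergy_deriv_three_le {κ p₁ p₂ p₃ : ℝ} (hp₁ : |p₁| ≤ κ) (hp₂ : |p₂| ≤ κ)
    (hp₃ : |p₃| ≤ κ) (hw : ∀ u ∈ N, 0 ≤ w u) (hpos : 0 < ∑ u ∈ N, w u) (hv : ∀ u ∈ N, 1 ≤ v u)
    (hs : 0 ≤ s) (ha : 0 ≤ a) (hb : 0 ≤ b) (h₁ : 3 * a ≤ Q)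
    (h₂ : a + b ≤ Q) (h₃ : e ≤ Q) (hJ₁ : 0 ≤ J₁) (hJ₂ : 0 ≤ J₂) (hJ₃ : 0 ≤ J₃)
    (hf₁ : ∀ u ∈ N, |f₁ u| ≤ J₁ * v u ^ a) (hf₂ : ∀ u ∈ N, |f₂ u| ≤ J₂ * v u ^ b)
    (hf₃ : ∀ u ∈ N, |f₃ u| ≤ J₃ * v u ^ e) :
    |p₃ * gibbsAvg N w f₁ ^ 3 +
        3 * p₂ * (gibbsAvg N w f₁ * (gibbsAvg N w f₂ - s * gibbsCov N w f₁ f₁)) +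
        p₁ * (gibbsAvg N w f₃ - 3 * s * gibbsCov N w f₁ f₂ +
          s ^ 2 * gibbsCumulantThree N w f₁)| ≤
      κ * ((1 + 6 * s + 6 * s ^ 2) * J₁ ^ 3 + (3 + 6 * s) * (J₁ * J₂) + J₃) *
        gibbsAvg N w (fun u => v u ^ Q) := by
  have hκ : 0 ≤ κ := (abs_nonneg _).trans hp₁
  have hv₀ : ∀ u ∈ N, 0 < v u := fun u hu => one_pos.trans_le (hv u hu)
  set E := gibbsAvg N w (fun u => v u ^ Q) with hE
  have cube : |gibbsAvg N w f₁ ^ 3| ≤ J₁ ^ 3 * E := by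
    rw [abs_pow]
    exact (abs_gibbsAvg_pow_three_le hw hpos hv₀ ha hJ₁ hf₁).trans
      (by gcongr; exact gibbsAvg_rpow_le_rpow hw hv h₁)
  have product := abs_freeEnergy_deriv_mul_deriv_two_le hw hpos hv hs ha hb h₁ h₂ hJ₁ hJ₂ hf₁ hf₂
  have third :=
    abs_freeEnergy_deriv_three_le hw hpos hv hs ha hb h₁ h₂ h₃ hJ₁ hJ₂ hJ₃ hf₁ hf₂ hf₃
  rw [← hE] at product third
  calc _ ≤ |p₃ * gibbsAvg N w f₁ ^ 3| +
          |3 * p₂ * (gibbsAvg N w f₁ * (gibbsAvg N w f₂ - s * gibbsCov N w f₁ f₁))| +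
          |p₁ * (gibbsAvg N w f₃ - 3 * s * gibbsCov N w f₁ f₂ +
            s ^ 2 * gibbsCumulantThree N w f₁)| :=
        (abs_add_le _ _).trans (add_le_add_left (abs_add_le _ _) _)
    _ ≤ κ * (J₁ ^ 3 * E) + 3 * κ * ((J₁ * J₂ + 2 * s * J₁ ^ 3) * E) +
          κ * ((J₃ + 6 * s * (J₁ * J₂) + 6 * s ^ 2 * J₁ ^ 3) * E) := by
        rw [abs_mul p₃, abs_mul (3 * p₂), abs_mul 3, abs_mul p₁, abs_of_pos (three_pos (α := ℝ))]
        gcongr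
    _ = _ := by ring

end ThirdDerivative

section SmoothLoss

/-- A nonnegative `C³` loss with self-bounded derivatives and polynomial growth: the class to which
the approximations `ℓ_{i;ρ}` belong, with constant `D = 𝒟_ℓ(ρ)`. -/
structure SmoothLoss (q : Fin 4 → ℝ) (D Λ : ℝ) (ℓ : ℝ → ℝ) : Prop where
  nonneg : ∀ x, 0 ≤ ℓ x
  contDiff : ContDiff ℝ 3 ℓ
  deriv_le : ∀ k : Fin 4, k ≠ 0 → ∀ x, |iteratedDeriv (k : ℕ) ℓ x| ≤ D * (1 + ℓ x ^ q k)
  growth : ∀ x, ℓ x ≤ Λ * (2 + |x| ^ q 0)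

/-- A `C³` test function with values in `[0, 1]` whose first three derivatives are bounded
by `κ`. -/
structure SmoothTest (κ : ℝ) (φ : ℝ → ℝ) : Prop where
  mem_Icc : ∀ x, φ x ∈ Icc (0 : ℝ) 1
  contDiff : ContDiff ℝ 3 φ
  deriv_le : ∀ k ∈ Finset.Icc 1 3, ∀ x, |iteratedDeriv k φ x| ≤ κ

variable {q : Fin 4 → ℝ} {D Λ κ s Y : ℝ} {ℓ φ : ℝ → ℝ}

theorem SmoothTest.bound_nonneg (hφ : SmoothTest κ φ) : 0 ≤ κ :=
  (abs_nonneg _).trans (hφ.deriv_le 1 (by simp) 0)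

theorem bigQ_nonneg (hq : ∀ k, 0 ≤ q k) : 0 ≤ bigQ q :=
  (mul_nonneg three_pos.le (hq 1)).trans (le_max_left _ _)

theorem q_zero_mul_bigQ_le_qBar (q : Fin 4 → ℝ) : q 0 * bigQ q ≤ qBar q := by
  have := Nat.le_ceil (q 0 * bigQ q / 2)
  rw [qBar]
  push_cast
  linarith

theorem even_qBar (q : Fin 4 → ℝ) : Even (qBar q) := even_two_mul _

theorem SmoothLoss.abs_deriv_mul_pow_le (hℓ : SmoothLoss q D Λ ℓ) (hq : ∀ k, 0 ≤ q k) (hD : 0 ≤ D)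
    {k : Fin 4} (hk : k ≠ 0) (x : ℝ) {y : ℝ} (hy : |y| ≤ Y) :
    |iteratedDeriv k ℓ x * y ^ (k : ℕ)| ≤ 2 * D * Y ^ (k : ℕ) * (1 + ℓ x) ^ q k := by
  have h₀ := hℓ.nonneg x
  have rpow_le : ℓ x ^ q k ≤ (1 + ℓ x) ^ q k := Real.rpow_le_rpow h₀ (by linarith) (hq k)
  have one_le : 1 ≤ (1 + ℓ x) ^ q k := Real.one_le_rpow (by linarith) (hq k)
  have hY : 0 ≤ Y := (abs_nonneg y).trans hy
  calc |iteratedDeriv k ℓ x * y ^ (k : ℕ)| = |iteratedDeriv k ℓ x| * |y| ^ (k : ℕ) := by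
        rw [abs_mul, abs_pow]
    _ ≤ D * (1 + ℓ x ^ q k) * Y ^ (k : ℕ) := by
        gcongr
        exact hℓ.deriv_le k hk x
    _ ≤ D * (2 * (1 + ℓ x) ^ q k) * Y ^ (k : ℕ) := by gcongr; linarith
    _ = _ := by ring

theorem rpow_le_of_le_mul_add_rpow {x r a e : ℝ} {m : ℕ} (hΛ : 0 ≤ Λ) (ha : 0 ≤ a) (hr : 0 ≤ r)
    (he : 0 ≤ e) (hm : r * a ≤ m) (he' : e ≤ Λ * (5 + |x| ^ r)) :
    e ^ a ≤ 6 ^ a * Λ ^ a * (1 + |x| ^ m) := by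
  set y := max 1 |x|
  have one_le : 1 ≤ y := le_max_left _ _
  have e_le : e ≤ 6 * Λ * y ^ r := by
    have abs_rpow_le : |x| ^ r ≤ y ^ r := Real.rpow_le_rpow (abs_nonneg _) (le_max_right _ _) hr
    calc e ≤ Λ * (5 + |x| ^ r) := he'
      _ ≤ Λ * (6 * y ^ r) := by gcongr; linarith [Real.one_le_rpow one_le hr]
      _ = _ := by ring
  have y_pow_le : y ^ m ≤ 1 + |x| ^ m := by
    rcases max_cases 1 |x| with ⟨h, -⟩ | ⟨h, -⟩ <;> simp only [y, h]
    · simp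
    · linarith
  calc e ^ a ≤ (6 * Λ * y ^ r) ^ a := Real.rpow_le_rpow he e_le ha
    _ = 6 ^ a * Λ ^ a * y ^ (r * a) := by
        rw [Real.mul_rpow (by positivity) (by positivity), Real.mul_rpow (by positivity) hΛ,
          Real.rpow_mul (by positivity)]
    _ ≤ 6 ^ a * Λ ^ a * y ^ (m : ℝ) := by gcongr
    _ ≤ 6 ^ a * Λ ^ a * (1 + |x| ^ m) := by rw [Real.rpow_natCast]; gcongr

theorem SmoothLoss.one_add_rpow_bigQ_le (hℓ : SmoothLoss q D Λ ℓ) (hq : ∀ k, 0 ≤ q k) (hΛ : 1 ≤ Λ)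
    (b : ℝ) {y : ℝ} (hy : |y| ≤ Y) :
    (1 + ℓ (b + y)) ^ bigQ q ≤
      6 ^ bigQ q * Λ ^ bigQ q * 2 ^ qBar q * (1 + Y ^ qBar q + b ^ qBar q) := by
  have hY : 0 ≤ Y := (abs_nonneg y).trans hy
  have growth : 1 + ℓ (b + y) ≤ Λ * (5 + |b + y| ^ q 0) := by linarith [hℓ.growth (b + y)]
  have split : |b + y| ^ qBar q ≤ 2 ^ qBar q * (b ^ qBar q + Y ^ qBar q) :=
    calc |b + y| ^ qBar q ≤ (|b| + Y) ^ qBar q := by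
          gcongr; exact (abs_add_le _ _).trans (by linarith)
      _ ≤ 2 ^ (qBar q - 1) * (|b| ^ qBar q + Y ^ qBar q) := add_pow_le (abs_nonneg _) hY _
      _ ≤ 2 ^ qBar q * (b ^ qBar q + Y ^ qBar q) := by
          rw [(even_qBar q).pow_abs]
          have := (even_qBar q).pow_nonneg b
          gcongr
          · exact one_le_two
          · exact Nat.sub_le _ _
  calc _ ≤ 6 ^ bigQ q * Λ ^ bigQ q * (1 + |b + y| ^ qBar q) :=
        rpow_le_of_le_mul_add_rpow (by linarith) (bigQ_nonneg hq) (hq 0)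
          (by linarith [hℓ.nonneg (b + y)]) (q_zero_mul_bigQ_le_qBar q) growth
    _ ≤ 6 ^ bigQ q * Λ ^ bigQ q * (2 ^ qBar q * (1 + Y ^ qBar q + b ^ qBar q)) := by
        gcongr
        linarith [one_le_pow₀ (one_le_two (α := ℝ)) (n := qBar q)]
    _ = _ := by ring

end SmoothLoss

section RowTaylor

variable {q : Fin 4 → ℝ} {D Λ κ s L Y : ℝ} {ℓ φ : ℝ → ℝ}

/-- The constant in front of the third-order Taylor remainder of `rowFun`. -/
noncomputable def taylorConst (q : Fin 4 → ℝ) (s D Λ κ : ℝ) : ℝ :=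
  48 * κ * (1 + s) ^ 2 * D ^ 3 * (6 ^ bigQ q * Λ ^ bigQ q * 2 ^ qBar q)

theorem taylor_coefficient_le (hD : 1 ≤ D) (hs : 0 ≤ s) (hY : 0 ≤ Y) :
    (1 + 6 * s + 6 * s ^ 2) * (2 * D * Y ^ 1) ^ 3 +
      (3 + 6 * s) * ((2 * D * Y ^ 1) * (2 * D * Y ^ 2)) + 2 * D * Y ^ 3 ≤
      48 * (1 + s) ^ 2 * D ^ 3 * Y ^ 3 := by
  calc _ = (8 * (1 + 6 * s + 6 * s ^ 2) * D ^ 3 + 4 * (3 + 6 * s) * D ^ 2 + 2 * D) * Y ^ 3 := by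
        ring
    _ ≤ (8 * (1 + 6 * s + 6 * s ^ 2) * D ^ 3 + 4 * (3 + 6 * s) * D ^ 3 + 2 * D ^ 3) * Y ^ 3 := by
        gcongr
        · norm_num
        · exact le_self_pow₀ hD (by norm_num)
    _ = (22 + 72 * s + 48 * s ^ 2) * (D ^ 3 * Y ^ 3) := by ring
    _ ≤ (48 * (1 + s) ^ 2) * (D ^ 3 * Y ^ 3) := by gcongr; nlinarith
    _ = _ := by ring

theorem abs_comp_freeEnergy_deriv_three_le_of_smoothLoss {ι : Type*} {N : Finset ι}
    {c z y : ι → ℝ} {p₁ p₂ p₃ : ℝ} (hq : ∀ k, 0 ≤ q k) (hℓ : SmoothLoss q D Λ ℓ) (hD : 1 ≤ D)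
    (hs : 0 ≤ s) (hN : N.Nonempty) (hc : ∀ u ∈ N, 0 < c u) (hY : 0 ≤ Y)
    (hy : ∀ u ∈ N, |y u| ≤ Y) (hp₁ : |p₁| ≤ κ) (hp₂ : |p₂| ≤ κ) (hp₃ : |p₃| ≤ κ)
    {w f₁ f₂ f₃ : ι → ℝ} (hw : w = gibbsWeight c s (fun u => ℓ (z u)))
    (hf₁ : f₁ = fun u => iteratedDeriv 1 ℓ (z u) * y u)
    (hf₂ : f₂ = fun u => iteratedDeriv 2 ℓ (z u) * y u ^ 2)
    (hf₃ : f₃ = fun u => iteratedDeriv 3 ℓ (z u) * y u ^ 3) :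
    |p₃ * gibbsAvg N w f₁ ^ 3 +
        3 * p₂ * (gibbsAvg N w f₁ * (gibbsAvg N w f₂ - s * gibbsCov N w f₁ f₁)) +
        p₁ * (gibbsAvg N w f₃ - 3 * s * gibbsCov N w f₁ f₂ +
          s ^ 2 * gibbsCumulantThree N w f₁)| ≤
      48 * κ * (1 + s) ^ 2 * D ^ 3 * Y ^ 3 * gibbsAvg N c (fun u => (1 + ℓ (z u)) ^ bigQ q) := by
  subst hw hf₁ hf₂ hf₃
  have hκ : 0 ≤ κ := (abs_nonneg _).trans hp₁
  have hD₀ : 0 ≤ D := by linarith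
  have one_le : ∀ u ∈ N, 1 ≤ 1 + ℓ (z u) := fun u _ => by linarith [hℓ.nonneg (z u)]
  have hw : ∀ u ∈ N, 0 ≤ gibbsWeight c s (fun u => ℓ (z u)) u := fun u hu =>
    (gibbsWeight_pos hc _ u hu).le
  set E := gibbsAvg N (gibbsWeight c s (fun u => ℓ (z u))) (fun u => (1 + ℓ (z u)) ^ bigQ q)
  have hE : 0 ≤ E := gibbsAvg_nonneg hw fun u hu => by
    have := one_le u hu
    positivity
  refine (abs_comp_freeEnergy_deriv_three_le (Q := bigQ q) (v := fun u => 1 + ℓ (z u))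
    (J₁ := 2 * D * Y ^ 1) (J₂ := 2 * D * Y ^ 2) (J₃ := 2 * D * Y ^ 3) hp₁ hp₂ hp₃ hw
    (sum_gibbsWeight_pos hN hc _) one_le hs (hq 1) (hq 2) (le_max_left _ _)
    ((le_max_left _ _).trans (le_max_right _ _)) ((le_max_right _ _).trans (le_max_right _ _))
    (by positivity) (by positivity) (by positivity)
    (fun u hu => by
      simpa using hℓ.abs_deriv_mul_pow_le hq hD₀ (k := 1) (by decide) (z u) (hy u hu))
    (fun u hu => hℓ.abs_deriv_mul_pow_le hq hD₀ (k := 2) (by decide) (z u) (hy u hu))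
    (fun u hu => hℓ.abs_deriv_mul_pow_le hq hD₀ (k := 3) (by decide) (z u) (hy u hu))).trans ?_
  have tilt : E ≤ gibbsAvg N c (fun u => (1 + ℓ (z u)) ^ bigQ q) :=
    gibbsAvg_gibbsWeight_rpow_le hN hc hs (bigQ_nonneg hq) fun u hu => by linarith [one_le u hu]
  calc _ ≤ κ * (48 * (1 + s) ^ 2 * D ^ 3 * Y ^ 3) *
        gibbsAvg N c (fun u => (1 + ℓ (z u)) ^ bigQ q) := by
        gcongr
        exact taylor_coefficient_le hD hs hY
    _ = _ := by ring

theorem abs_comp_freeEnergy_taylor_le {ι : Type*} {N : Finset ι} {c b y : ι → ℝ}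
    (hq : ∀ k, 0 ≤ q k) (hℓ : SmoothLoss q D Λ ℓ) (hφ : SmoothTest κ φ) (hD : 1 ≤ D) (hΛ : 1 ≤ Λ)
    (hs : 0 < s) (hN : N.Nonempty) (hc : ∀ u ∈ N, 0 < c u) (hY : 0 ≤ Y)
    (hy : ∀ u ∈ N, |y u| ≤ Y) {w f₁ f₂ : ι → ℝ} (hw : w = gibbsWeight c s (fun u => ℓ (b u)))
    (hf₁ : f₁ = fun u => iteratedDeriv 1 ℓ (b u) * y u)
    (hf₂ : f₂ = fun u => iteratedDeriv 2 ℓ (b u) * y u ^ 2) {F : ℝ}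
    (hF : F = freeEnergy N c s (fun u => ℓ (b u))) :
    |φ (freeEnergy N c s (fun u => ℓ (b u + y u))) - φ F -
        iteratedDeriv 1 φ F * gibbsAvg N w f₁ -
        (iteratedDeriv 2 φ F * gibbsAvg N w f₁ ^ 2 +
          iteratedDeriv 1 φ F * (gibbsAvg N w f₂ - s * gibbsCov N w f₁ f₁)) / 2| ≤
      taylorConst q s D Λ κ * Y ^ 3 *
        (1 + Y ^ qBar q + gibbsAvg N c (fun u => b u ^ qBar q)) := by
  have hκ : 0 ≤ κ := hφ.bound_nonneg
  have hne : ∑ u ∈ N, c u ≠ 0 := (Finset.sum_pos hc hN).ne'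
  have path := (hasThreeDerivs_of_contDiff hφ.contDiff).comp
    (hasThreeDerivs_freeEnergy hN hc hs.ne'
      fun u _ => (hasThreeDerivs_of_contDiff hℓ.contDiff).comp_line (b u) (y u))
  have taylor := path.abs_taylor_le (K := taylorConst q s D Λ κ * Y ^ 3 *
    (1 + Y ^ qBar q + gibbsAvg N c (fun u => b u ^ qBar q))) fun t ht => ?_
  · simpa only [hw, hf₁, hf₂, hF, zero_mul, add_zero, one_mul] using taylor
  have moving : ∀ u ∈ N, |t * y u| ≤ Y := fun u hu => by
    rw [abs_mul, abs_of_nonneg ht.1]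
    exact (mul_le_of_le_one_left (abs_nonneg _) ht.2).trans (hy u hu)
  refine (abs_comp_freeEnergy_deriv_three_le_of_smoothLoss hq hℓ hD hs.le hN hc hY hy
    (hφ.deriv_le 1 (by simp) _) (hφ.deriv_le 2 (by simp) _) (hφ.deriv_le 3 (by simp) _)
    rfl rfl rfl rfl).trans ?_
  calc _ ≤ 48 * κ * (1 + s) ^ 2 * D ^ 3 * Y ^ 3 * gibbsAvg N c (fun u =>
          6 ^ bigQ q * Λ ^ bigQ q * 2 ^ qBar q * (1 + Y ^ qBar q + b u ^ qBar q)) := by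
        gcongr
        exact gibbsAvg_mono (fun u hu => (hc u hu).le) fun u hu =>
          hℓ.one_add_rpow_bigQ_le hq hΛ (b u) (moving u hu)
    _ = _ := by
        rw [gibbsAvg_const_mul, gibbsAvg_add, gibbsAvg_const hne, taylorConst]
        ring

end RowTaylor

section RowFun

variable {p : ℕ} {N : Finset (Fin p → ℝ)} {w g : (Fin p → ℝ) → ℝ}

theorem gibbsAvg_mul_dotProduct (y : Fin p → ℝ) :
    gibbsAvg N w (fun u => g u * (y ⬝ᵥ u)) = ∑ j, gibbsAvg N w (fun u => g u * u j) * y j := by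
  simp only [dotProduct, Finset.mul_sum, gibbsAvg_sum]
  refine Finset.sum_congr rfl fun j _ => ?_
  rw [mul_comm, ← gibbsAvg_const_mul]
  congr! 2
  ring

theorem gibbsAvg_mul_dotProduct_sq (y : Fin p → ℝ) :
    gibbsAvg N w (fun u => g u * (y ⬝ᵥ u) ^ 2) =
      ∑ j, ∑ k, gibbsAvg N w (fun u => g u * u j * u k) * (y j * y k) := by
  calc _ = gibbsAvg N w (fun u => g u * (y ⬝ᵥ u) * (y ⬝ᵥ u)) := by congr! 2; ring
    _ = ∑ k, gibbsAvg N w (fun u => g u * u k * (y ⬝ᵥ u)) * y k := by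
        rw [gibbsAvg_mul_dotProduct]
        congr! 4
        ring
    _ = _ := by
        simp only [gibbsAvg_mul_dotProduct, Finset.sum_mul]
        refine Finset.sum_congr rfl fun k _ => Finset.sum_congr rfl fun j _ => ?_
        ring

theorem gibbsCov_mul_dotProduct (y : Fin p → ℝ) :
    gibbsCov N w (fun u => g u * (y ⬝ᵥ u)) (fun u => g u * (y ⬝ᵥ u)) =
      ∑ j, ∑ k, gibbsCov N w (fun u => g u * u j) (fun u => g u * u k) * (y j * y k) := by
  have square : gibbsAvg N w (fun u => g u * (y ⬝ᵥ u) * (g u * (y ⬝ᵥ u))) =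
      ∑ j, ∑ k, gibbsAvg N w (fun u => g u * u j * (g u * u k)) * (y j * y k) := by
    calc _ = gibbsAvg N w (fun u => g u ^ 2 * (y ⬝ᵥ u) ^ 2) := by congr! 2; ring
      _ = _ := by
        rw [gibbsAvg_mul_dotProduct_sq]
        refine Finset.sum_congr rfl fun j _ => Finset.sum_congr rfl fun k _ => ?_
        congr! 3
        ring
  simp only [gibbsCov, square, gibbsAvg_mul_dotProduct, Finset.sum_mul_sum, sub_mul,
    Finset.sum_sub_distrib]
  refine congrArg _ (Finset.sum_congr rfl fun j _ => Finset.sum_congr rfl fun k _ => ?_)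
  ring

theorem abs_dotProduct_le {L : ℝ} (y : Fin p → ℝ) {u : Fin p → ℝ} (hu : ‖u‖ ≤ L) :
    |y ⬝ᵥ u| ≤ L * ∑ j, |y j| := by
  rw [dotProduct, Finset.mul_sum]
  refine (Finset.abs_sum_le_sum_abs _ _).trans (Finset.sum_le_sum fun j _ => ?_)
  rw [abs_mul, mul_comm]
  exact mul_le_mul_of_nonneg_right ((norm_le_pi_norm u j).trans hu) (abs_nonneg _)

/-- The test function `φ` of the free energy, as a function of one row `x` of the design; the
contribution of the other rows is stored in the weights `c`. -/
noncomputable def rowFun (N : Finset (Fin p → ℝ)) (c : (Fin p → ℝ) → ℝ) (φ ℓ : ℝ → ℝ) (s : ℝ)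
    (x : Fin p → ℝ) : ℝ :=
  φ (freeEnergy N c s (fun u => ℓ (x ⬝ᵥ u)))

theorem exists_rowFun_taylor {q : Fin 4 → ℝ} {ℓ φ : ℝ → ℝ} {D Λ κ L s : ℝ} (hq : ∀ k, 0 ≤ q k)
    (hℓ : SmoothLoss q D Λ ℓ) (hφ : SmoothTest κ φ) (hD : 1 ≤ D) (hΛ : 1 ≤ Λ) (hL : 0 ≤ L)
    (hs : 0 < s) (hN : N.Nonempty) (hNL : ∀ u ∈ N, ‖u‖ ≤ L) {c : (Fin p → ℝ) → ℝ}
    (hc : ∀ u ∈ N, 0 < c u) (x : Fin p → ℝ) :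
    ∃ (α : Fin p → ℝ) (A : Fin p → Fin p → ℝ), ∀ y : Fin p → ℝ,
      |rowFun N c φ ℓ s (x + y) - rowFun N c φ ℓ s x - ∑ j, α j * y j -
        ∑ j, ∑ k, A j k * (y j * y k)| ≤
      taylorConst q s D Λ κ * (L * ∑ j, |y j|) ^ 3 *
        (1 + (L * ∑ j, |y j|) ^ qBar q + gibbsAvg N c (fun u => (x ⬝ᵥ u) ^ qBar q)) := by
  set w := gibbsWeight c s (fun u => ℓ (x ⬝ᵥ u)) with hw
  set F := freeEnergy N c s (fun u => ℓ (x ⬝ᵥ u)) with hF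
  set g₁ : (Fin p → ℝ) → ℝ := fun u => iteratedDeriv 1 ℓ (x ⬝ᵥ u)
  set g₂ : (Fin p → ℝ) → ℝ := fun u => iteratedDeriv 2 ℓ (x ⬝ᵥ u)
  set a : Fin p → ℝ := fun j => gibbsAvg N w (fun u => g₁ u * u j)
  refine ⟨fun j => iteratedDeriv 1 φ F * a j, fun j k => (iteratedDeriv 2 φ F * (a j * a k) +
    iteratedDeriv 1 φ F * (gibbsAvg N w (fun u => g₂ u * u j * u k) -
      s * gibbsCov N w (fun u => g₁ u * u j) (fun u => g₁ u * u k))) / 2, fun y => ?_⟩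
  have taylor := abs_comp_freeEnergy_taylor_le (Y := L * ∑ j, |y j|) (b := fun u => x ⬝ᵥ u)
    (y := fun u => y ⬝ᵥ u) hq hℓ hφ hD hΛ hs hN hc (by positivity)
    (fun u hu => abs_dotProduct_le y (hNL u hu)) hw rfl rfl hF
  have linear : gibbsAvg N w (fun u => g₁ u * (y ⬝ᵥ u)) = ∑ j, a j * y j :=
    gibbsAvg_mul_dotProduct y
  rw [linear, gibbsAvg_mul_dotProduct_sq, gibbsCov_mul_dotProduct] at taylor
  refine le_of_eq_of_le ?_ taylor
  simp only [rowFun, ← hF, add_dotProduct]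
  congr 2
  · simp only [Finset.mul_sum, mul_assoc]
  · rw [sq, Finset.sum_mul_sum]
    simp only [Finset.mul_sum, ← Finset.sum_sub_distrib, ← Finset.sum_add_distrib,
      Finset.sum_div]
    exact Finset.sum_congr rfl fun j _ => Finset.sum_congr rfl fun k _ => by ring

end RowFun

section Moments

variable {Ω κ : Type*} [MeasurableSpace Ω] {P : Measure Ω}

theorem abs_pow_mul_abs_pow_le (S Z : ℝ) {j k : ℕ} (hk : k ≤ 2 * j) :
    |Z| ^ (k + 2) * |S| ^ (2 * j - k) ≤ S ^ (2 * j) * Z ^ 2 + Z ^ (2 * j + 2) := by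
  rw [← (even_two_mul j).pow_abs S, ← even_two.pow_abs Z,
    ← ((even_two_mul j).add even_two).pow_abs Z]
  rcases le_total |Z| |S| with h | h
  · calc |Z| ^ (k + 2) * |S| ^ (2 * j - k) = |Z| ^ k * |S| ^ (2 * j - k) * |Z| ^ 2 := by ring
      _ ≤ |S| ^ k * |S| ^ (2 * j - k) * |Z| ^ 2 := by gcongr
      _ = |S| ^ (2 * j) * |Z| ^ 2 := by rw [← pow_add, Nat.add_sub_cancel' hk]
      _ ≤ _ := le_add_of_nonneg_right (by positivity)
  · calc |Z| ^ (k + 2) * |S| ^ (2 * j - k) ≤ |Z| ^ (k + 2) * |Z| ^ (2 * j - k) := by gcongr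
      _ = |Z| ^ (2 * j + 2) := by rw [← pow_add]; congr 1; omega
      _ ≤ _ := le_add_of_nonneg_left (by positivity)

theorem sum_choose_add_two_le (m : ℕ) :
    ∑ k ∈ Finset.range (m + 1), (m + 2).choose (k + 1 + 1) ≤ 2 ^ (m + 2) := by
  rw [← Nat.sum_range_choose (m + 2), Finset.sum_range_succ' _ (m + 2),
    Finset.sum_range_succ' _ (m + 1)]
  omega

theorem add_pow_even_le (S Z : ℝ) (j : ℕ) :
    (S + Z) ^ (2 * j + 2) ≤ S ^ (2 * j + 2) + (2 * j + 2) * (S ^ (2 * j + 1) * Z) +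
      2 ^ (2 * j + 2) * (S ^ (2 * j) * Z ^ 2 + Z ^ (2 * j + 2)) := by
  rw [add_comm S Z, add_pow, Finset.sum_range_succ', Finset.sum_range_succ']
  set R := S ^ (2 * j) * Z ^ 2 + Z ^ (2 * j + 2)
  have hR : 0 ≤ R := le_trans (by positivity) (abs_pow_mul_abs_pow_le S Z (Nat.zero_le (2 * j)))
  have higher_order : ∑ k ∈ Finset.range (2 * j + 1),
      Z ^ (k + 1 + 1) * S ^ (2 * j + 2 - (k + 1 + 1)) * ((2 * j + 2).choose (k + 1 + 1) : ℝ) ≤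
        2 ^ (2 * j + 2) * R := by
    calc _ ≤ ∑ k ∈ Finset.range (2 * j + 1), R * ((2 * j + 2).choose (k + 1 + 1) : ℝ) := by
          refine Finset.sum_le_sum fun k hk => mul_le_mul_of_nonneg_right ?_ (by positivity)
          rw [Nat.add_sub_add_right]
          refine le_trans ?_ (abs_pow_mul_abs_pow_le S Z (Finset.mem_range_succ_iff.1 hk))
          rw [← abs_pow, ← abs_pow, ← abs_mul]
          exact le_abs_self _
      _ ≤ R * 2 ^ (2 * j + 2) := by
          rw [← Finset.mul_sum]
          exact mul_le_mul_of_nonneg_left (mod_cast sum_choose_add_two_le (2 * j)) hR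
      _ = _ := mul_comm _ _
  have linear : Z ^ (0 + 1) * S ^ (2 * j + 2 - (0 + 1)) * ((2 * j + 2).choose (0 + 1) : ℝ) =
      (2 * j + 2) * (S ^ (2 * j + 1) * Z) := by
    simp only [zero_add, pow_one, Nat.choose_one_right, Nat.add_succ_sub_one]
    push_cast
    ring
  rw [linear]
  simp only [pow_zero, one_mul, Nat.sub_zero, Nat.choose_zero_right, Nat.cast_one, mul_one]
  linarith

theorem integrable_pow_of_memLp [IsFiniteMeasure P] {Z : Ω → ℝ} {r k : ℕ}
    (h : MemLp Z (r : ℝ≥0∞) P) (hk : k ≤ r) : Integrable (fun ω => Z ω ^ k) P := by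
  have memLp : MemLp Z (k : ℝ≥0∞) P := h.mono_exponent (by exact_mod_cast hk)
  exact memLp.integrable_norm_pow'.mono' (memLp.1.pow k) (ae_of_all _ fun ω => by simp)

theorem integral_add_pow_even_le [IsFiniteMeasure P] {S Z : Ω → ℝ} {j : ℕ}
    (hind : IndepFun S Z P) (hS : MemLp S ((2 * j + 2 : ℕ) : ℝ≥0∞) P)
    (hZ : MemLp Z ((2 * j + 2 : ℕ) : ℝ≥0∞) P) (hmean : ∫ ω, Z ω ∂P = 0) :
    ∫ ω, (S ω + Z ω) ^ (2 * j + 2) ∂P ≤ ∫ ω, S ω ^ (2 * j + 2) ∂P +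
      2 ^ (2 * j + 2) * ((∫ ω, S ω ^ (2 * j) ∂P) * ∫ ω, Z ω ^ 2 ∂P +
        ∫ ω, Z ω ^ (2 * j + 2) ∂P) := by
  have indep_pow (k l : ℕ) : IndepFun (fun ω => S ω ^ k) (fun ω => Z ω ^ l) P :=
    hind.comp (φ := fun x => x ^ k) (ψ := fun x => x ^ l) (by fun_prop) (by fun_prop)
  have integral_mul (k l : ℕ) :
      ∫ ω, S ω ^ k * Z ω ^ l ∂P = (∫ ω, S ω ^ k ∂P) * ∫ ω, Z ω ^ l ∂P :=
    (indep_pow k l).integral_fun_mul_eq_mul_integral (hS.1.pow k) (hZ.1.pow l)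
  have integrable_mul {k l : ℕ} (hk : k ≤ 2 * j + 2) (hl : l ≤ 2 * j + 2) :
      Integrable (fun ω => S ω ^ k * Z ω ^ l) P :=
    (indep_pow k l).integrable_mul (integrable_pow_of_memLp hS hk) (integrable_pow_of_memLp hZ hl)
  have leading := integrable_pow_of_memLp hS le_rfl
  have linear := (integrable_mul (k := 2 * j + 1) (l := 1) (by omega) (by omega)).const_mul
    (2 * j + 2 : ℝ)
  have quadratic := integrable_mul (k := 2 * j) (l := 2) (by omega) (by omega)
  have top := integrable_pow_of_memLp hZ le_rfl
  calc ∫ ω, (S ω + Z ω) ^ (2 * j + 2) ∂P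
      ≤ ∫ ω, (S ω ^ (2 * j + 2) + (2 * j + 2) * (S ω ^ (2 * j + 1) * Z ω ^ 1) +
          2 ^ (2 * j + 2) * (S ω ^ (2 * j) * Z ω ^ 2 + Z ω ^ (2 * j + 2))) ∂P :=
        integral_mono (integrable_pow_of_memLp (hS.add hZ) le_rfl)
          ((leading.fun_add linear).fun_add ((quadratic.fun_add top).const_mul _))
          fun ω => by simpa only [pow_one] using add_pow_even_le (S ω) (Z ω) j
    _ = _ := by
        rw [integral_add (leading.fun_add linear) ((quadratic.fun_add top).const_mul _),
          integral_add leading linear, integral_const_mul, integral_const_mul, integral_mul,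
          integral_add quadratic top, integral_mul]
        simp only [pow_one, hmean, mul_zero, add_zero]

theorem integral_sum_pow_succ_le [IsProbabilityMeasure P] {Z : κ → Ω → ℝ} (hind : iIndepFun Z P)
    (hmean : ∀ b, ∫ ω, Z b ω ∂P = 0) {j : ℕ} (hLp : ∀ b, MemLp (Z b) ((2 * j + 2 : ℕ) : ℝ≥0∞) P)
    {A : ℝ} {t : Finset κ} (hA : ∀ t' ⊆ t, ∫ ω, (∑ b ∈ t', Z b ω) ^ (2 * j) ∂P ≤ A) :
    ∫ ω, (∑ b ∈ t, Z b ω) ^ (2 * j + 2) ∂P ≤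
      2 ^ (2 * j + 2) * ∑ b ∈ t, (A * ∫ ω, Z b ω ^ 2 ∂P + ∫ ω, Z b ω ^ (2 * j + 2) ∂P) := by
  classical
  induction t using Finset.induction_on with
  | empty => simp
  | insert b t hb ih =>
    have indep : IndepFun (fun ω => ∑ b ∈ t, Z b ω) (Z b) P := by
      convert hind.indepFun_finsetSum_of_notMem₀ (fun b => (hLp b).1.aemeasurable) hb using 1
      ext ω
      exact (Finset.sum_apply ω t Z).symm
    have step := integral_add_pow_even_le indep (memLp_finsetSum t fun b _ => hLp b) (hLp b)
      (hmean b)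
    have sum_eq (ω : Ω) : ∑ b ∈ insert b t, Z b ω = ∑ b ∈ t, Z b ω + Z b ω := by
      rw [Finset.sum_insert hb, add_comm]
    simp only [sum_eq, Finset.sum_insert hb]
    have : 0 ≤ ∫ ω, Z b ω ^ 2 ∂P := integral_nonneg fun ω => sq_nonneg _
    calc _ ≤ _ := step
      _ ≤ 2 ^ (2 * j + 2) *
            ∑ b ∈ t, (A * ∫ ω, Z b ω ^ 2 ∂P + ∫ ω, Z b ω ^ (2 * j + 2) ∂P) +
          2 ^ (2 * j + 2) * (A * ∫ ω, Z b ω ^ 2 ∂P + ∫ ω, Z b ω ^ (2 * j + 2) ∂P) := by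
        gcongr
        · exact ih fun t' ht' => hA t' (ht'.trans (Finset.subset_insert b t))
        · exact hA t (Finset.subset_insert b t)
      _ = _ := by ring

/-- The constants of the Rosenthal-type inequality `integral_sum_pow_le` for moments of
order `2 j`. -/
def sumMomentConst : ℕ → ℝ
  | 0 => 1
  | j + 1 => 2 ^ (2 * j + 2) * (sumMomentConst j + 1)

theorem sumMomentConst_pos (j : ℕ) : 0 < sumMomentConst j := by
  induction j with
  | zero => exact one_pos
  | succ j ih => rw [sumMomentConst]; positivity

theorem integral_sum_pow_le [IsProbabilityMeasure P] {Z : κ → Ω → ℝ} (hind : iIndepFun Z P)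
    (hmean : ∀ b, ∫ ω, Z b ω ∂P = 0) {h : ℕ} (hLp : ∀ b, MemLp (Z b) ((2 * h : ℕ) : ℝ≥0∞) P)
    {a W : ℝ} (ha : 0 ≤ a) (hW : 1 ≤ W) {s : Finset κ}
    (h₂ : ∑ b ∈ s, ∫ ω, Z b ω ^ 2 ∂P ≤ a ^ 2)
    (hh : ∀ j, 1 ≤ j → j ≤ h → ∑ b ∈ s, ∫ ω, Z b ω ^ (2 * j) ∂P ≤ a ^ (2 * j) * W)
    {j : ℕ} (hj : j ≤ h) {t : Finset κ} (hts : t ⊆ s) :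
    ∫ ω, (∑ b ∈ t, Z b ω) ^ (2 * j) ∂P ≤ sumMomentConst j * a ^ (2 * j) * W := by
  induction j generalizing t with
  | zero => simpa [sumMomentConst] using hW
  | succ j ih =>
    have constant_nonneg := (sumMomentConst_pos j).le
    have moment_nonneg (l : ℕ) (b : κ) : 0 ≤ ∫ ω, Z b ω ^ (2 * l) ∂P :=
      integral_nonneg fun ω => (even_two_mul l).pow_nonneg _
    have sum_mono (l : ℕ) : ∑ b ∈ t, ∫ ω, Z b ω ^ (2 * l) ∂P ≤ ∑ b ∈ s, ∫ ω, Z b ω ^ (2 * l) ∂P :=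
      Finset.sum_le_sum_of_subset_of_nonneg hts fun b _ _ => moment_nonneg l b
    calc ∫ ω, (∑ b ∈ t, Z b ω) ^ (2 * j + 2) ∂P
        ≤ 2 ^ (2 * j + 2) * ∑ b ∈ t, (sumMomentConst j * a ^ (2 * j) * W * ∫ ω, Z b ω ^ 2 ∂P +
            ∫ ω, Z b ω ^ (2 * j + 2) ∂P) :=
          integral_sum_pow_succ_le hind hmean
            (fun b => (hLp b).mono_exponent (by exact_mod_cast (by omega)))
            fun t' ht' => ih (by omega) (ht'.trans hts)
      _ ≤ 2 ^ (2 * j + 2) * (sumMomentConst j * a ^ (2 * j) * W * a ^ 2 +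
            a ^ (2 * j + 2) * W) := by
          rw [Finset.sum_add_distrib, ← Finset.mul_sum]
          gcongr
          · exact (sum_mono 1).trans h₂
          · exact (sum_mono (j + 1)).trans (hh (j + 1) (by omega) hj)
      _ = _ := by rw [sumMomentConst]; ring

end Moments

section Telescope

variable {ι : Type*} {E : ι → Type*} [Fintype ι] [DecidableEq ι] [∀ i, MeasurableSpace (E i)]

theorem map_update_pi (m : ∀ i, Measure (E i)) [∀ i, IsProbabilityMeasure (m i)] (j : ι)
    (ν : Measure (E j)) [IsProbabilityMeasure ν] :
    ((Measure.pi m).prod ν).map (fun z => Function.update z.1 j z.2) =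
      Measure.pi (Function.update m j ν) := by
  have : ∀ i, IsProbabilityMeasure (Function.update m j ν i) := fun i => by
    rcases eq_or_ne i j with rfl | h
    · simpa
    · simpa [h] using (inferInstance : IsProbabilityMeasure (m i))
  refine (Measure.pi_eq fun s hs => ?_).symm
  have preimage_eq : (fun z : (∀ i, E i) × E j => Function.update z.1 j z.2) ⁻¹' univ.pi s =
      univ.pi (Function.update s j univ) ×ˢ s j := by
    ext ⟨x, y⟩
    simp only [mem_preimage, mem_univ_pi, mem_prod]
    rw [Function.forall_update_iff x (fun i z => z ∈ s i), Function.forall_update_iff s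
      (fun i t => x i ∈ t)]
    simp only [mem_univ, true_and, and_comm]
  rw [Measure.map_apply measurable_update' (MeasurableSet.univ_pi hs), preimage_eq,
    Measure.prod_prod, Measure.pi_pi,
    Fintype.prod_eq_mul_prod_compl j (fun i => m i (Function.update s j univ i)),
    Fintype.prod_eq_mul_prod_compl j, Function.update_self, Function.update_self, measure_univ,
    one_mul, mul_comm]
  congr 1
  refine Finset.prod_congr rfl fun i hi => ?_
  have hij : i ≠ j := by simpa using hi
  simp only [Function.update_of_ne hij]

theorem integrable_comp_update (m : ∀ i, Measure (E i)) [∀ i, IsProbabilityMeasure (m i)] (j : ι)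
    (ν : Measure (E j)) [IsProbabilityMeasure ν] {f : (∀ i, E i) → ℝ} (hf : Measurable f) {c : ℝ}
    (hb : ∀ x, |f x| ≤ c) :
    Integrable (fun z : (∀ i, E i) × E j => f (Function.update z.1 j z.2))
      ((Measure.pi m).prod ν) :=
  .of_bound (hf.comp measurable_update').aestronglyMeasurable c (ae_of_all _ fun _ => hb _)

theorem integral_pi_update (m : ∀ i, Measure (E i)) [∀ i, IsProbabilityMeasure (m i)] (j : ι)
    (ν : Measure (E j)) [IsProbabilityMeasure ν] {f : (∀ i, E i) → ℝ} (hf : Measurable f) {c : ℝ}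
    (hb : ∀ x, |f x| ≤ c) :
    ∫ x, f x ∂Measure.pi (Function.update m j ν) =
      ∫ x, ∫ y, f (Function.update x j y) ∂ν ∂Measure.pi m := by
  rw [← map_update_pi, integral_map measurable_update'.aemeasurable hf.aestronglyMeasurable,
    integral_prod _ (integrable_comp_update m j ν hf hb)]

theorem abs_integral_pi_sub_le (μ ν : ∀ i, Measure (E i)) [∀ i, IsProbabilityMeasure (μ i)]
    [∀ i, IsProbabilityMeasure (ν i)] {f : (∀ i, E i) → ℝ} (hf : Measurable f) {c : ℝ}
    (hb : ∀ x, |f x| ≤ c) {ε : ι → ℝ}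
    (h : ∀ (j : ι) (m : ∀ i, Measure (E i)), (∀ i, m i = μ i ∨ m i = ν i) →
      |∫ x, (∫ y, f (Function.update x j y) ∂μ j - ∫ y, f (Function.update x j y) ∂ν j)
        ∂Measure.pi m| ≤ ε j) :
    |∫ x, f x ∂Measure.pi μ - ∫ x, f x ∂Measure.pi ν| ≤ ∑ j, ε j := by
  suffices partial_swap : ∀ s : Finset ι, |∫ x, f x ∂Measure.pi μ -
      ∫ x, f x ∂Measure.pi (s.piecewise ν μ)| ≤ ∑ j ∈ s, ε j by
    simpa using partial_swap Finset.univ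
  intro s
  induction s using Finset.induction_on with
  | empty => simp
  | insert j s hj ih =>
    set m := s.piecewise ν μ with hm
    have mem (i : ι) : m i = μ i ∨ m i = ν i := by
      by_cases hi : i ∈ s <;> simp [hm, hi]
    have : ∀ i, IsProbabilityMeasure (m i) := fun i => by
      rcases mem i with h | h <;> rw [h] <;> infer_instance
    have restore : Function.update m j (μ j) = m :=
      Function.update_eq_self_iff.2 (Finset.piecewise_eq_of_notMem _ _ _ hj).symm
    have swap := h j m mem
    rw [integral_sub (integrable_comp_update m j _ hf hb).integral_prod_left
      (integrable_comp_update m j _ hf hb).integral_prod_left,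
      ← integral_pi_update m j _ hf hb, ← integral_pi_update m j _ hf hb, restore] at swap
    rw [Finset.piecewise_insert, Finset.sum_insert hj]
    exact (abs_sub_le _ _ _).trans (by linarith)

end Telescope

section BlockPart

variable {p : ℕ}

/-- The part of the vector `x` supported on the cell `s`, extended by zero. -/
def blockPart (s : Finset (Fin p)) (x : Fin p → ℝ) : Fin p → ℝ := fun j => if j ∈ s then x j else 0

theorem measurable_blockPart (s : Finset (Fin p)) : Measurable (blockPart s) := by
  refine measurable_pi_iff.2 fun j => ?_
  unfold blockPart
  split_ifs <;> fun_prop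

theorem sum_abs_blockPart (s : Finset (Fin p)) (x : Fin p → ℝ) :
    ∑ j, |blockPart s x j| = ∑ j ∈ s, |x j| := by
  simp only [blockPart, apply_ite, abs_zero, Finset.sum_ite_mem, Finset.univ_inter]

theorem blockPart_dotProduct (s : Finset (Fin p)) (x u : Fin p → ℝ) :
    blockPart s x ⬝ᵥ u = x ⬝ᵥ blockPart s u := by
  simp only [dotProduct, blockPart, ite_mul, mul_ite, zero_mul, mul_zero]

theorem abs_blockPart_dotProduct_le {L : ℝ} (s : Finset (Fin p)) (x : Fin p → ℝ) {u : Fin p → ℝ}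
    (hu : ‖u‖ ≤ L) : |blockPart s x ⬝ᵥ u| ≤ L * ∑ j ∈ s, |x j| := by
  rw [← sum_abs_blockPart]
  exact abs_dotProduct_le _ hu

theorem blockPart_dotProduct_self_le {L : ℝ} (s : Finset (Fin p)) {u : Fin p → ℝ} (hu : ‖u‖ ≤ L) :
    blockPart s u ⬝ᵥ blockPart s u ≤ L ^ 2 * s.card := by
  calc blockPart s u ⬝ᵥ blockPart s u = ∑ i ∈ s, u i ^ 2 := by
        simp [dotProduct, blockPart, sq]
    _ ≤ ∑ _i ∈ s, L ^ 2 :=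
        Finset.sum_le_sum fun i _ => sq_le_sq' (abs_le.1 ((norm_le_pi_norm u i).trans hu)).1
          (abs_le.1 ((norm_le_pi_norm u i).trans hu)).2
    _ = L ^ 2 * s.card := by rw [Finset.sum_const, nsmul_eq_mul, mul_comm]

end BlockPart

section RowLaw

variable {p k n r : ℕ}

/-- The law of a centred row with covariance `Sig / n`, with moments up to order `r` of the size
of those of `n ^ (-1 / 2)` times a fixed random variable, and with independent parts on the
cells `B`. -/
structure RowLaw (B : Fin k → Finset (Fin p)) (Sig : Matrix (Fin p) (Fin p) ℝ) (n r : ℕ) (K : ℝ)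
    (μ : Measure (Fin p → ℝ)) : Prop where
  blocks : (Measure.pi fun a => μ.map (blockPart (B a))).map (fun x => ∑ a, x a) = μ
  memLp : ∀ j, MemLp (fun x => x j) (r : ℝ≥0∞) μ
  mean : ∀ j, ∫ x, x j ∂μ = 0
  cov : ∀ i j, ∫ x, x i * x j ∂μ = Sig i j / n
  moment : ∀ j, ∀ l ≤ r, ∫ x, |x j| ^ l ∂μ ≤ K / Real.sqrt n ^ l

namespace RowLaw

variable {B : Fin k → Finset (Fin p)} {Sig : Matrix (Fin p) (Fin p) ℝ} {K L : ℝ}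
  {μ : Measure (Fin p → ℝ)}

theorem memLp_dotProduct (hμ : RowLaw B Sig n r K μ) (v : Fin p → ℝ) :
    MemLp (fun x => x ⬝ᵥ v) (r : ℝ≥0∞) μ :=
  memLp_finsetSum _ fun j _ => (hμ.memLp j).mul_const _

variable [IsProbabilityMeasure μ]

theorem integral_dotProduct (hμ : RowLaw B Sig n r K μ) (hr : 1 ≤ r) (v : Fin p → ℝ) :
    ∫ x, x ⬝ᵥ v ∂μ = 0 := by
  simp only [dotProduct]
  rw [integral_finsetSum _ fun j _ =>
    ((hμ.memLp j).integrable (by exact_mod_cast hr)).mul_const _]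
  simp only [integral_mul_const, hμ.mean, zero_mul, Finset.sum_const_zero]

theorem integrable_mul (hμ : RowLaw B Sig n r K μ) (hr : 2 ≤ r) (i j : Fin p) :
    Integrable (fun x => x i * x j) μ :=
  have memLp_two (j) : MemLp (fun x : Fin p → ℝ => x j) 2 μ :=
    (hμ.memLp j).mono_exponent (by exact_mod_cast hr)
  (memLp_two i).integrable_mul (memLp_two j)

theorem integrable_quadratic (hμ : RowLaw B Sig n r K μ) (hr : 2 ≤ r)
    (A : Fin p → Fin p → ℝ) : Integrable (fun x => ∑ i, ∑ j, A i j * (x i * x j)) μ :=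
  integrable_finsetSum _ fun i _ => integrable_finsetSum _ fun j _ =>
    (hμ.integrable_mul hr i j).const_mul _

theorem integral_quadratic (hμ : RowLaw B Sig n r K μ) (hr : 2 ≤ r) (A : Fin p → Fin p → ℝ) :
    ∫ x, ∑ i, ∑ j, A i j * (x i * x j) ∂μ = ∑ i, ∑ j, A i j * (Sig i j / n) := by
  have integrable (i j) : Integrable (fun x => A i j * (x i * x j)) μ :=
    (hμ.integrable_mul hr i j).const_mul _
  rw [integral_finsetSum _ fun i _ => integrable_finsetSum _ fun j _ => integrable i j]
  refine Finset.sum_congr rfl fun i _ => ?_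
  rw [integral_finsetSum _ fun j _ => integrable i j]
  exact Finset.sum_congr rfl fun j _ => by rw [integral_const_mul, hμ.cov]

theorem integral_dotProduct_sq (hμ : RowLaw B Sig n r K μ) (hr : 2 ≤ r) (v : Fin p → ℝ) :
    ∫ x, (x ⬝ᵥ v) ^ 2 ∂μ = v ⬝ᵥ Sig.mulVec v / n := by
  have expand (x : Fin p → ℝ) : (x ⬝ᵥ v) ^ 2 = ∑ i, ∑ j, v i * v j * (x i * x j) := by
    rw [sq, dotProduct, Finset.sum_mul_sum]
    exact Finset.sum_congr rfl fun i _ => Finset.sum_congr rfl fun j _ => by ring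
  simp only [expand, hμ.integral_quadratic hr]
  simp only [dotProduct, Matrix.mulVec, Finset.mul_sum, Finset.sum_div]
  exact Finset.sum_congr rfl fun i _ => Finset.sum_congr rfl fun j _ => by ring

theorem integral_blockPart_dotProduct_sq_le (hμ : RowLaw B Sig n r K μ) (hr : 2 ≤ r) {M : ℝ}
    (hM : 0 ≤ M) (hSig : ∀ v : Fin p → ℝ, v ⬝ᵥ Sig.mulVec v ≤ M * (v ⬝ᵥ v))
    (s : Finset (Fin p)) {u : Fin p → ℝ} (hu : ‖u‖ ≤ L) :
    ∫ x, (blockPart s x ⬝ᵥ u) ^ 2 ∂μ ≤ M * L ^ 2 * (s.card / n) := by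
  simp only [blockPart_dotProduct s _ u, hμ.integral_dotProduct_sq hr]
  calc _ ≤ M * (blockPart s u ⬝ᵥ blockPart s u) / n := by gcongr; exact hSig _
    _ ≤ M * (L ^ 2 * s.card) / n := by gcongr; exact blockPart_dotProduct_self_le s hu
    _ = M * L ^ 2 * (s.card / n) := by ring

theorem integrable_sum_abs_pow (hμ : RowLaw B Sig n r K μ) (s : Finset (Fin p)) {l : ℕ}
    (hl : l ≤ r) : Integrable (fun x => (∑ j ∈ s, |x j|) ^ l) μ :=
  integrable_pow_of_memLp (memLp_finsetSum s fun j _ => (hμ.memLp j).abs) hl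

theorem integral_sum_abs_pow_le (hμ : RowLaw B Sig n r K μ) (hK : 1 ≤ K) (s : Finset (Fin p))
    {l : ℕ} (hl : l ≤ r) :
    ∫ x, (∑ j ∈ s, |x j|) ^ l ∂μ ≤ K * ((s.card : ℝ) / Real.sqrt n) ^ l := by
  rcases l with _ | l
  · simpa using hK
  have integrable (j) : Integrable (fun x : Fin p → ℝ => |x j| ^ (l + 1)) μ :=
    integrable_pow_of_memLp (hμ.memLp j).abs hl
  calc ∫ x, (∑ j ∈ s, |x j|) ^ (l + 1) ∂μ
      ≤ ∫ x, (s.card : ℝ) ^ l * ∑ j ∈ s, |x j| ^ (l + 1) ∂μ :=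
        integral_mono (hμ.integrable_sum_abs_pow s hl)
          ((integrable_finsetSum s fun j _ => integrable j).const_mul _)
          fun x => pow_sum_le_card_mul_sum_pow (fun j _ => abs_nonneg (x j)) l
    _ = (s.card : ℝ) ^ l * ∑ j ∈ s, ∫ x, |x j| ^ (l + 1) ∂μ := by
        rw [integral_const_mul, integral_finsetSum s fun j _ => integrable j]
    _ ≤ (s.card : ℝ) ^ l * ∑ _j ∈ s, K / Real.sqrt n ^ (l + 1) := by
        gcongr with j _
        exact hμ.moment j _ hl
    _ = _ := by rw [Finset.sum_const, nsmul_eq_mul, div_pow]; ring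

theorem integral_blockPart_dotProduct_pow_le (hμ : RowLaw B Sig n r K μ) (hK : 1 ≤ K)
    (s : Finset (Fin p)) {u : Fin p → ℝ} (hu : ‖u‖ ≤ L) {j : ℕ} (hj : 2 * j ≤ r) :
    ∫ x, (blockPart s x ⬝ᵥ u) ^ (2 * j) ∂μ ≤
      K * (L ^ (2 * j) * ((s.card : ℝ) / Real.sqrt n) ^ (2 * j)) := by
  have memLp : MemLp (fun x => blockPart s x ⬝ᵥ u) (r : ℝ≥0∞) μ := by
    simpa only [blockPart_dotProduct] using hμ.memLp_dotProduct _
  have hL : 0 ≤ L := (norm_nonneg u).trans hu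
  calc _ ≤ ∫ x, L ^ (2 * j) * (∑ i ∈ s, |x i|) ^ (2 * j) ∂μ := by
        refine integral_mono (integrable_pow_of_memLp memLp hj)
          ((hμ.integrable_sum_abs_pow s hj).const_mul _) fun x => ?_
        rw [← (even_two_mul j).pow_abs, ← mul_pow]
        exact pow_le_pow_left₀ (abs_nonneg _) (abs_blockPart_dotProduct_le s x hu) _
    _ ≤ L ^ (2 * j) * (K * ((s.card : ℝ) / Real.sqrt n) ^ (2 * j)) := by
        rw [integral_const_mul]
        gcongr
        exact hμ.integral_sum_abs_pow_le hK s hj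
    _ = _ := by ring

theorem integral_blockPart_sub_quadratic (hμ : RowLaw B Sig n r K μ) (hr : 2 ≤ r)
    (s : Finset (Fin p)) {g : (Fin p → ℝ) → ℝ} (hg : Integrable (fun x => g (blockPart s x)) μ)
    (g₀ : ℝ) (α : Fin p → ℝ) (A : Fin p → Fin p → ℝ) :
    ∫ x, (g (blockPart s x) - g₀ - ∑ j, α j * blockPart s x j -
        ∑ i, ∑ j, A i j * (blockPart s x i * blockPart s x j)) ∂μ =
      ∫ x, g (blockPart s x) ∂μ - g₀ - ∑ i ∈ s, ∑ j ∈ s, A i j * (Sig i j / n) := by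
  set A' : Fin p → Fin p → ℝ := fun i j => if i ∈ s then (if j ∈ s then A i j else 0) else 0
  have quadratic (x : Fin p → ℝ) : ∑ i, ∑ j, A i j * (blockPart s x i * blockPart s x j) =
      ∑ i, ∑ j, A' i j * (x i * x j) :=
    Finset.sum_congr rfl fun i _ => Finset.sum_congr rfl fun j _ => by
      simp only [A', blockPart]
      split_ifs <;> simp
  have linear (x : Fin p → ℝ) : ∑ j, α j * blockPart s x j = x ⬝ᵥ blockPart s α :=
    (dotProduct_comm α (blockPart s x)).trans (blockPart_dotProduct s x α)
  have restrict : ∑ i, ∑ j, A' i j * (Sig i j / n) = ∑ i ∈ s, ∑ j ∈ s, A i j * (Sig i j / n) := by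
    simp [A']
  have linear_integrable : Integrable (fun x => x ⬝ᵥ blockPart s α) μ :=
    (hμ.memLp_dotProduct _).integrable (by exact_mod_cast (by omega : 1 ≤ r))
  have sub_const : Integrable (fun x => g (blockPart s x) - g₀) μ := hg.sub (integrable_const g₀)
  have sub_linear : Integrable (fun x => g (blockPart s x) - g₀ - x ⬝ᵥ blockPart s α) μ :=
    sub_const.sub linear_integrable
  simp only [quadratic, linear]
  rw [integral_sub sub_linear (hμ.integrable_quadratic hr A'),
    integral_sub sub_const linear_integrable, integral_sub hg (integrable_const g₀),
    hμ.integral_dotProduct (by omega), hμ.integral_quadratic hr, restrict]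
  simp

theorem abs_integral_blockPart_sub_quadratic_le (hμ : RowLaw B Sig n r K μ) (hK : 1 ≤ K)
    (s : Finset (Fin p)) {m : ℕ} (hr : m + 3 ≤ r) {g : (Fin p → ℝ) → ℝ} (hg : Measurable g)
    {b : ℝ} (hgb : ∀ y, |g y| ≤ b) {g₀ T v : ℝ} (hT : 0 ≤ T) (hL : 0 ≤ L) (hv : 0 ≤ v)
    {α : Fin p → ℝ} {A : Fin p → Fin p → ℝ}
    (h : ∀ y, |g y - g₀ - ∑ j, α j * y j - ∑ i, ∑ j, A i j * (y i * y j)| ≤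
      T * (L * ∑ j, |y j|) ^ 3 * (1 + (L * ∑ j, |y j|) ^ m + v)) :
    |∫ x, g (blockPart s x) ∂μ - g₀ - ∑ i ∈ s, ∑ j ∈ s, A i j * (Sig i j / n)| ≤
      T * L ^ 3 * K * ((s.card : ℝ) / Real.sqrt n) ^ 3 *
        (1 + v + (L * (s.card / Real.sqrt n)) ^ m) := by
  have integrable : Integrable (fun x => g (blockPart s x)) μ :=
    .of_bound (hg.comp (measurable_blockPart s)).aestronglyMeasurable b
      (ae_of_all _ fun x => hgb _)
  have cubic := (hμ.integrable_sum_abs_pow s (l := 3) (by omega)).const_mul (T * L ^ 3 * (1 + v))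
  have top := (hμ.integrable_sum_abs_pow s hr).const_mul (T * L ^ (m + 3))
  rw [← hμ.integral_blockPart_sub_quadratic (by omega) s integrable g₀ α, ← Real.norm_eq_abs]
  refine (norm_integral_le_of_norm_le (cubic.fun_add top) (ae_of_all _ fun x => ?_)).trans ?_
  · refine (h (blockPart s x)).trans_eq ?_
    rw [sum_abs_blockPart]
    ring
  · rw [integral_add cubic top, integral_const_mul, integral_const_mul]
    calc _ ≤ T * L ^ 3 * (1 + v) * (K * ((s.card : ℝ) / Real.sqrt n) ^ 3) +
          T * L ^ (m + 3) * (K * ((s.card : ℝ) / Real.sqrt n) ^ (m + 3)) := by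
          gcongr
          · exact hμ.integral_sum_abs_pow_le hK s (by omega)
          · exact hμ.integral_sum_abs_pow_le hK s hr
      _ = _ := by ring

end RowLaw

end RowLaw

section BlockSystem

variable {p k d : ℕ} {B : Fin k → Finset (Fin p)}

/-- A system of pairwise disjoint cells of size at most `d`. -/
structure IsBlockSystem (B : Fin k → Finset (Fin p)) (d : ℕ) : Prop where
  disjoint : ∀ a b, a ≠ b → Disjoint (B a) (B b)
  card_le : ∀ a, (B a).card ≤ d

theorem IsBlockSystem.sum_card_le (hB : IsBlockSystem B d) : ∑ a, (B a).card ≤ p := by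
  rw [← Finset.card_biUnion fun a _ b _ hab => hB.disjoint a b hab]
  exact (Finset.card_le_univ _).trans_eq (Fintype.card_fin p)

theorem IsBlockSystem.sum_card_pow_le (hB : IsBlockSystem B d) (l m : ℕ) :
    ∑ a, (B a).card ^ (l + m + 1) ≤ d ^ l * p ^ (m + 1) := by
  calc ∑ a, (B a).card ^ (l + m + 1) ≤ ∑ a, d ^ l * p ^ m * (B a).card := by
        refine Finset.sum_le_sum fun a _ => ?_
        rw [pow_succ, pow_add]
        gcongr
        · exact hB.card_le a
        · exact (Finset.card_le_univ _).trans_eq (Fintype.card_fin p)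
    _ = d ^ l * p ^ m * ∑ a, (B a).card := (Finset.mul_sum _ _ _).symm
    _ ≤ d ^ l * p ^ m * p := by gcongr; exact hB.sum_card_le
    _ = d ^ l * p ^ (m + 1) := by ring

theorem IsBlockSystem.sum_card_div_sqrt_pow_le (hB : IsBlockSystem B d) (n l m : ℕ) :
    ∑ a, (((B a).card : ℝ) / Real.sqrt n) ^ (l + m + 1) ≤
      d ^ l * p ^ (m + 1) / Real.sqrt n ^ (l + m + 1) := by
  simp only [div_pow]
  rw [← Finset.sum_div]
  gcongr
  exact_mod_cast hB.sum_card_pow_le l m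

/-- The standing assumptions on a row: blocks of size at most `d`, a dimension `p` at most
proportional to `n`, and a covariance matrix bounded by `M`; `K` is a bound for moments. -/
structure BlockRegime (B : Fin k → Finset (Fin p)) (Sig : Matrix (Fin p) (Fin p) ℝ) (n d : ℕ)
    (M K θ : ℝ) : Prop extends IsBlockSystem B d where
  n_pos : 0 < n
  one_le_d : 1 ≤ d
  one_le_θ : 1 ≤ θ
  p_le : (p : ℝ) ≤ θ * n
  one_le_K : 1 ≤ K
  M_nonneg : 0 ≤ M
  quadratic_le : ∀ v : Fin p → ℝ, v ⬝ᵥ Sig.mulVec v ≤ M * (v ⬝ᵥ v)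

variable {n : ℕ} {Sig : Matrix (Fin p) (Fin p) ℝ} {M K θ : ℝ}

theorem BlockRegime.sum_card_div_le (hB : BlockRegime B Sig n d M K θ) :
    ∑ a, ((B a).card : ℝ) / n ≤ θ := by
  have n_pos : (0 : ℝ) < n := mod_cast hB.n_pos
  rw [← Finset.sum_div, div_le_iff₀ n_pos]
  exact le_trans (mod_cast hB.sum_card_le) hB.p_le

theorem BlockRegime.mul_sum_card_div_sqrt_pow_le (hB : BlockRegime B Sig n d M K θ) {h i : ℕ}
    (hi : i + 2 ≤ h) :
    K * ∑ a, (((B a).card : ℝ) / Real.sqrt n) ^ (2 * (i + 2)) ≤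
      ((1 + M) * K * θ) ^ (i + 2) * (1 + (d : ℝ) ^ (h + 1) / n) := by
  have n_pos : (0 : ℝ) < n := mod_cast hB.n_pos
  have hK := hB.one_le_K
  have hM := hB.M_nonneg
  have hθ := hB.one_le_θ
  have sum_le : ∑ a, (((B a).card : ℝ) / Real.sqrt n) ^ (2 * (i + 2)) ≤
      θ ^ (i + 1) * ((d : ℝ) ^ (h + 1) / n) := by
    calc _ ≤ (d : ℝ) ^ (i + 3) * p ^ (i + 1) / Real.sqrt n ^ (2 * (i + 2)) := by
          simpa only [show i + 3 + i + 1 = 2 * (i + 2) by omega]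
            using hB.sum_card_div_sqrt_pow_le n (i + 3) i
      _ ≤ (d : ℝ) ^ (h + 1) * (θ * n) ^ (i + 1) / Real.sqrt n ^ (2 * (i + 2)) := by
          have d_pow_le : (d : ℝ) ^ (i + 3) ≤ (d : ℝ) ^ (h + 1) :=
            pow_le_pow_right₀ (mod_cast hB.one_le_d) (by omega)
          gcongr
          exact hB.p_le
      _ = θ ^ (i + 1) * ((d : ℝ) ^ (h + 1) / n) := by
          rw [pow_mul, Real.sq_sqrt n_pos.le]
          field_simp
          ring
  have const_le : K * θ ^ (i + 1) ≤ ((1 + M) * K * θ) ^ (i + 2) := by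
    rw [mul_pow, mul_pow]
    calc K * θ ^ (i + 1) ≤ K ^ (i + 2) * θ ^ (i + 2) :=
          mul_le_mul (le_self_pow₀ hK (by omega)) (pow_le_pow_right₀ hθ (by omega))
            (by positivity) (by positivity)
      _ ≤ (1 + M) ^ (i + 2) * K ^ (i + 2) * θ ^ (i + 2) := by
          rw [mul_assoc]
          exact le_mul_of_one_le_left (by positivity) (one_le_pow₀ (by linarith))
  calc _ ≤ K * (θ ^ (i + 1) * ((d : ℝ) ^ (h + 1) / n)) := by gcongr
    _ = K * θ ^ (i + 1) * ((d : ℝ) ^ (h + 1) / n) := by ring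
    _ ≤ _ := by gcongr; linarith

end BlockSystem

section Hybrid

variable {p k n r d h : ℕ} {B : Fin k → Finset (Fin p)} {Sig : Matrix (Fin p) (Fin p) ℝ}
  {M K θ L : ℝ} {ρ : Fin k → Measure (Fin p → ℝ)}

/-- The law of a family of independent blocks, the block on the cell `B a` being drawn from the
row law `ρ a`. -/
noncomputable abbrev hybridLaw (B : Fin k → Finset (Fin p)) (ρ : Fin k → Measure (Fin p → ℝ)) :
    Measure (Fin k → Fin p → ℝ) :=
  Measure.pi fun a => (ρ a).map (blockPart (B a))

instance isProbabilityMeasure_map_blockPart (μ : Measure (Fin p → ℝ)) [IsProbabilityMeasure μ]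
    (s : Finset (Fin p)) : IsProbabilityMeasure (μ.map (blockPart s)) :=
  Measure.isProbabilityMeasure_map (measurable_blockPart s).aemeasurable

theorem measurable_dotProduct (u : Fin p → ℝ) : Measurable (fun y : Fin p → ℝ => y ⬝ᵥ u) := by
  unfold dotProduct
  fun_prop

variable [∀ a, IsProbabilityMeasure (ρ a)]

theorem integral_hybridLaw_eval (b : Fin k) {f : (Fin p → ℝ) → ℝ} (hf : Measurable f) :
    ∫ x, f (x b) ∂hybridLaw B ρ = ∫ y, f (blockPart (B b) y) ∂ρ b := by
  rw [integral_comp_eval hf.aestronglyMeasurable,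
    integral_map (measurable_blockPart _).aemeasurable hf.aestronglyMeasurable]

theorem memLp_hybridLaw_eval_dotProduct (hρ : ∀ a, RowLaw B Sig n r K (ρ a)) (b : Fin k)
    (u : Fin p → ℝ) : MemLp (fun x => x b ⬝ᵥ u) (r : ℝ≥0∞) (hybridLaw B ρ) := by
  have memLp : MemLp (fun y => y ⬝ᵥ u) (r : ℝ≥0∞) ((ρ b).map (blockPart (B b))) := by
    rw [memLp_map_measure_iff (measurable_dotProduct u).aestronglyMeasurable
      (measurable_blockPart _).aemeasurable]
    simpa only [Function.comp_def, blockPart_dotProduct] using (hρ b).memLp_dotProduct _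
  exact memLp.comp_measurePreserving (measurePreserving_eval _ b)

theorem integral_hybridLaw_eval_dotProduct (hρ : ∀ a, RowLaw B Sig n r K (ρ a)) (hr : 1 ≤ r)
    (b : Fin k) (u : Fin p → ℝ) : ∫ x, x b ⬝ᵥ u ∂hybridLaw B ρ = 0 := by
  rw [integral_hybridLaw_eval b (measurable_dotProduct u)]
  simpa only [blockPart_dotProduct] using (hρ b).integral_dotProduct hr _

theorem sum_integral_hybridLaw_sq_le (hB : BlockRegime B Sig n d M K θ)
    (hρ : ∀ a, RowLaw B Sig n r K (ρ a)) (hr : 2 ≤ r) {u : Fin p → ℝ} (hu : ‖u‖ ≤ L) :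
    ∑ b, ∫ x, (x b ⬝ᵥ u) ^ 2 ∂hybridLaw B ρ ≤ L ^ 2 * ((1 + M) * K * θ) := by
  have hM := hB.M_nonneg
  calc ∑ b, ∫ x, (x b ⬝ᵥ u) ^ 2 ∂hybridLaw B ρ ≤ ∑ b, M * L ^ 2 * ((B b).card / n) := by
        refine Finset.sum_le_sum fun b _ => ?_
        rw [integral_hybridLaw_eval b (f := fun y => (y ⬝ᵥ u) ^ 2)
          ((measurable_dotProduct u).pow_const 2)]
        exact (hρ b).integral_blockPart_dotProduct_sq_le hr hM hB.quadratic_le _ hu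
    _ = L ^ 2 * (M * ∑ b, ((B b).card / n : ℝ)) := by rw [← Finset.mul_sum]; ring
    _ ≤ L ^ 2 * (((1 + M) * K) * θ) := by
        have := hB.one_le_θ
        have := hB.one_le_K
        gcongr
        · nlinarith
        · exact hB.sum_card_div_le

theorem sum_integral_hybridLaw_pow_le (hB : BlockRegime B Sig n d M K θ)
    (hρ : ∀ a, RowLaw B Sig n r K (ρ a)) (hr : 2 * h ≤ r) {u : Fin p → ℝ} (hu : ‖u‖ ≤ L)
    {j : ℕ} (hj : 1 ≤ j) (hjh : j ≤ h) :
    ∑ b, ∫ x, (x b ⬝ᵥ u) ^ (2 * j) ∂hybridLaw B ρ ≤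
      (L ^ 2 * ((1 + M) * K * θ)) ^ j * (1 + (d : ℝ) ^ (h + 1) / n) := by
  rcases Nat.lt_or_ge j 2 with hj2 | hj2
  · obtain rfl : j = 1 := by omega
    have sum_le := sum_integral_hybridLaw_sq_le hB hρ (by omega) hu
    rw [mul_one, pow_one]
    refine sum_le.trans (le_mul_of_one_le_right (le_trans (Finset.sum_nonneg fun b _ =>
      integral_nonneg fun x => sq_nonneg _) sum_le) (le_add_of_nonneg_right (by positivity)))
  obtain ⟨i, rfl⟩ := Nat.exists_eq_add_of_le' hj2
  calc _ ≤ ∑ b, K * (L ^ (2 * (i + 2)) * (((B b).card : ℝ) / Real.sqrt n) ^ (2 * (i + 2))) := by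
        refine Finset.sum_le_sum fun b _ => ?_
        rw [integral_hybridLaw_eval b (f := fun y => (y ⬝ᵥ u) ^ (2 * (i + 2)))
          ((measurable_dotProduct u).pow_const _)]
        exact (hρ b).integral_blockPart_dotProduct_pow_le hB.one_le_K _ hu (by omega)
    _ = (L ^ 2) ^ (i + 2) *
          (K * ∑ b, (((B b).card : ℝ) / Real.sqrt n) ^ (2 * (i + 2))) := by
        rw [← Finset.mul_sum, ← Finset.mul_sum, ← pow_mul]
        ring
    _ ≤ (L ^ 2) ^ (i + 2) * (((1 + M) * K * θ) ^ (i + 2) * (1 + (d : ℝ) ^ (h + 1) / n)) :=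
        mul_le_mul_of_nonneg_left (hB.mul_sum_card_div_sqrt_pow_le hjh) (by positivity)
    _ = _ := by rw [← mul_assoc, ← mul_pow]

theorem integrable_hybridLaw_pow (hρ : ∀ a, RowLaw B Sig n r K (ρ a)) (hr : h ≤ r)
    (u : Fin p → ℝ) (t : Finset (Fin k)) :
    Integrable (fun x => ((∑ b ∈ t, x b) ⬝ᵥ u) ^ h) (hybridLaw B ρ) := by
  simp only [sum_dotProduct]
  exact integrable_pow_of_memLp
    (memLp_finsetSum t fun b _ => memLp_hybridLaw_eval_dotProduct hρ b u) hr

theorem integral_hybridLaw_pow_le (hB : BlockRegime B Sig n d M K θ)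
    (hρ : ∀ a, RowLaw B Sig n r K (ρ a)) (hr : 2 * h ≤ r) (hr2 : 2 ≤ r) {u : Fin p → ℝ}
    (hu : ‖u‖ ≤ L) (t : Finset (Fin k)) :
    ∫ x, ((∑ b ∈ t, x b) ⬝ᵥ u) ^ (2 * h) ∂hybridLaw B ρ ≤
      sumMomentConst h * (L ^ 2 * ((1 + M) * K * θ)) ^ h * (1 + (d : ℝ) ^ (h + 1) / n) := by
  have hL : 0 ≤ L := (norm_nonneg u).trans hu
  have scale_nonneg : 0 ≤ (1 + M) * K * θ :=
    mul_nonneg (mul_nonneg (by linarith [hB.M_nonneg]) (by linarith [hB.one_le_K]))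
      (by linarith [hB.one_le_θ])
  have scale_pow (j : ℕ) : (L * Real.sqrt ((1 + M) * K * θ)) ^ (2 * j) =
      (L ^ 2 * ((1 + M) * K * θ)) ^ j := by
    rw [pow_mul, mul_pow, Real.sq_sqrt scale_nonneg]
  have independent : iIndepFun (fun b (x : Fin k → Fin p → ℝ) => x b ⬝ᵥ u) (hybridLaw B ρ) :=
    iIndepFun_pi (X := fun _ y => y ⬝ᵥ u) fun _ => (measurable_dotProduct u).aemeasurable
  simp only [sum_dotProduct]
  rw [← scale_pow]
  refine integral_sum_pow_le independent
    (integral_hybridLaw_eval_dotProduct hρ (by omega) · u)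
    (fun b => (memLp_hybridLaw_eval_dotProduct hρ b u).mono_exponent (by exact_mod_cast hr))
    (by positivity) (le_add_of_nonneg_right (by positivity)) ?_
    (fun j hj hjh => ?_) le_rfl (Finset.subset_univ t)
  · rw [scale_pow 1, pow_one]
    exact sum_integral_hybridLaw_sq_le hB hρ hr2 hu
  · rw [scale_pow]
    exact sum_integral_hybridLaw_pow_le hB hρ hr hu hj hjh

end Hybrid

section SigmaRate

/-- Half of the even exponent `qBar q`. -/
noncomputable def qHalf (q : Fin 4 → ℝ) : ℕ := ⌈q 0 * bigQ q / 2⌉₊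

theorem qBar_eq_two_mul_qHalf (q : Fin 4 → ℝ) : qBar q = 2 * qHalf q := rfl

theorem rpow_div_two_eq_sqrt_pow (n l : ℕ) : (n : ℝ) ^ ((l : ℝ) / 2) = Real.sqrt n ^ l := by
  rw [Real.sqrt_eq_rpow, ← Real.rpow_natCast, ← Real.rpow_mul n.cast_nonneg]
  congr 1
  ring

variable {n p d : ℕ}

theorem sigmaRate_eq (p d : ℕ) (q : Fin 4 → ℝ) (hn : 0 < n) :
    sigmaRate n p d q = p * (d : ℝ) ^ 2 / Real.sqrt n ^ 3 *
      (1 + (d : ℝ) ^ (qHalf q + 1) / n + (d / Real.sqrt n) ^ qBar q) := by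
  have n_pos : (0 : ℝ) < n := mod_cast hn
  have : 0 < Real.sqrt n := Real.sqrt_pos.2 n_pos
  have five : (n : ℝ) ^ ((5 : ℝ) / 2) = Real.sqrt n ^ 3 * n := by
    calc (n : ℝ) ^ ((5 : ℝ) / 2) = Real.sqrt n ^ 5 := mod_cast rpow_div_two_eq_sqrt_pow n 5
      _ = Real.sqrt n ^ 3 * Real.sqrt n ^ 2 := by ring
      _ = _ := by rw [Real.sq_sqrt n_pos.le]
  have three : (n : ℝ) ^ ((3 : ℝ) / 2) = Real.sqrt n ^ 3 := mod_cast rpow_div_two_eq_sqrt_pow n 3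
  have top : (n : ℝ) ^ (((qBar q : ℝ) + 3) / 2) = Real.sqrt n ^ (qBar q + 3) :=
    mod_cast rpow_div_two_eq_sqrt_pow n (qBar q + 3)
  have half : (d : ℝ) ^ (3 + (qBar q : ℝ) / 2) = (d : ℝ) ^ (3 + qHalf q) := by
    rw [qBar_eq_two_mul_qHalf, ← Real.rpow_natCast]
    push_cast
    congr 1
    ring
  rw [sigmaRate, five, three, top, half, div_pow]
  field_simp
  ring

theorem sigmaRate_pos (q : Fin 4 → ℝ) (hn : 0 < n) (hp : 0 < p) (hd : 0 < d) :
    0 < sigmaRate n p d q := by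
  rw [sigmaRate_eq p d q hn]
  positivity

end SigmaRate

section BlockSwap

variable {p k n r d : ℕ} {B : Fin k → Finset (Fin p)} {Sig : Matrix (Fin p) (Fin p) ℝ} {K : ℝ}
  {μ ν : Measure (Fin p → ℝ)}

theorem RowLaw.integral_eq_integral_hybridLaw (hμ : RowLaw B Sig n r K μ) {g : (Fin p → ℝ) → ℝ}
    (hg : Measurable g) : ∫ x, g x ∂μ = ∫ x, g (∑ a, x a) ∂hybridLaw B fun _ => μ := by
  conv_lhs => rw [← hμ.blocks]
  exact integral_map (Finset.measurable_sum _ fun a _ => measurable_pi_apply a).aemeasurable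
    hg.aestronglyMeasurable

variable [IsProbabilityMeasure μ] [IsProbabilityMeasure ν]

theorem RowLaw.abs_integral_map_blockPart_sub_le (hμ : RowLaw B Sig n r K μ)
    (hν : RowLaw B Sig n r K ν) (hK : 1 ≤ K) (s : Finset (Fin p)) {m : ℕ} (hr : m + 3 ≤ r)
    {g : (Fin p → ℝ) → ℝ} (hg : Measurable g) {b : ℝ} (hgb : ∀ y, |g y| ≤ b) {g₀ T L v : ℝ}
    (hT : 0 ≤ T) (hL : 0 ≤ L) (hv : 0 ≤ v) {α : Fin p → ℝ} {A : Fin p → Fin p → ℝ}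
    (h : ∀ y, |g y - g₀ - ∑ j, α j * y j - ∑ i, ∑ j, A i j * (y i * y j)| ≤
      T * (L * ∑ j, |y j|) ^ 3 * (1 + (L * ∑ j, |y j|) ^ m + v)) :
    |∫ y, g y ∂μ.map (blockPart s) - ∫ y, g y ∂ν.map (blockPart s)| ≤
      2 * T * L ^ 3 * K * ((s.card : ℝ) / Real.sqrt n) ^ 3 *
        (1 + v + (L * (s.card / Real.sqrt n)) ^ m) := by
  have bound_μ := hμ.abs_integral_blockPart_sub_quadratic_le hK s hr hg hgb hT hL hv h
  have bound_ν := hν.abs_integral_blockPart_sub_quadratic_le hK s hr hg hgb hT hL hv h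
  rw [integral_map (measurable_blockPart s).aemeasurable hg.aestronglyMeasurable,
    integral_map (measurable_blockPart s).aemeasurable hg.aestronglyMeasurable]
  rw [abs_le] at bound_μ bound_ν ⊢
  constructor <;> linarith [bound_μ.1, bound_μ.2, bound_ν.1, bound_ν.2]

theorem sum_update_eq_sum_erase_add (x : Fin k → Fin p → ℝ) (a : Fin k) (y : Fin p → ℝ) :
    ∑ b, Function.update x a y b = ∑ b ∈ Finset.univ.erase a, x b + y := by
  rw [Finset.sum_update_of_mem (Finset.mem_univ a), Finset.sdiff_singleton_eq_erase, add_comm]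

/-- Both laws have the same first and second block moments, so a function that is a quadratic
polynomial up to a third-order remainder hardly notices the replacement of one block. -/
theorem RowLaw.abs_integral_sub_le_sum (hμ : RowLaw B Sig n r K μ) (hν : RowLaw B Sig n r K ν)
    (hK : 1 ≤ K) {m : ℕ} (hr : m + 3 ≤ r) {g v : (Fin p → ℝ) → ℝ} (hg : Measurable g) {b : ℝ}
    (hgb : ∀ y, |g y| ≤ b) {T L S : ℝ} (hT : 0 ≤ T) (hL : 0 ≤ L) (hv : ∀ x, 0 ≤ v x)
    (taylor : ∀ x, ∃ (α : Fin p → ℝ) (A : Fin p → Fin p → ℝ), ∀ y,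
      |g (x + y) - g x - ∑ j, α j * y j - ∑ i, ∑ j, A i j * (y i * y j)| ≤
        T * (L * ∑ j, |y j|) ^ 3 * (1 + (L * ∑ j, |y j|) ^ m + v x))
    (hS : ∀ (ρ : Fin k → Measure (Fin p → ℝ)) [∀ a, IsProbabilityMeasure (ρ a)],
      (∀ a, RowLaw B Sig n r K (ρ a)) → ∀ t : Finset (Fin k),
        Integrable (fun x => v (∑ b ∈ t, x b)) (hybridLaw B ρ) ∧
        ∫ x, v (∑ b ∈ t, x b) ∂hybridLaw B ρ ≤ S) :
    |∫ x, g x ∂μ - ∫ x, g x ∂ν| ≤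
      ∑ a, 2 * T * L ^ 3 * K * (((B a).card : ℝ) / Real.sqrt n) ^ 3 *
        (1 + S + (L * ((B a).card / Real.sqrt n)) ^ m) := by
  rw [hμ.integral_eq_integral_hybridLaw hg, hν.integral_eq_integral_hybridLaw hg]
  refine abs_integral_pi_sub_le _ _ (f := fun x => g (∑ a, x a))
    (hg.comp (Finset.measurable_sum _ fun a _ => measurable_pi_apply a)) (fun x => hgb _)
    fun a m' hm' => ?_
  have hybrid (a) : ∃ ρ : Measure (Fin p → ℝ), IsProbabilityMeasure ρ ∧ RowLaw B Sig n r K ρ ∧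
      m' a = ρ.map (blockPart (B a)) :=
    (hm' a).elim (⟨μ, inferInstance, hμ, ·⟩) (⟨ν, inferInstance, hν, ·⟩)
  choose ρ hρ_prob hρ hm'_eq using hybrid
  obtain rfl : m' = fun a => (ρ a).map (blockPart (B a)) := funext hm'_eq
  obtain ⟨v_integrable, v_le⟩ := hS ρ hρ (Finset.univ.erase a)
  set x₀ : (Fin k → Fin p → ℝ) → Fin p → ℝ := fun x => ∑ b ∈ Finset.univ.erase a, x b
  set E := 2 * T * L ^ 3 * K * (((B a).card : ℝ) / Real.sqrt n) ^ 3
  have one_add_v_integrable : Integrable (fun x => 1 + v (x₀ x)) (hybridLaw B ρ) :=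
    (integrable_const 1).add v_integrable
  rw [← Real.norm_eq_abs]
  refine (norm_integral_le_of_norm_le (g := fun x =>
    E * (1 + v (x₀ x) + (L * ((B a).card / Real.sqrt n)) ^ m))
    ((one_add_v_integrable.add (integrable_const _)).const_mul E)
    (ae_of_all _ fun x => ?_)).trans ?_
  · simp only [sum_update_eq_sum_erase_add]
    obtain ⟨α, A, h⟩ := taylor (x₀ x)
    exact hμ.abs_integral_map_blockPart_sub_le hν hK (B a) hr (g := fun y => g (x₀ x + y))
      (hg.comp (measurable_const_add _)) (fun y => hgb _) hT hL (hv _) h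
  · rw [integral_const_mul, integral_add one_add_v_integrable (integrable_const _),
      integral_add (integrable_const 1) v_integrable]
    simp only [integral_const, probReal_univ, smul_eq_mul, one_mul]
    gcongr

end BlockSwap

section RowSwap

variable {p k n r d : ℕ} {q : Fin 4 → ℝ} {B : Fin k → Finset (Fin p)}
  {Sig : Matrix (Fin p) (Fin p) ℝ} {M K θ L T : ℝ}

/-- The constant in the comparison of the expectations of a function of one row under two row
laws. -/
noncomputable def rowConst (q : Fin 4 → ℝ) (M K θ : ℝ) : ℝ :=
  2 * K * (1 + sumMomentConst (qHalf q) * ((1 + M) * K * θ) ^ qHalf q)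

theorem rowConst_nonneg (hM : 0 ≤ M) (hK : 0 ≤ K) (hθ : 0 ≤ θ) : 0 ≤ rowConst q M K θ := by
  have := (sumMomentConst_pos (qHalf q)).le
  unfold rowConst
  positivity

theorem one_add_add_le_mul_one_add {l x e g : ℝ} (hl : 1 ≤ l) (hx : 0 ≤ x) (he : 0 ≤ e)
    (hg : 0 ≤ g) : 1 + l * x * (1 + e) + l * g ≤ l * ((1 + x) * (1 + e + g)) := by
  have : 0 ≤ l * (e + x * g) := by positivity
  nlinarith

theorem BlockRegime.sum_swap_le (hB : BlockRegime B Sig n d M K θ) (hL : 1 ≤ L) (hT : 0 ≤ T) :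
    ∑ a, 2 * T * L ^ 3 * K * (((B a).card : ℝ) / Real.sqrt n) ^ 3 *
      (1 + sumMomentConst (qHalf q) * (L ^ 2 * ((1 + M) * K * θ)) ^ qHalf q *
        (1 + (d : ℝ) ^ (qHalf q + 1) / n) + (L * ((B a).card / Real.sqrt n)) ^ qBar q) ≤
      rowConst q M K θ * T * L ^ (qBar q + 3) * sigmaRate n p d q := by
  have hK := hB.one_le_K
  have hM := hB.M_nonneg
  have hθ := hB.one_le_θ
  have hC := sumMomentConst_pos (qHalf q)
  set x := sumMomentConst (qHalf q) * ((1 + M) * K * θ) ^ qHalf q with hx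
  set e := (d : ℝ) ^ (qHalf q + 1) / n
  set g := ((d : ℝ) / Real.sqrt n) ^ qBar q with hg
  have moment : sumMomentConst (qHalf q) * (L ^ 2 * ((1 + M) * K * θ)) ^ qHalf q =
      L ^ qBar q * x := by
    rw [mul_pow, ← pow_mul, ← qBar_eq_two_mul_qHalf, hx]
    ring
  have cubes : ∑ a, (((B a).card : ℝ) / Real.sqrt n) ^ 3 ≤ p * (d : ℝ) ^ 2 / Real.sqrt n ^ 3 := by
    simpa only [zero_add, add_zero, pow_one, mul_comm ((d : ℝ) ^ 2)]
      using hB.sum_card_div_sqrt_pow_le n 2 0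
  calc _ ≤ ∑ a, (((B a).card : ℝ) / Real.sqrt n) ^ 3 *
        (2 * T * L ^ 3 * K * (1 + L ^ qBar q * x * (1 + e) + L ^ qBar q * g)) := by
        refine Finset.sum_le_sum fun a _ => ?_
        rw [moment, hg, ← mul_pow, mul_comm (2 * T * L ^ 3 * K), mul_assoc]
        gcongr
        exact hB.card_le a
    _ ≤ p * (d : ℝ) ^ 2 / Real.sqrt n ^ 3 *
          (2 * T * L ^ 3 * K * (L ^ qBar q * ((1 + x) * (1 + e + g)))) := by
        rw [← Finset.sum_mul]
        gcongr
        exact one_add_add_le_mul_one_add (one_le_pow₀ hL) (by positivity) (by positivity)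
          (by positivity)
    _ = _ := by
        rw [sigmaRate_eq p d q hB.n_pos, rowConst, pow_add]
        ring

variable {N : Finset (Fin p → ℝ)} {c : (Fin p → ℝ) → ℝ} {φ ℓ : ℝ → ℝ} {D Λ κ s : ℝ}

theorem continuous_rowFun (hN : N.Nonempty) (hc : ∀ u ∈ N, 0 < c u) (hφ : Continuous φ)
    (hℓ : Continuous ℓ) (s : ℝ) : Continuous (rowFun N c φ ℓ s) := by
  refine hφ.comp (continuous_const.mul (Continuous.log ?_ fun x =>
    (sum_gibbsWeight_pos hN hc _).ne'))
  unfold gibbsWeight dotProduct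
  fun_prop

theorem hybridLaw_gibbsAvg_pow (hB : BlockRegime B Sig n d M K θ) (hr : qBar q + 3 ≤ r)
    (hN : N.Nonempty) (hc : ∀ u ∈ N, 0 < c u) (hNL : ∀ u ∈ N, ‖u‖ ≤ L)
    (ρ : Fin k → Measure (Fin p → ℝ)) [∀ a, IsProbabilityMeasure (ρ a)]
    (hρ : ∀ a, RowLaw B Sig n r K (ρ a)) (t : Finset (Fin k)) :
    Integrable (fun x => gibbsAvg N c fun u => ((∑ b ∈ t, x b) ⬝ᵥ u) ^ qBar q) (hybridLaw B ρ) ∧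
      ∫ x, (gibbsAvg N c fun u => ((∑ b ∈ t, x b) ⬝ᵥ u) ^ qBar q) ∂hybridLaw B ρ ≤
        sumMomentConst (qHalf q) * (L ^ 2 * ((1 + M) * K * θ)) ^ qHalf q *
          (1 + (d : ℝ) ^ (qHalf q + 1) / n) := by
  have integrable (u : Fin p → ℝ) : Integrable
      (fun x => c u * ((∑ b ∈ t, x b) ⬝ᵥ u) ^ qBar q) (hybridLaw B ρ) :=
    (integrable_hybridLaw_pow hρ (by omega) u t).const_mul _
  refine ⟨(integrable_finsetSum N fun u _ => integrable u).div_const _, ?_⟩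
  simp only [gibbsAvg]
  rw [integral_div, integral_finsetSum N fun u _ => integrable u]
  simp only [integral_const_mul]
  rw [qBar_eq_two_mul_qHalf] at hr ⊢
  exact gibbsAvg_le_of_le (fun u hu => (hc u hu).le) (Finset.sum_pos hc hN).ne' fun u hu =>
    integral_hybridLaw_pow_le hB hρ (by omega) (by omega) (hNL u hu) t

theorem BlockRegime.abs_integral_rowFun_sub_le {μ ν : Measure (Fin p → ℝ)}
    [IsProbabilityMeasure μ] [IsProbabilityMeasure ν] (hB : BlockRegime B Sig n d M K θ)
    (hμ : RowLaw B Sig n r K μ) (hν : RowLaw B Sig n r K ν) (hq : ∀ k, 0 ≤ q k)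
    (hr : qBar q + 3 ≤ r) (hL : 1 ≤ L) (hℓ : SmoothLoss q D Λ ℓ) (hφ : SmoothTest κ φ)
    (hD : 1 ≤ D) (hΛ : 1 ≤ Λ) (hs : 0 < s) (hN : N.Nonempty) (hNL : ∀ u ∈ N, ‖u‖ ≤ L)
    (hc : ∀ u ∈ N, 0 < c u) :
    |∫ x, rowFun N c φ ℓ s x ∂μ - ∫ x, rowFun N c φ ℓ s x ∂ν| ≤
      rowConst q M K θ * taylorConst q s D Λ κ * L ^ (qBar q + 3) * sigmaRate n p d q := by
  have hT : 0 ≤ taylorConst q s D Λ κ := by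
    have := hφ.bound_nonneg
    unfold taylorConst
    positivity
  refine (hμ.abs_integral_sub_le_sum hν hB.one_le_K hr (b := 1)
    (continuous_rowFun hN hc hφ.contDiff.continuous hℓ.contDiff.continuous s).measurable
    (fun x => abs_le.2 ⟨neg_one_lt_zero.le.trans (hφ.mem_Icc _).1, (hφ.mem_Icc _).2⟩) hT
    (by positivity)
    (fun x => gibbsAvg_nonneg (fun u hu => (hc u hu).le) fun u _ => (even_qBar q).pow_nonneg _)
    (exists_rowFun_taylor hq hℓ hφ hD hΛ (by positivity) hs hN hNL hc)
    (hybridLaw_gibbsAvg_pow hB hr hN hc hNL)).trans (hB.sum_swap_le hL hT)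

end RowSwap

section SoftMin

variable {ι : Type*} {N : Finset ι} {s : ℝ} {z : ι → ℝ}

theorem freeEnergy_add (N : Finset ι) (c : ι → ℝ) (s : ℝ) (z z' : ι → ℝ) :
    freeEnergy N c s (fun u => z u + z' u) =
      freeEnergy N (fun u => c u * Real.exp (-s * z' u)) s z := by
  unfold freeEnergy gibbsWeight
  congr! 3
  rw [mul_assoc, ← Real.exp_add]
  congr 2
  ring

theorem freeEnergy_one_le (hs : 0 < s) {u : ι} (hu : u ∈ N) :
    freeEnergy N (fun _ => 1) s z ≤ z u := by
  have single_le : Real.exp (-s * z u) ≤ ∑ v ∈ N, gibbsWeight (fun _ => 1) s z v := by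
    simpa only [gibbsWeight, one_mul] using
      Finset.single_le_sum (f := fun v => Real.exp (-s * z v)) (fun v _ => (Real.exp_pos _).le) hu
  have log_le := Real.log_le_log (Real.exp_pos _) single_le
  rw [Real.log_exp] at log_le
  calc freeEnergy N (fun _ => 1) s z ≤ -(1 / s) * (-s * z u) :=
        mul_le_mul_of_nonpos_left log_le (neg_nonpos.2 (by positivity))
    _ = z u := by field_simp

theorem sub_log_card_div_le_freeEnergy_one (hs : 0 < s) (hN : N.Nonempty) {b : ℝ}
    (hb : ∀ u ∈ N, b ≤ z u) : b - Real.log N.card / s ≤ freeEnergy N (fun _ => 1) s z := by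
  have card_pos : (0 : ℝ) < N.card := mod_cast hN.card_pos
  have sum_le : ∑ u ∈ N, gibbsWeight (fun _ => 1) s z u ≤ N.card * Real.exp (-s * b) := by
    rw [← nsmul_eq_mul]
    refine Finset.sum_le_card_nsmul _ _ _ fun u hu => ?_
    rw [gibbsWeight, one_mul, Real.exp_le_exp]
    exact mul_le_mul_of_nonpos_left (hb u hu) (neg_nonpos.2 hs.le)
  have log_le := Real.log_le_log (sum_gibbsWeight_pos hN (fun _ _ => one_pos) z) sum_le
  rw [Real.log_mul card_pos.ne' (Real.exp_pos _).ne', Real.log_exp] at log_le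
  calc b - Real.log N.card / s = -(1 / s) * (Real.log N.card + -s * b) := by
        field_simp
        ring
    _ ≤ _ := mul_le_mul_of_nonpos_left log_le (neg_nonpos.2 (by positivity))

theorem SmoothTest.comp_mul {κ a c : ℝ} {φ : ℝ → ℝ} (hφ : SmoothTest κ φ)
    (hc : ∀ k ∈ Finset.Icc 1 3, |a| ^ k ≤ c) : SmoothTest (c * κ) (fun x => φ (a * x)) where
  mem_Icc x := hφ.mem_Icc _
  contDiff := hφ.contDiff.comp (contDiff_const.mul contDiff_id)
  deriv_le k hk x := by
    rw [iteratedDeriv_comp_const_mul (hφ.contDiff.of_le (mod_cast (Finset.mem_Icc.1 hk).2)),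
      abs_mul, abs_pow]
    exact mul_le_mul (hc k hk) (hφ.deriv_le k hk _) (abs_nonneg _)
      ((pow_nonneg (abs_nonneg a) k).trans (hc k hk))

end SoftMin

section SoftRisk

variable {p k n r d : ℕ} {q : Fin 4 → ℝ} {N : Finset (Fin p → ℝ)} {ℓ : Fin n → ℝ → ℝ}
  {R : (Fin p → ℝ) → ℝ} {s : ℝ}

/-- The soft minimum of the risk over `N` at inverse temperature `n * s`. -/
noncomputable def softRisk (N : Finset (Fin p → ℝ)) (ℓ : Fin n → ℝ → ℝ) (R : (Fin p → ℝ) → ℝ)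
    (s : ℝ) (A : Matrix (Fin n) (Fin p) ℝ) : ℝ :=
  1 / n * freeEnergy N (fun _ => 1) s (fun u => n * risk ℓ R u A)

theorem softRisk_le_risk (hs : 0 < s) (hn : 0 < n) (A : Matrix (Fin n) (Fin p) ℝ)
    {u : Fin p → ℝ} (hu : u ∈ N) : softRisk N ℓ R s A ≤ risk ℓ R u A := by
  calc softRisk N ℓ R s A ≤ 1 / n * (n * risk ℓ R u A) :=
        mul_le_mul_of_nonneg_left (freeEnergy_one_le hs hu) (by positivity)
    _ = risk ℓ R u A := by field_simp

theorem le_softRisk_of_forall_le (hs : 0 < s) (hn : 0 < n) (A : Matrix (Fin n) (Fin p) ℝ)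
    (hN : N.Nonempty) {b : ℝ} (hb : ∀ u ∈ N, b ≤ risk ℓ R u A) :
    b - Real.log N.card / (n * s) ≤ softRisk N ℓ R s A := by
  calc b - Real.log N.card / (n * s) = 1 / n * (n * b - Real.log N.card / s) := by field_simp
    _ ≤ softRisk N ℓ R s A :=
        mul_le_mul_of_nonneg_left (sub_log_card_div_le_freeEnergy_one hs hN fun u hu =>
          mul_le_mul_of_nonneg_left (hb u hu) n.cast_nonneg) (by positivity)

theorem mul_risk_update (ℓ : Fin n → ℝ → ℝ) (R : (Fin p → ℝ) → ℝ) (u : Fin p → ℝ)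
    (A : Fin n → Fin p → ℝ) (i : Fin n) (y : Fin p → ℝ) :
    n * risk ℓ R u (Matrix.of (Function.update A i y)) =
      ℓ i (y ⬝ᵥ u) + (∑ j ∈ Finset.univ.erase i, ℓ j (A j ⬝ᵥ u) + n * R u) := by
  have n_ne_zero : (n : ℝ) ≠ 0 := mod_cast i.pos.ne'
  have row (j : Fin n) : (Matrix.of (Function.update A i y)).mulVec u j =
      Function.update A i y j ⬝ᵥ u := rfl
  have other_rows : ∑ j ∈ Finset.univ.erase i, ℓ j (Function.update A i y j ⬝ᵥ u) =
      ∑ j ∈ Finset.univ.erase i, ℓ j (A j ⬝ᵥ u) :=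
    Finset.sum_congr rfl fun j hj => by rw [Function.update_of_ne (Finset.ne_of_mem_erase hj)]
  simp only [risk, row]
  rw [← Finset.add_sum_erase _ _ (Finset.mem_univ i), other_rows, Function.update_self]
  field_simp
  ring

theorem comp_softRisk_update_eq_rowFun (N : Finset (Fin p → ℝ)) (ℓ : Fin n → ℝ → ℝ)
    (R : (Fin p → ℝ) → ℝ) (s : ℝ) (φ : ℝ → ℝ) (A : Fin n → Fin p → ℝ) (i : Fin n)
    (y : Fin p → ℝ) :
    φ (softRisk N ℓ R s (Matrix.of (Function.update A i y))) =
      rowFun N (fun u => 1 * Real.exp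
        (-s * (∑ j ∈ Finset.univ.erase i, ℓ j (A j ⬝ᵥ u) + n * R u)))
        (fun x => φ (1 / n * x)) (ℓ i) s y := by
  simp only [softRisk, mul_risk_update, freeEnergy_add, rowFun]

theorem continuous_softRisk (hN : N.Nonempty) (hℓ : ∀ i, Continuous (ℓ i)) (R : (Fin p → ℝ) → ℝ)
    (s : ℝ) : Continuous fun A : Fin n → Fin p → ℝ => softRisk N ℓ R s (Matrix.of A) := by
  have : ∀ (i : Fin n) (u : Fin p → ℝ),
      Continuous fun A : Fin n → Fin p → ℝ => (Matrix.of A).mulVec u i := by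
    intro i u
    simp only [Matrix.mulVec, dotProduct, Matrix.of_apply]
    fun_prop
  refine continuous_const.mul (continuous_const.mul (Continuous.log ?_ fun A =>
    (sum_gibbsWeight_pos hN (fun _ _ => one_pos) _).ne'))
  unfold gibbsWeight risk
  fun_prop

/-- The constant in the comparison of the expectations of a function of the soft risk under two
i.i.d. designs. -/
noncomputable def lindebergConst (q : Fin 4 → ℝ) (M K θ : ℝ) : ℝ :=
  48 * 6 ^ bigQ q * 2 ^ qBar q * rowConst q M K θ

theorem BlockRegime.abs_integral_softRisk_sub_le {B : Fin k → Finset (Fin p)}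
    {Sig : Matrix (Fin p) (Fin p) ℝ} {M K θ L D κ : ℝ} {Λ : Fin n → ℝ} {φ : ℝ → ℝ}
    {μ ν : Measure (Fin p → ℝ)} [IsProbabilityMeasure μ] [IsProbabilityMeasure ν]
    (hB : BlockRegime B Sig n d M K θ) (hμ : RowLaw B Sig n r K μ) (hν : RowLaw B Sig n r K ν)
    (hq : ∀ k, 0 ≤ q k) (hr : qBar q + 3 ≤ r) (hL : 1 ≤ L)
    (hℓ : ∀ i, SmoothLoss q D (Λ i) (ℓ i)) (hφ : SmoothTest κ φ) (hD : 1 ≤ D) (hΛ : ∀ i, 1 ≤ Λ i)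
    (hs : 0 < s) (hN : N.Nonempty) (hNL : ∀ u ∈ N, ‖u‖ ≤ L) :
    |∫ A, φ (softRisk N ℓ R s (Matrix.of A)) ∂Measure.pi (fun _ : Fin n => μ) -
      ∫ A, φ (softRisk N ℓ R s (Matrix.of A)) ∂Measure.pi (fun _ : Fin n => ν)| ≤
      lindebergConst q M K θ * κ * (1 + s) ^ 2 * D ^ 3 *
        (avgL q Λ * L ^ (qBar q + 3) * sigmaRate n p d q) := by
  have n_inv_pow_le (m : ℕ) (hm : m ∈ Finset.Icc 1 3) : |1 / (n : ℝ)| ^ m ≤ 1 / n := by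
    have m_pos := (Finset.mem_Icc.1 hm).1
    rw [abs_of_nonneg (by positivity)]
    exact pow_le_of_le_one (by positivity)
      (div_le_one_of_le₀ (mod_cast hB.n_pos) n.cast_nonneg) (by omega)
  have continuous := hφ.contDiff.continuous.comp
    (continuous_softRisk hN (fun i => (hℓ i).contDiff.continuous) R s)
  refine (abs_integral_pi_sub_le (c := 1) (ε := fun i => rowConst q M K θ *
    taylorConst q s D (Λ i) (1 / n * κ) * L ^ (qBar q + 3) * sigmaRate n p d q) _ _
    continuous.measurable
    (fun A => abs_le.2 ⟨neg_one_lt_zero.le.trans (hφ.mem_Icc _).1, (hφ.mem_Icc _).2⟩)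
    (fun i m hm => ?_)).trans_eq ?_
  · have isProbabilityMeasure (a) : IsProbabilityMeasure (m a) := by
      rcases hm a with h | h <;> rw [h] <;> infer_instance
    simp only [Function.comp_apply, comp_softRisk_update_eq_rowFun]
    have row_le (A : Fin n → Fin p → ℝ) := hB.abs_integral_rowFun_sub_le hμ hν hq hr hL (hℓ i)
      (hφ.comp_mul n_inv_pow_le) hD (hΛ i) hs hN hNL
      (c := fun u => 1 * Real.exp (-s * (∑ j ∈ Finset.univ.erase i, ℓ j (A j ⬝ᵥ u) + n * R u)))
      fun u _ => by positivity
    simp only [← Real.norm_eq_abs] at row_le ⊢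
    simpa using norm_integral_le_of_norm_le_const (ae_of_all (Measure.pi m) row_le)
  · simp only [lindebergConst, taylorConst, avgL, Finset.mul_sum, Finset.sum_mul]
    exact Finset.sum_congr rfl fun i _ => by ring

end SoftRisk

section Net

variable {p : ℕ}

theorem exists_finset_net {L δ : ℝ} (hδ : 0 < δ) {T : Set (Fin p → ℝ)} (hT : ∀ w ∈ T, ‖w‖ ≤ L)
    (hne : T.Nonempty) :
    ∃ N : Finset (Fin p → ℝ), N.Nonempty ∧ (∀ u ∈ N, u ∈ T) ∧
      (∀ w ∈ T, ∃ u ∈ N, ‖w - u‖ ≤ δ) ∧ (N.card : ℝ) ≤ (2 * L / δ + 1) ^ p := by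
  have hL : 0 ≤ L := hne.elim fun w hw => (norm_nonneg w).trans (hT w hw)
  have coord_le {w : Fin p → ℝ} (hw : w ∈ T) (j : Fin p) : |w j| ≤ L :=
    (norm_le_pi_norm w j).trans (hT w hw)
  have coord_add_nonneg {w : Fin p → ℝ} (hw : w ∈ T) (j : Fin p) : 0 ≤ (w j + L) / δ :=
    div_nonneg (by linarith [(abs_le.1 (coord_le hw j)).1]) hδ.le
  let cell (w : Fin p → ℝ) (j : Fin p) : ℕ := ⌊(w j + L) / δ⌋₊
  let cells : Finset (Fin p → ℕ) := Fintype.piFinset fun _ => Finset.range (⌊2 * L / δ⌋₊ + 1)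
  have cell_mem : MapsTo cell T cells := fun w hw => by
    refine Finset.mem_coe.2 (Fintype.mem_piFinset.2 fun j => Finset.mem_range.2 ?_)
    have := (abs_le.1 (coord_le hw j)).2
    exact Nat.lt_succ_of_le (Nat.floor_le_floor (by gcongr; linarith))
  obtain ⟨N, hNT, cell_bij⟩ := exists_subset_bijOn T cell
  have N_finite : N.Finite := Finite.of_finite_image
    (cells.finite_toSet.subset (cell_bij.image_eq ▸ cell_mem.image_subset)) cell_bij.injOn
  lift N to Finset (Fin p → ℝ) using N_finite
  have dense (w) (hw : w ∈ T) : ∃ u ∈ N, ‖w - u‖ ≤ δ := by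
    obtain ⟨u, hu, same_cell⟩ := cell_bij.surjOn (mem_image_of_mem cell hw)
    refine ⟨u, hu, (pi_norm_le_iff_of_nonneg hδ.le).2 fun j => ?_⟩
    have floor_eq : ⌊(w j + L) / δ⌋ = ⌊(u j + L) / δ⌋ := by
      rw [← Int.natCast_floor_eq_floor (coord_add_nonneg hw j),
        ← Int.natCast_floor_eq_floor (coord_add_nonneg (hNT hu) j)]
      exact congrArg Nat.cast (congrFun same_cell j).symm
    have close := Int.abs_sub_lt_one_of_floor_eq_floor floor_eq
    rw [← sub_div, add_sub_add_right_eq_sub, abs_div, abs_of_pos hδ, div_lt_one hδ] at close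
    exact close.le
  refine ⟨N, ?_, fun u hu => hNT hu, dense, ?_⟩
  · obtain ⟨w, hw⟩ := hne
    obtain ⟨u, hu, -⟩ := dense w hw
    exact ⟨u, hu⟩
  · have card_le : N.card ≤ (⌊2 * L / δ⌋₊ + 1) ^ p := by
      simpa [cells] using Finset.card_le_card_of_injOn cell
        (fun u hu => cell_mem (hNT hu)) cell_bij.injOn
    calc (N.card : ℝ) ≤ ((⌊2 * L / δ⌋₊ : ℝ) + 1) ^ p := mod_cast card_le
      _ ≤ _ := by
        gcongr
        exact Nat.floor_le (by positivity)

theorem one_le_logPlus (x : ℝ) : 1 ≤ logPlus x := le_max_left _ _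

theorem log_two_mul_add_one_le {x : ℝ} (hx : 0 < x) : Real.log (2 * x + 1) ≤ 3 * logPlus x := by
  have log_three : Real.log 3 ≤ 2 :=
    (Real.log_le_sub_one_of_pos three_pos).trans_eq (by norm_num)
  have one_le := one_le_logPlus x
  have log_le : Real.log x ≤ logPlus x := le_max_right _ _
  rcases le_total x 1 with h | h
  · have := Real.log_le_log (by positivity) (by linarith : 2 * x + 1 ≤ 3)
    linarith
  · have := Real.log_le_log (by positivity) (by linarith : 2 * x + 1 ≤ 3 * x)
    rw [Real.log_mul three_ne_zero hx.ne'] at this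
    linarith

theorem log_card_net_le {N : Finset (Fin p → ℝ)} (hN : N.Nonempty) {L δ : ℝ} (hL : 0 < L)
    (hδ : 0 < δ) (h : (N.card : ℝ) ≤ (2 * L / δ + 1) ^ p) :
    Real.log N.card ≤ 3 * p * logPlus (L / δ) := by
  calc Real.log N.card ≤ p * Real.log (2 * (L / δ) + 1) := by
        rw [← Real.log_pow, ← mul_div_assoc]
        exact Real.log_le_log (mod_cast hN.card_pos) h
    _ ≤ p * (3 * logPlus (L / δ)) := by
        gcongr
        exact log_two_mul_add_one_le (by positivity)
    _ = _ := by ring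

end Net

section Test

theorem SmoothTest.comp_sub_const {κ : ℝ} {φ : ℝ → ℝ} (hφ : SmoothTest κ φ) (a : ℝ) :
    SmoothTest κ (fun x => φ (x - a)) where
  mem_Icc x := hφ.mem_Icc _
  contDiff := hφ.contDiff.comp (contDiff_id.sub contDiff_const)
  deriv_le k hk x := by
    rw [iteratedDeriv_comp_sub_const]
    exact hφ.deriv_le k hk _

theorem iteratedDeriv_smoothTransition_eq_zero {k : ℕ} (hk : k ≠ 0) {x : ℝ}
    (hx : x ∉ Icc (0 : ℝ) 1) : iteratedDeriv k Real.smoothTransition x = 0 := by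
  have locally_const : ∃ a : ℝ, Real.smoothTransition =ᶠ[nhds x] fun _ => a := by
    rcases lt_or_ge x 0 with x_neg | x_nonneg
    · exact ⟨0, Filter.eventually_of_mem (Iio_mem_nhds x_neg) fun y hy =>
        Real.smoothTransition.zero_of_nonpos (le_of_lt hy)⟩
    · have one_lt : 1 < x := not_le.1 fun h => hx ⟨x_nonneg, h⟩
      exact ⟨1, Filter.eventually_of_mem (Ioi_mem_nhds one_lt) fun y hy =>
        Real.smoothTransition.one_of_one_le (le_of_lt hy)⟩
  obtain ⟨a, ha⟩ := locally_const
  rw [ha.iteratedDeriv_eq k, iteratedDeriv_const, if_neg hk]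

theorem exists_smoothTest_smoothTransition : ∃ C, SmoothTest C Real.smoothTransition := by
  have bounded (k : ℕ) (hk : k ∈ Finset.Icc 1 3) :
      ∃ C, ∀ x, |iteratedDeriv k Real.smoothTransition x| ≤ C := by
    have k_ne_zero : k ≠ 0 := Nat.one_le_iff_ne_zero.1 (Finset.mem_Icc.1 hk).1
    exact (HasCompactSupport.intro isCompact_Icc fun x hx =>
      iteratedDeriv_smoothTransition_eq_zero k_ne_zero hx).exists_bound_of_continuous
      (Real.smoothTransition.contDiff.continuous_iteratedDeriv k le_rfl)
  choose! C hC using bounded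
  refine ⟨∑ k ∈ Finset.Icc 1 3, C k, fun x =>
    ⟨Real.smoothTransition.nonneg x, Real.smoothTransition.le_one x⟩,
    Real.smoothTransition.contDiff, fun k hk x => (hC k hk x).trans ?_⟩
  exact Finset.single_le_sum (fun m hm => (abs_nonneg _).trans (hC m hm 0)) hk

end Test

section LossLipschitz

variable {q : Fin 4 → ℝ} {D Λ Y T L δ : ℝ} {ℓ : ℝ → ℝ}

theorem q_one_le_bigQ (hq : ∀ k, 0 ≤ q k) : q 1 ≤ bigQ q := by
  have : 3 * q 1 ≤ bigQ q := le_max_left _ _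
  linarith [hq 1]

theorem q_zero_mul_q_one_le_qBar (hq : ∀ k, 0 ≤ q k) : q 0 * q 1 ≤ qBar q :=
  (mul_le_mul_of_nonneg_left (q_one_le_bigQ hq) (hq 0)).trans (q_zero_mul_bigQ_le_qBar q)

theorem SmoothLoss.rpow_q_one_le (hℓ : SmoothLoss q D Λ ℓ) (hq : ∀ k, 0 ≤ q k) (hΛ : 1 ≤ Λ)
    (hY : 1 ≤ Y) (hT : 0 ≤ T) {x : ℝ} (hx : |x| ≤ Y * T) :
    ℓ x ^ q 1 ≤ 6 ^ q 1 * Y ^ (q 0 * q 1) * (Λ ^ bigQ q * (1 + T ^ qBar q)) := by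
  have Y_nonneg : 0 ≤ Y := zero_le_one.trans hY
  have Λ_nonneg : 0 ≤ Λ := zero_le_one.trans hΛ
  have loss_le : ℓ x ≤ Λ * Y ^ q 0 * (5 + |T| ^ q 0) := by
    have one_le : 1 ≤ Y ^ q 0 := Real.one_le_rpow hY (hq 0)
    have abs_rpow_le : |x| ^ q 0 ≤ Y ^ q 0 * T ^ q 0 :=
      (Real.rpow_le_rpow (abs_nonneg x) hx (hq 0)).trans_eq (Real.mul_rpow Y_nonneg hT)
    calc ℓ x ≤ Λ * (2 + |x| ^ q 0) := hℓ.growth x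
      _ ≤ Λ * (Y ^ q 0 * (5 + |T| ^ q 0)) := by
        rw [abs_of_nonneg hT]
        gcongr
        linarith
      _ = _ := by ring
  calc ℓ x ^ q 1 ≤ 6 ^ q 1 * (Λ * Y ^ q 0) ^ q 1 * (1 + |T| ^ qBar q) :=
        rpow_le_of_le_mul_add_rpow (by positivity) (hq 1) (hq 0) (hℓ.nonneg x)
          (q_zero_mul_q_one_le_qBar hq) loss_le
    _ = 6 ^ q 1 * Y ^ (q 0 * q 1) * (Λ ^ q 1 * (1 + T ^ qBar q)) := by
        rw [Real.mul_rpow Λ_nonneg (by positivity), ← Real.rpow_mul Y_nonneg, abs_of_nonneg hT]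
        ring
    _ ≤ _ := by
        gcongr
        exact q_one_le_bigQ hq

theorem SmoothLoss.abs_deriv_le (hℓ : SmoothLoss q D Λ ℓ) (hq : ∀ k, 0 ≤ q k) (hD : 0 ≤ D)
    (hΛ : 1 ≤ Λ) (hY : 1 ≤ Y) (hT : 0 ≤ T) {x : ℝ} (hx : |x| ≤ Y * T) :
    |iteratedDeriv 1 ℓ x| ≤
      2 * 6 ^ q 1 * D * Y ^ (q 0 * q 1) * (Λ ^ bigQ q * (1 + T ^ qBar q)) := by
  set Z := 6 ^ q 1 * Y ^ (q 0 * q 1) * (Λ ^ bigQ q * (1 + T ^ qBar q)) with Z_eq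
  have one_le_Z : 1 ≤ Z := by
    have one_le_six : 1 ≤ (6 : ℝ) ^ q 1 := Real.one_le_rpow (by norm_num) (hq 1)
    have one_le_Y : 1 ≤ Y ^ (q 0 * q 1) := Real.one_le_rpow hY (mul_nonneg (hq 0) (hq 1))
    have one_le_Λ : 1 ≤ Λ ^ bigQ q := Real.one_le_rpow hΛ (bigQ_nonneg hq)
    have one_le_T : 1 ≤ 1 + T ^ qBar q := le_add_of_nonneg_right (pow_nonneg hT _)
    exact one_le_mul_of_one_le_of_one_le (one_le_mul_of_one_le_of_one_le one_le_six one_le_Y)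
      (one_le_mul_of_one_le_of_one_le one_le_Λ one_le_T)
  calc |iteratedDeriv 1 ℓ x| ≤ D * (1 + ℓ x ^ q 1) := hℓ.deriv_le 1 (by decide) x
    _ ≤ D * (Z + Z) := by
        gcongr
        exact hℓ.rpow_q_one_le hq hΛ hY hT hx
    _ = _ := by
        rw [Z_eq]
        ring

theorem SmoothLoss.abs_sub_le (hℓ : SmoothLoss q D Λ ℓ) (hq : ∀ k, 0 ≤ q k) (hD : 0 ≤ D)
    (hΛ : 1 ≤ Λ) (hY : 1 ≤ Y) (hT : 0 ≤ T) {x y : ℝ} (hx : |x| ≤ Y * T) (hy : |y| ≤ Y * T) :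
    |ℓ x - ℓ y| ≤
      2 * 6 ^ q 1 * D * Y ^ (q 0 * q 1) * (Λ ^ bigQ q * (1 + T ^ qBar q)) * |x - y| :=
  (convex_Icc (-(Y * T)) (Y * T)).norm_image_sub_le_of_norm_hasDerivWithin_le
    (fun _ _ => ((hasThreeDerivs_of_contDiff hℓ.contDiff).first _).hasDerivWithinAt)
    (fun _ hz => hℓ.abs_deriv_le hq hD hΛ hY hT (abs_le.2 hz)) (abs_le.1 hy) (abs_le.1 hx)

/-- The deterministic factor of the Lipschitz constant of the risk on the cube `[-L, L]^p`. -/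
noncomputable def lipConst (q : Fin 4 → ℝ) (n : ℕ) (D L : ℝ) : ℝ :=
  4 * 6 ^ q 1 * D * (L * Real.sqrt n) ^ (q 0 * q 1) * Real.sqrt n

theorem lipConst_nonneg (q : Fin 4 → ℝ) (n : ℕ) (hD : 0 ≤ D) (hL : 0 ≤ L) :
    0 ≤ lipConst q n D L := by
  unfold lipConst
  positivity

theorem mul_one_add_pow_le (hT : 0 ≤ T) (m : ℕ) : T * (1 + T ^ m) ≤ 2 * (1 + T ^ (m + 1)) := by
  have pow_nonneg : 0 ≤ T ^ (m + 1) := by positivity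
  have T_le : T ≤ 1 + T ^ (m + 1) := by
    rcases le_total T 1 with h | h
    · linarith
    · linarith [le_self_pow₀ h m.add_one_ne_zero]
  calc T * (1 + T ^ m) = T + T ^ (m + 1) := by ring
    _ ≤ _ := by linarith

theorem SmoothLoss.abs_comp_dotProduct_sub_le {n p : ℕ} (hℓ : SmoothLoss q D Λ ℓ)
    (hq : ∀ k, 0 ≤ q k) (hD : 0 ≤ D) (hΛ : 1 ≤ Λ) (hL : 1 ≤ L) (hn : 0 < n) {w w' : Fin p → ℝ}
    (hw : ‖w‖ ≤ L) (hw' : ‖w'‖ ≤ L) (h : ‖w - w'‖ ≤ δ) (x : Fin p → ℝ) :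
    |ℓ (x ⬝ᵥ w) - ℓ (x ⬝ᵥ w')| ≤ δ * (lipConst q n D L *
      (Λ ^ bigQ q * (1 + ((∑ j, |x j|) / Real.sqrt n) ^ (qBar q + 1)))) := by
  have one_le_sqrt : 1 ≤ Real.sqrt n := Real.one_le_sqrt.2 (mod_cast hn)
  set T := (∑ j, |x j|) / Real.sqrt n with hT
  have T_nonneg : 0 ≤ T := by positivity
  have sum_eq : ∑ j, |x j| = Real.sqrt n * T := by
    rw [hT]
    field_simp
  have δ_nonneg : 0 ≤ δ := (norm_nonneg _).trans h
  have dotProduct_le {a : ℝ} {v : Fin p → ℝ} (hv : ‖v‖ ≤ a) : |x ⬝ᵥ v| ≤ a * Real.sqrt n * T := by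
    simpa only [sum_eq, mul_assoc] using abs_dotProduct_le x hv
  have diff_le : |x ⬝ᵥ w - x ⬝ᵥ w'| ≤ δ * Real.sqrt n * T := by
    rw [← dotProduct_sub]
    exact dotProduct_le h
  set P := 2 * 6 ^ q 1 * D * (L * Real.sqrt n) ^ (q 0 * q 1) with hP
  calc _ ≤ P * (Λ ^ bigQ q * (1 + T ^ qBar q)) * |x ⬝ᵥ w - x ⬝ᵥ w'| :=
        hℓ.abs_sub_le hq hD hΛ (one_le_mul_of_one_le_of_one_le hL one_le_sqrt) T_nonneg
          (dotProduct_le hw) (dotProduct_le hw')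
    _ ≤ P * (Λ ^ bigQ q * (1 + T ^ qBar q)) * (δ * Real.sqrt n * T) := by gcongr
    _ = δ * (P * Real.sqrt n * (Λ ^ bigQ q * (T * (1 + T ^ qBar q)))) := by ring
    _ ≤ δ * (P * Real.sqrt n * (Λ ^ bigQ q * (2 * (1 + T ^ (qBar q + 1))))) := by
        refine mul_le_mul_of_nonneg_left (mul_le_mul_of_nonneg_left ?_ (by positivity)) δ_nonneg
        exact mul_le_mul_of_nonneg_left (mul_one_add_pow_le T_nonneg _) (by positivity)
    _ = _ := by
        rw [lipConst, hP]
        ring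

end LossLipschitz

section RiskLipschitz

variable {p n : ℕ} {q : Fin 4 → ℝ} {D L δ : ℝ} {Λ : Fin n → ℝ} {ℓ : Fin n → ℝ → ℝ}
  {R : (Fin p → ℝ) → ℝ} {w w' : Fin p → ℝ}

theorem regModulus_nonneg (R : (Fin p → ℝ) → ℝ) (L δ : ℝ) : 0 ≤ regModulus R L δ := by
  refine Real.sSup_nonneg ?_
  rintro x ⟨v, v', -, -, -, rfl⟩
  exact abs_nonneg _

theorem abs_sub_le_regModulus (hR : Continuous R) (hw : ‖w‖ ≤ L) (hw' : ‖w'‖ ≤ L)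
    (h : ‖w - w'‖ ≤ δ) : |R w - R w'| ≤ regModulus R L δ := by
  obtain ⟨C, hC⟩ := (isCompact_closedBall (0 : Fin p → ℝ) L).exists_bound_of_continuousOn
    hR.continuousOn
  refine le_csSup ⟨C + C, ?_⟩ ⟨w, w', hw, hw', h, rfl⟩
  rintro x ⟨v, v', hv, hv', -, rfl⟩
  exact (abs_sub _ _).trans
    (add_le_add (hC v (mem_closedBall_zero_iff.2 hv)) (hC v' (mem_closedBall_zero_iff.2 hv')))

/-- A bound for the Lipschitz constant on the cube `[-L, L]^p` of the loss part of the risk with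
design matrix `A`. -/
noncomputable def lipBound (q : Fin 4 → ℝ) (D L : ℝ) (Λ : Fin n → ℝ) (A : Fin n → Fin p → ℝ) : ℝ :=
  lipConst q n D L * ((1 / (n : ℝ)) *
    ∑ i, Λ i ^ bigQ q * (1 + ((∑ j, |A i j|) / Real.sqrt n) ^ (qBar q + 1)))

theorem lipBound_nonneg (q : Fin 4 → ℝ) (hD : 0 ≤ D) (hL : 0 ≤ L) (hΛ : ∀ i, 0 ≤ Λ i)
    (A : Fin n → Fin p → ℝ) : 0 ≤ lipBound q D L Λ A :=
  mul_nonneg (lipConst_nonneg q n hD hL) (mul_nonneg (by positivity) (Finset.sum_nonneg fun i _ =>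
    mul_nonneg (Real.rpow_nonneg (hΛ i) _) (by positivity)))

theorem abs_risk_sub_le (hq : ∀ k, 0 ≤ q k) (hR : Continuous R)
    (hℓ : ∀ i, SmoothLoss q D (Λ i) (ℓ i)) (hD : 0 ≤ D) (hΛ : ∀ i, 1 ≤ Λ i) (hL : 1 ≤ L)
    (hw : ‖w‖ ≤ L) (hw' : ‖w'‖ ≤ L) (h : ‖w - w'‖ ≤ δ) (A : Fin n → Fin p → ℝ) :
    |risk ℓ R w (Matrix.of A) - risk ℓ R w' (Matrix.of A)| ≤
      regModulus R L δ + δ * lipBound q D L Λ A := by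
  have risk_sub : risk ℓ R w (Matrix.of A) - risk ℓ R w' (Matrix.of A) =
      R w - R w' + 1 / n * ∑ i, (ℓ i (A i ⬝ᵥ w) - ℓ i (A i ⬝ᵥ w')) := by
    simp only [risk, Matrix.mulVec, Matrix.of_apply, Finset.sum_sub_distrib]
    ring
  calc _ ≤ |R w - R w'| + 1 / n * ∑ i, |ℓ i (A i ⬝ᵥ w) - ℓ i (A i ⬝ᵥ w')| := by
        rw [risk_sub]
        refine (abs_add_le _ _).trans ?_
        rw [abs_mul, abs_of_nonneg (by positivity : 0 ≤ 1 / (n : ℝ))]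
        gcongr
        exact Finset.abs_sum_le_sum_abs _ _
    _ ≤ regModulus R L δ + 1 / n * ∑ i, δ * (lipConst q n D L *
          (Λ i ^ bigQ q * (1 + ((∑ j, |A i j|) / Real.sqrt n) ^ (qBar q + 1)))) := by
        gcongr with i
        · exact abs_sub_le_regModulus hR hw hw' h
        · exact (hℓ i).abs_comp_dotProduct_sub_le hq hD (hΛ i) hL i.pos hw hw' h (A i)
    _ = _ := by
        rw [← Finset.mul_sum, ← Finset.mul_sum, lipBound]
        ring

end RiskLipschitz

section IidRows

variable {p n : ℕ} {Ω : Type*} [MeasurableSpace Ω] {P : Measure Ω} {X : Fin n → Ω → Fin p → ℝ}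
  {μ : Measure (Fin p → ℝ)}

/-- The rows `X i` of a random design are independent with common law `μ`. -/
structure IidRows (P : Measure Ω) (X : Fin n → Ω → Fin p → ℝ) (μ : Measure (Fin p → ℝ)) : Prop where
  measurable : ∀ i, Measurable (X i)
  indep : iIndepFun X P
  law : ∀ i, P.map (X i) = μ

theorem IidRows.integral_eq [IsProbabilityMeasure P] (hX : IidRows P X μ)
    {f : (Fin n → Fin p → ℝ) → ℝ} (hf : Measurable f) :
    ∫ ω, f (fun i => X i ω) ∂P = ∫ A, f A ∂Measure.pi fun _ : Fin n => μ := by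
  have joint_law := (iIndepFun_iff_map_fun_eq_pi_map fun i => (hX.measurable i).aemeasurable).1
    hX.indep
  simp only [hX.law] at joint_law
  rw [← joint_law,
    integral_map (measurable_pi_iff.2 hX.measurable).aemeasurable hf.aestronglyMeasurable]

theorem IidRows.integrable_row (hX : IidRows P X μ) (i : Fin n) {f : (Fin p → ℝ) → ℝ}
    (hf : Integrable f μ) : Integrable (fun ω => f (X i ω)) P := by
  rw [← hX.law i] at hf
  exact hf.comp_measurable (hX.measurable i)

theorem IidRows.integral_row (hX : IidRows P X μ) (i : Fin n) {f : (Fin p → ℝ) → ℝ}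
    (hf : Integrable f μ) : ∫ ω, f (X i ω) ∂P = ∫ x, f x ∂μ := by
  rw [← hX.law i] at hf ⊢
  exact (integral_map (hX.measurable i).aemeasurable hf.aestronglyMeasurable).symm

end IidRows

section LipBound

variable {p k n r d m : ℕ} {q : Fin 4 → ℝ} {B : Fin k → Finset (Fin p)}
  {Sig : Matrix (Fin p) (Fin p) ℝ} {M K θ D L : ℝ} {Λ : Fin n → ℝ} {μ : Measure (Fin p → ℝ)}
  [IsProbabilityMeasure μ]

theorem RowLaw.integrable_one_add_sum_abs_div_sqrt_pow (hμ : RowLaw B Sig n r K μ) (hm : m ≤ r) :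
    Integrable (fun x => 1 + ((∑ j, |x j|) / Real.sqrt n) ^ m) μ := by
  simp only [div_pow]
  exact (integrable_const 1).add ((hμ.integrable_sum_abs_pow Finset.univ hm).div_const _)

theorem BlockRegime.integral_one_add_sum_abs_div_sqrt_pow_le (hB : BlockRegime B Sig n d M K θ)
    (hμ : RowLaw B Sig n r K μ) (hm : m ≤ r) :
    ∫ x, 1 + ((∑ j, |x j|) / Real.sqrt n) ^ m ∂μ ≤ 1 + K * θ ^ m := by
  have n_pos : (0 : ℝ) < n := mod_cast hB.n_pos
  have hK := hB.one_le_K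
  simp only [div_pow]
  rw [integral_add (integrable_const _)
    ((hμ.integrable_sum_abs_pow Finset.univ hm).div_const _), integral_div]
  simp only [integral_const, probReal_univ, smul_eq_mul, one_mul]
  gcongr
  calc _ ≤ K * (p / Real.sqrt n) ^ m / Real.sqrt n ^ m := by
        gcongr
        simpa using hμ.integral_sum_abs_pow_le hK Finset.univ hm
    _ = K * (p / n) ^ m := by
        rw [mul_div_assoc, ← div_pow, div_div, Real.mul_self_sqrt n_pos.le]
    _ ≤ K * θ ^ m := by
        gcongr
        exact (div_le_iff₀ n_pos).2 hB.p_le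

variable {Ω : Type*} [MeasurableSpace Ω] {P : Measure Ω} {X : Fin n → Ω → Fin p → ℝ}

theorem IidRows.integrable_lipBound (hX : IidRows P X μ) (hμ : RowLaw B Sig n r K μ)
    (hr : qBar q + 1 ≤ r) : Integrable (fun ω => lipBound q D L Λ fun i => X i ω) P :=
  ((integrable_finsetSum _ fun i _ => (hX.integrable_row i
    (hμ.integrable_one_add_sum_abs_div_sqrt_pow hr)).const_mul _).const_mul _).const_mul _

theorem IidRows.integral_lipBound_le (hX : IidRows P X μ) (hB : BlockRegime B Sig n d M K θ)
    (hμ : RowLaw B Sig n r K μ) (hr : qBar q + 1 ≤ r) (hD : 0 ≤ D) (hL : 0 ≤ L)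
    (hΛ : ∀ i, 0 ≤ Λ i) : ∫ ω, lipBound q D L Λ (fun i => X i ω) ∂P ≤
      lipConst q n D L * ((1 + K * θ ^ (qBar q + 1)) * avgL q Λ) := by
  have integrable := hμ.integrable_one_add_sum_abs_div_sqrt_pow hr
  unfold lipBound
  rw [integral_const_mul, integral_const_mul,
    integral_finsetSum _ fun i _ => (hX.integrable_row i integrable).const_mul _]
  refine mul_le_mul_of_nonneg_left ?_ (lipConst_nonneg q n hD hL)
  calc _ ≤ 1 / (n : ℝ) * ∑ i, Λ i ^ bigQ q * (1 + K * θ ^ (qBar q + 1)) := by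
        gcongr with i
        rw [integral_const_mul, hX.integral_row i integrable]
        exact mul_le_mul_of_nonneg_left (hB.integral_one_add_sum_abs_div_sqrt_pow_le hμ hr)
          (Real.rpow_nonneg (hΛ i) _)
    _ = _ := by
        rw [← Finset.sum_mul, avgL]
        ring

theorem omegaRate_mul_sqrt_rpow (p d : ℕ) (q : Fin 4 → ℝ) (hn : 0 < n) :
    omegaRate n p d q * (Real.sqrt n ^ (q 0 * q 1) * Real.sqrt n) = sigmaRate n p d q / n := by
  have n_pos : (0 : ℝ) < n := mod_cast hn
  have sqrt_rpow : Real.sqrt n ^ (q 0 * q 1) * Real.sqrt n = (n : ℝ) ^ ((q 0 * q 1 + 1) / 2) := by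
    rw [← Real.rpow_add_one (Real.sqrt_pos.2 n_pos).ne', Real.sqrt_eq_rpow,
      ← Real.rpow_mul n_pos.le]
    congr 1
    ring
  have exponent : -(q 0 * q 1 + 3) / 2 + (q 0 * q 1 + 1) / 2 = -1 := by ring
  rw [omegaRate, sqrt_rpow, mul_right_comm, ← Real.rpow_add n_pos, exponent, Real.rpow_neg_one]
  field_simp

theorem mul_lipConst_le (hq : ∀ k, 0 ≤ q k) (hn : 0 < n) (hD : 0 ≤ D) (hL : 1 ≤ L)
    (hσ : 0 ≤ sigmaRate n p d q) {δ : ℝ} (hδ : δ ≤ omegaRate n p d q) :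
    δ * lipConst q n D L ≤ 4 * 6 ^ q 1 * D * (L ^ (qBar q + 3) * sigmaRate n p d q) := by
  have L_nonneg : 0 ≤ L := zero_le_one.trans hL
  have rpow_le : L ^ (q 0 * q 1) ≤ L ^ (qBar q + 3) := by
    rw [← Real.rpow_natCast]
    refine Real.rpow_le_rpow_of_exponent_le hL ((q_zero_mul_q_one_le_qBar hq).trans ?_)
    exact mod_cast Nat.le_add_right _ _
  calc δ * lipConst q n D L ≤ omegaRate n p d q * lipConst q n D L :=
        mul_le_mul_of_nonneg_right hδ (lipConst_nonneg q n hD L_nonneg)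
    _ = 4 * 6 ^ q 1 * D * (L ^ (q 0 * q 1) *
          (omegaRate n p d q * (Real.sqrt n ^ (q 0 * q 1) * Real.sqrt n))) := by
        rw [lipConst, Real.mul_rpow L_nonneg (Real.sqrt_nonneg _)]
        ring
    _ ≤ _ := by
        rw [omegaRate_mul_sqrt_rpow p d q hn]
        gcongr
        exact div_le_self hσ (mod_cast hn)

/-- The constant in the tail bound for the Lipschitz constant of the risk. -/
noncomputable def netConst (q : Fin 4 → ℝ) (K θ : ℝ) : ℝ :=
  4 * 6 ^ q 1 * (1 + K * θ ^ (qBar q + 1))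

theorem IidRows.measureReal_le_mul_lipBound_le (hX : IidRows P X μ)
    (hB : BlockRegime B Sig n d M K θ) (hμ : RowLaw B Sig n r K μ) (hq : ∀ k, 0 ≤ q k)
    (hr : qBar q + 1 ≤ r) (hD : 0 ≤ D) (hL : 1 ≤ L) (hΛ : ∀ i, 0 ≤ Λ i)
    (hσ : 0 ≤ sigmaRate n p d q) {δ e : ℝ} (hδ : 0 ≤ δ) (hδ' : δ ≤ omegaRate n p d q)
    (he : 0 < e) :
    P.real {ω | e ≤ δ * lipBound q D L Λ fun i => X i ω} ≤
      netConst q K θ * D * (avgL q Λ * L ^ (qBar q + 3) * sigmaRate n p d q) / e := by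
  have hK := hB.one_le_K
  have hθ := hB.one_le_θ
  have L_nonneg : 0 ≤ L := zero_le_one.trans hL
  have avgL_nonneg : 0 ≤ avgL q Λ :=
    mul_nonneg (by positivity) (Finset.sum_nonneg fun i _ => Real.rpow_nonneg (hΛ i) _)
  rw [le_div_iff₀' he]
  calc _ ≤ ∫ ω, δ * lipBound q D L Λ (fun i => X i ω) ∂P :=
        mul_meas_ge_le_integral_of_nonneg
          (ae_of_all P fun ω => mul_nonneg hδ (lipBound_nonneg q hD L_nonneg hΛ _))
          ((hX.integrable_lipBound hμ hr).const_mul δ) e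
    _ ≤ δ * lipConst q n D L * ((1 + K * θ ^ (qBar q + 1)) * avgL q Λ) := by
        rw [integral_const_mul, mul_assoc]
        exact mul_le_mul_of_nonneg_left
          (hX.integral_lipBound_le hB hμ hr hD L_nonneg hΛ) hδ
    _ ≤ 4 * 6 ^ q 1 * D * (L ^ (qBar q + 3) * sigmaRate n p d q) *
          ((1 + K * θ ^ (qBar q + 1)) * avgL q Λ) := by
        refine mul_le_mul_of_nonneg_right (mul_lipConst_le hq hB.n_pos hD hL hσ hδ') ?_
        exact mul_nonneg (by positivity) avgL_nonneg
    _ = _ := by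
        rw [netConst]
        ring

end LipBound

section SoftRisk

variable {p k n r d : ℕ} {q : Fin 4 → ℝ} {B : Fin k → Finset (Fin p)}
  {Sig : Matrix (Fin p) (Fin p) ℝ} {M K θ D L κ s : ℝ} {Λ : Fin n → ℝ} {ℓ : Fin n → ℝ → ℝ}
  {R : (Fin p → ℝ) → ℝ} {φ : ℝ → ℝ} {N : Finset (Fin p → ℝ)} {μ ν : Measure (Fin p → ℝ)}
  [IsProbabilityMeasure μ] [IsProbabilityMeasure ν]
  {Ω Ω' : Type*} [MeasurableSpace Ω] [MeasurableSpace Ω'] {P : Measure Ω} {P' : Measure Ω'}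
  [IsProbabilityMeasure P] [IsProbabilityMeasure P']
  {X : Fin n → Ω → Fin p → ℝ} {G : Fin n → Ω' → Fin p → ℝ}

theorem IidRows.integral_comp_softRisk_le (hX : IidRows P X μ) (hG : IidRows P' G ν)
    (hB : BlockRegime B Sig n d M K θ) (hμ : RowLaw B Sig n r K μ) (hν : RowLaw B Sig n r K ν)
    (hq : ∀ k, 0 ≤ q k) (hr : qBar q + 3 ≤ r) (hL : 1 ≤ L)
    (hℓ : ∀ i, SmoothLoss q D (Λ i) (ℓ i)) (hφ : SmoothTest κ φ) (hD : 1 ≤ D) (hΛ : ∀ i, 1 ≤ Λ i)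
    (hs : 0 < s) (hN : N.Nonempty) (hNL : ∀ u ∈ N, ‖u‖ ≤ L) :
    ∫ ω, φ (softRisk N ℓ R s (designMatrix X ω)) ∂P ≤
      ∫ ω, φ (softRisk N ℓ R s (designMatrix G ω)) ∂P' +
        lindebergConst q M K θ * κ * (1 + s) ^ 2 * D ^ 3 *
          (avgL q Λ * L ^ (qBar q + 3) * sigmaRate n p d q) := by
  have measurable := (hφ.contDiff.continuous.comp
    (continuous_softRisk hN (fun i => (hℓ i).contDiff.continuous) R s)).measurable
  have compare := hB.abs_integral_softRisk_sub_le (R := R) hμ hν hq hr hL hℓ hφ hD hΛ hs hN hNL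
  have X_eq := hX.integral_eq measurable
  have G_eq := hG.integral_eq measurable
  simp only [Function.comp_apply] at X_eq G_eq
  simp only [designMatrix]
  rw [X_eq, G_eq]
  linarith [le_abs_self (∫ A, φ (softRisk N ℓ R s (Matrix.of A)) ∂Measure.pi (fun _ : Fin n => μ) -
    ∫ A, φ (softRisk N ℓ R s (Matrix.of A)) ∂Measure.pi (fun _ : Fin n => ν))]

end SoftRisk

section ApproxInf

variable {W : Type*} {η e m z ρ₀ : ℝ} {h h' : W → ℝ} {S C : Set W} {T : Set W}

/-- `m` agrees with the infimum of `h` over `T` up to an error `η`. -/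
structure IsApproxInf (η : ℝ) (h : W → ℝ) (T : Set W) (m : ℝ) : Prop where
  le_add : ∀ w ∈ T, m ≤ h w + η
  sub_le : ∀ b, (∀ w ∈ T, b ≤ h w) → b - η ≤ m

theorem IsApproxInf.mono (hm : IsApproxInf η h T m) (he : η ≤ e) : IsApproxInf e h T m where
  le_add w hw := (hm.le_add w hw).trans (by gcongr)
  sub_le b hb := le_trans (by gcongr) (hm.sub_le b hb)

theorem IsApproxInf.of_abs_sub_le (hm : IsApproxInf η h' T m) (hh : ∀ w, |h' w - h w| ≤ e) :
    IsApproxInf (η + e) h T m where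
  le_add w hw := by linarith [hm.le_add w hw, (abs_le.1 (hh w)).2]
  sub_le b hb := by
    have := hm.sub_le (b - e) fun w hw => by linarith [hb w hw, (abs_le.1 (hh w)).1]
    linarith

theorem IsApproxInf.le_or_le_of_isMin {w : W} {m₁ m₂ : ℝ} (h₁ : IsApproxInf η h C m₁)
    (h₂ : IsApproxInf η h (S ∩ C) m₂) (hw : ∀ v, h w ≤ h v) (hwS : w ∈ S) (hwC : w ∈ C) (a : ℝ) :
    a - η ≤ m₁ ∨ m₂ ≤ a + η := by
  rcases le_total a (h w) with above | below
  · exact Or.inl (h₁.sub_le a fun v _ => above.trans (hw v))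
  · exact Or.inr ((h₂.le_add w ⟨hwS, hwC⟩).trans (by gcongr))

end ApproxInf

section ApproxRisk

variable {p n : ℕ} {ℓ ℓ' : Fin n → ℝ → ℝ} {R : (Fin p → ℝ) → ℝ} {A : Matrix (Fin n) (Fin p) ℝ}
  {S C T : Set (Fin p → ℝ)} {η m a : ℝ}

theorem IsApproxInf.le_minRisk_univ {w : Fin p → ℝ} (h : IsApproxInf η (fun v => risk ℓ R v A) C m)
    (hw : IsRiskMinimizer ℓ R A w) (hwC : w ∈ C) (ha : a + η ≤ m) :
    (a : EReal) ≤ minRisk ℓ R univ A :=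
  le_iInf₂ fun v _ => EReal.coe_le_coe_iff.2 (by linarith [h.le_add w hwC, hw v])

theorem IsApproxInf.minRisk_le (h : IsApproxInf η (fun v => risk ℓ R v A) T m) (hTS : T ⊆ S)
    (ha : m < a - η) : minRisk ℓ R S A ≤ a := by
  by_contra! above
  refine ha.not_ge (h.sub_le a fun w hw => EReal.coe_le_coe_iff.1 (above.le.trans ?_))
  exact iInf₂_le w (hTS hw)

theorem abs_risk_sub_risk_le {e : ℝ} (hn : 0 < n) (h : ∀ i x, |ℓ' i x - ℓ i x| ≤ e)
    (R : (Fin p → ℝ) → ℝ) (w : Fin p → ℝ) (A : Matrix (Fin n) (Fin p) ℝ) :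
    |risk ℓ' R w A - risk ℓ R w A| ≤ e := by
  have risk_sub : risk ℓ' R w A - risk ℓ R w A =
      1 / n * ∑ i, (ℓ' i (A.mulVec w i) - ℓ i (A.mulVec w i)) := by
    rw [risk, risk, Finset.sum_sub_distrib]
    ring
  rw [risk_sub, abs_mul, abs_of_nonneg (by positivity)]
  calc _ ≤ 1 / (n : ℝ) * ∑ _i : Fin n, e := by
        gcongr
        exact (Finset.abs_sum_le_sum_abs _ _).trans (Finset.sum_le_sum fun i _ => h i _)
    _ = e := by
        rw [Finset.sum_const, Finset.card_univ, Fintype.card_fin, nsmul_eq_mul]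
        field_simp

theorem isApproxInf_softRisk {N : Finset (Fin p → ℝ)} {s δ c : ℝ} (hs : 0 < s) (hn : 0 < n)
    (hc : 0 ≤ c) (hN : N.Nonempty) (hNT : ∀ u ∈ N, u ∈ T) (dense : ∀ w ∈ T, ∃ u ∈ N, ‖w - u‖ ≤ δ)
    (h : ∀ w ∈ T, ∀ u ∈ T, ‖w - u‖ ≤ δ → |risk ℓ R w A - risk ℓ R u A| ≤ c) :
    IsApproxInf (c + Real.log N.card / (n * s)) (fun w => risk ℓ R w A) T
      (softRisk N ℓ R s A) where
  le_add w hw := by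
    obtain ⟨u, hu, close⟩ := dense w hw
    have log_nonneg : 0 ≤ Real.log N.card / (n * s) :=
      div_nonneg (Real.log_natCast_nonneg _) (by positivity)
    have soft_le := softRisk_le_risk (ℓ := ℓ) (R := R) hs hn A hu
    linarith [(abs_le.1 (h w hw u (hNT u hu) close)).1]
  sub_le b hb := by
    linarith [le_softRisk_of_forall_le hs hn A hN fun u hu => hb u (hNT u hu)]

theorem exists_softRisk_isApproxInf {L δ s e c : ℝ} (hL : 0 < L) (hδ : 0 < δ) (hs : 0 < s)
    (hn : 0 < n) (hc : 0 ≤ c) (hT : ∀ w ∈ T, ‖w‖ ≤ L) (hne : T.Nonempty)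
    (hℓ : ∀ i x, |ℓ' i x - ℓ i x| ≤ e) :
    ∃ N : Finset (Fin p → ℝ), N.Nonempty ∧ (∀ u ∈ N, ‖u‖ ≤ L) ∧
      ∀ A : Matrix (Fin n) (Fin p) ℝ, (∀ w w', ‖w‖ ≤ L → ‖w'‖ ≤ L → ‖w - w'‖ ≤ δ →
        |risk ℓ' R w A - risk ℓ' R w' A| ≤ c) →
        IsApproxInf (c + 3 * p * logPlus (L / δ) / (n * s) + e) (fun w => risk ℓ R w A) T
          (softRisk N ℓ' R s A) := by
  obtain ⟨N, hN, hNT, dense, card_le⟩ := exists_finset_net hδ hT hne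
  refine ⟨N, hN, fun u hu => hT u (hNT u hu), fun A hA => ?_⟩
  refine ((isApproxInf_softRisk hs hn hc hN hNT dense fun w hw u hu close =>
    hA w u (hT w hw) (hT u hu) close).mono ?_).of_abs_sub_le
      fun w => abs_risk_sub_risk_le hn hℓ R w A
  gcongr
  exact log_card_net_le hN hL hδ card_le

end ApproxRisk

section Transfer

variable {Ω Ω' : Type*} [MeasurableSpace Ω] [MeasurableSpace Ω'] {P : Measure Ω} {P' : Measure Ω'}
  [IsProbabilityMeasure P] [IsProbabilityMeasure P']

theorem integrable_smoothTransition {f : Ω → ℝ} (hf : Measurable f) :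
    Integrable (fun ω => Real.smoothTransition (f ω)) P :=
  .of_bound (Real.smoothTransition.continuous.measurable.comp hf).aestronglyMeasurable 1
    (ae_of_all _ fun ω => by
      rw [Real.norm_of_nonneg (Real.smoothTransition.nonneg _)]
      exact Real.smoothTransition.le_one _)

theorem measureReal_one_le_le_integral_smoothTransition {f : Ω → ℝ} (hf : Measurable f) :
    P.real {ω | 1 ≤ f ω} ≤ ∫ ω, Real.smoothTransition (f ω) ∂P := by
  rw [← integral_indicator_one (measurableSet_le measurable_const hf)]
  refine integral_mono ((integrable_const 1).indicator (measurableSet_le measurable_const hf))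
    (integrable_smoothTransition hf) fun ω => ?_
  by_cases one_le : 1 ≤ f ω
  · simp [one_le, Real.smoothTransition.one_of_one_le]
  · simpa [indicator, one_le] using Real.smoothTransition.nonneg (f ω)

theorem integral_smoothTransition_le_measureReal {f : Ω → ℝ} (hf : Measurable f) :
    ∫ ω, Real.smoothTransition (f ω) ∂P ≤ P.real {ω | 0 < f ω} := by
  rw [← integral_indicator_one (measurableSet_lt measurable_const hf)]
  refine integral_mono (integrable_smoothTransition hf)
    ((integrable_const 1).indicator (measurableSet_lt measurable_const hf)) fun ω => ?_
  by_cases pos : 0 < f ω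
  · simpa [indicator, pos] using Real.smoothTransition.le_one (f ω)
  · simp [pos, Real.smoothTransition.zero_of_nonpos (not_lt.1 pos)]

theorem measureReal_le_add_of_ae_imp {a b c : Ω → Prop} (h : ∀ᵐ ω ∂P, a ω → b ω ∨ c ω) :
    P.real {ω | a ω} ≤ P.real {ω | b ω} + P.real {ω | c ω} :=
  (ENNReal.toReal_mono (measure_ne_top _ _) (measure_mono_ae h)).trans (measureReal_union_le _ _)

variable {p n : ℕ} {ℓ : Fin n → ℝ → ℝ} {R : (Fin p → ℝ) → ℝ} {S C : Set (Fin p → ℝ)}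
  {z ρ₀ ε lin mk : ℝ}

theorem measureReal_mem_le_add {x : Ω → Matrix (Fin n) (Fin p) ℝ} {w : Ω → Fin p → ℝ}
    {m₁ m₂ : Ω → ℝ} {η a : ℝ} (hw : ∀ᵐ ω ∂P, IsRiskMinimizer ℓ R (x ω) (w ω))
    (hC : P.real {ω | w ω ∉ C} ≤ ε)
    (happrox : P.real {ω | ¬ (IsApproxInf η (fun v => risk ℓ R v (x ω)) C (m₁ ω) ∧
      IsApproxInf η (fun v => risk ℓ R v (x ω)) (S ∩ C) (m₂ ω))} ≤ mk) :
    P.real {ω | w ω ∈ S} ≤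
      ε + (mk + (P.real {ω | a - η ≤ m₁ ω} + P.real {ω | m₂ ω ≤ a + η})) := by
  refine (measureReal_le_add_of_ae_imp ?_).trans (add_le_add hC
    ((measureReal_le_add_of_ae_imp (ae_of_all _ fun _ => id)).trans (add_le_add happrox
      (measureReal_le_add_of_ae_imp (ae_of_all _ fun _ => id)))))
  filter_upwards [hw] with ω minimizer mem_S
  by_cases mem_C : w ω ∈ C
  · refine Or.inr (or_iff_not_imp_left.2 fun h => ?_)
    obtain ⟨h₁, h₂⟩ := not_not.1 h
    exact h₁.le_or_le_of_isMin h₂ minimizer mem_S mem_C a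
  · exact Or.inl mem_C

theorem measureReal_lt_le_add {g : Ω → Matrix (Fin n) (Fin p) ℝ} {w : Ω → Fin p → ℝ}
    {m : Ω → ℝ} {η a : ℝ} (hw : ∀ᵐ ω ∂P, IsRiskMinimizer ℓ R (g ω) (w ω))
    (hC : P.real {ω | w ω ∉ C} ≤ ε)
    (happrox : P.real {ω | ¬ IsApproxInf η (fun v => risk ℓ R v (g ω)) C (m ω)} ≤ mk)
    (hmin : P.real {ω | (a : EReal) ≤ minRisk ℓ R univ (g ω)} ≤ ε) :
    P.real {ω | a + η < m ω} ≤ ε + (mk + ε) := by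
  refine (measureReal_le_add_of_ae_imp ?_).trans (add_le_add hC
    ((measureReal_le_add_of_ae_imp (ae_of_all _ fun _ => id)).trans (add_le_add happrox hmin)))
  filter_upwards [hw] with ω minimizer above
  by_cases mem_C : w ω ∈ C
  · exact Or.inr (or_iff_not_imp_left.2 fun h =>
      (not_not.1 h).le_minRisk_univ minimizer mem_C above.le)
  · exact Or.inl mem_C

theorem measureReal_lt_sub_le_add {g : Ω → Matrix (Fin n) (Fin p) ℝ} {m : Ω → ℝ} {η a : ℝ}
    (happrox : P.real {ω | ¬ IsApproxInf η (fun v => risk ℓ R v (g ω)) (S ∩ C) (m ω)} ≤ mk)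
    (hmin : P.real {ω | minRisk ℓ R S (g ω) ≤ (a : EReal)} ≤ ε) :
    P.real {ω | m ω < a - η} ≤ mk + ε :=
  (measureReal_le_add_of_ae_imp (ae_of_all _ fun _ below => or_iff_not_imp_left.2 fun h =>
    (not_not.1 h).minRisk_le inter_subset_left below)).trans (add_le_add happrox hmin)

-- The two levels separating `z + ρ₀` from `z + 2 * ρ₀` leave room for an approximation error
-- `ρ₀ / 8` on either side and for a test function moving from `0` to `1` over a length `ρ₀ / 4`.
theorem measureReal_mem_le_of_isApproxInf {x : Ω → Matrix (Fin n) (Fin p) ℝ}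
    {g : Ω' → Matrix (Fin n) (Fin p) ℝ} {wX : Ω → Fin p → ℝ} {wG : Ω' → Fin p → ℝ}
    {m₁ m₂ : Ω → ℝ} {m₁' m₂' : Ω' → ℝ}
    (hwX : ∀ᵐ ω ∂P, IsRiskMinimizer ℓ R (x ω) (wX ω))
    (hwG : ∀ᵐ ω ∂P', IsRiskMinimizer ℓ R (g ω) (wG ω))
    (hCX : P.real {ω | wX ω ∉ C} ≤ ε) (hCG : P'.real {ω | wG ω ∉ C} ≤ ε)
    (hX : P.real {ω | ¬ (IsApproxInf (ρ₀ / 8) (fun v => risk ℓ R v (x ω)) C (m₁ ω) ∧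
      IsApproxInf (ρ₀ / 8) (fun v => risk ℓ R v (x ω)) (S ∩ C) (m₂ ω))} ≤ mk)
    (hG : P'.real {ω | ¬ (IsApproxInf (ρ₀ / 8) (fun v => risk ℓ R v (g ω)) C (m₁' ω) ∧
      IsApproxInf (ρ₀ / 8) (fun v => risk ℓ R v (g ω)) (S ∩ C) (m₂' ω))} ≤ mk)
    (h₁ : ∀ a, P.real {ω | a + ρ₀ / 4 ≤ m₁ ω} ≤ P'.real {ω | a < m₁' ω} + lin)
    (h₂ : ∀ a, P.real {ω | m₂ ω ≤ a - ρ₀ / 4} ≤ P'.real {ω | m₂' ω < a} + lin)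
    (hmin : P'.real {ω | ((z + ρ₀ : ℝ) : EReal) ≤ minRisk ℓ R univ (g ω)} ≤ ε)
    (hminS : P'.real {ω | minRisk ℓ R S (g ω) ≤ ((z + 2 * ρ₀ : ℝ) : EReal)} ≤ ε) :
    P.real {ω | wX ω ∈ S} ≤ 4 * ε + 2 * lin + 3 * mk := by
  have X_le := measureReal_mem_le_add (a := z + 3 / 2 * ρ₀) hwX hCX hX
  have G_above := measureReal_lt_le_add (η := ρ₀ / 8) (m := m₁') hwG hCG
    ((measureReal_mono fun _ => mt And.left).trans hG) hmin
  have G_below := measureReal_lt_sub_le_add (η := ρ₀ / 8) (m := m₂')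
    ((measureReal_mono fun _ => mt And.right).trans hG) hminS
  have above := h₁ (z + ρ₀ + ρ₀ / 8)
  have below := h₂ (z + 2 * ρ₀ - ρ₀ / 8)
  have lower_level : z + ρ₀ + ρ₀ / 8 + ρ₀ / 4 = z + 3 / 2 * ρ₀ - ρ₀ / 8 := by ring
  have upper_level : z + 2 * ρ₀ - ρ₀ / 8 - ρ₀ / 4 = z + 3 / 2 * ρ₀ + ρ₀ / 8 := by ring
  rw [lower_level] at above
  rw [upper_level] at below
  linarith

end Transfer

section MatchedDesigns

variable {p k n r d : ℕ} {q : Fin 4 → ℝ} {B : Fin k → Finset (Fin p)}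
  {Sig : Matrix (Fin p) (Fin p) ℝ} {M K θ D L κ s c z ρ₀ ε δ e : ℝ} {Λ : Fin n → ℝ}
  {ℓ ℓ' : Fin n → ℝ → ℝ} {R : (Fin p → ℝ) → ℝ} {μ ν : Measure (Fin p → ℝ)}
  {Ω Ω' : Type*} [MeasurableSpace Ω] [MeasurableSpace Ω'] {P : Measure Ω} {P' : Measure Ω'}
  {X : Fin n → Ω → Fin p → ℝ} {G : Fin n → Ω' → Fin p → ℝ}

/-- The designs `X` and `G` have i.i.d. rows whose laws `μ` and `ν` share the blocks `B`, the
covariance matrix `Sig / n` and the moment bounds up to order `r`. -/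
structure MatchedDesigns (P : Measure Ω) (P' : Measure Ω') (X : Fin n → Ω → Fin p → ℝ)
    (G : Fin n → Ω' → Fin p → ℝ) (μ ν : Measure (Fin p → ℝ)) (B : Fin k → Finset (Fin p))
    (Sig : Matrix (Fin p) (Fin p) ℝ) (d r : ℕ) (M K θ : ℝ) : Prop where
  regime : BlockRegime B Sig n d M K θ
  rows_left : IidRows P X μ
  rows_right : IidRows P' G ν
  law_left : RowLaw B Sig n r K μ
  law_right : RowLaw B Sig n r K ν

theorem IidRows.measurable_softRisk {N : Finset (Fin p → ℝ)} (hX : IidRows P X μ)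
    (hN : N.Nonempty) (hℓ : ∀ i, SmoothLoss q D (Λ i) (ℓ i)) (R : (Fin p → ℝ) → ℝ) (s : ℝ) :
    Measurable fun ω => softRisk N ℓ R s (designMatrix X ω) :=
  (continuous_softRisk hN (fun i => (hℓ i).contDiff.continuous) R s).measurable.comp
    (measurable_pi_iff.2 hX.measurable)

theorem exists_softRisk_isApproxInf_of_lipBound_lt (hq : ∀ k, 0 ≤ q k) (hR : Continuous R)
    (hℓ : ∀ i, SmoothLoss q D (Λ i) (ℓ' i)) (hD : 0 ≤ D) (hΛ : ∀ i, 1 ≤ Λ i) (hL : 1 ≤ L)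
    (hδ : 0 < δ) (hs : 0 < s) (hn : 0 < n) (hℓℓ' : ∀ i x, |ℓ' i x - ℓ i x| ≤ e) (hρ₀ : 0 < ρ₀)
    (herr : regModulus R L δ + 3 * p * logPlus (L / δ) / (n * s) + e ≤ 3 * (ρ₀ / 32))
    {T : Set (Fin p → ℝ)} (hT : ∀ w ∈ T, ‖w‖ ≤ L) (hne : T.Nonempty) :
    ∃ N : Finset (Fin p → ℝ), N.Nonempty ∧ (∀ u ∈ N, ‖u‖ ≤ L) ∧
      ∀ A : Fin n → Fin p → ℝ, δ * lipBound q D L Λ A < ρ₀ / 32 →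
        IsApproxInf (ρ₀ / 8) (fun w => risk ℓ R w (Matrix.of A)) T
          (softRisk N ℓ' R s (Matrix.of A)) := by
  obtain ⟨N, hN, hNL, hNA⟩ := exists_softRisk_isApproxInf (R := R) (c := regModulus R L δ + ρ₀ / 32)
    (zero_lt_one.trans_le hL) hδ hs hn (add_nonneg (regModulus_nonneg R L δ) (by positivity))
    hT hne hℓℓ'
  refine ⟨N, hN, hNL, fun A hA => (hNA (Matrix.of A) fun w w' hw hw' close => ?_).mono ?_⟩
  · exact (abs_risk_sub_le hq hR hℓ hD hΛ hL hw hw' close A).trans (by gcongr)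
  · linarith

variable [IsProbabilityMeasure P] [IsProbabilityMeasure P'] [IsProbabilityMeasure μ]
  [IsProbabilityMeasure ν]

theorem MatchedDesigns.measureReal_one_le_softRisk_le {N : Finset (Fin p → ℝ)} {b : ℝ}
    (h : MatchedDesigns P P' X G μ ν B Sig d r M K θ) (hq : ∀ k, 0 ≤ q k) (hr : qBar q + 3 ≤ r)
    (hL : 1 ≤ L) (hℓ : ∀ i, SmoothLoss q D (Λ i) (ℓ i))
    (hφ : SmoothTest κ Real.smoothTransition) (hD : 1 ≤ D) (hΛ : ∀ i, 1 ≤ Λ i) (hs : 0 < s)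
    (hN : N.Nonempty) (hNL : ∀ u ∈ N, ‖u‖ ≤ L) (hb : ∀ m ∈ Finset.Icc 1 3, |b| ^ m ≤ c) (a : ℝ) :
    P.real {ω | 1 ≤ b * (softRisk N ℓ R s (designMatrix X ω) - a)} ≤
      P'.real {ω | 0 < b * (softRisk N ℓ R s (designMatrix G ω) - a)} +
        lindebergConst q M K θ * (c * κ) * (1 + s) ^ 2 * D ^ 3 *
          (avgL q Λ * L ^ (qBar q + 3) * sigmaRate n p d q) := by
  calc _ ≤ _ := measureReal_one_le_le_integral_smoothTransition
        (((h.rows_left.measurable_softRisk hN hℓ R s).sub_const a).const_mul b)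
    _ ≤ _ := h.rows_left.integral_comp_softRisk_le h.rows_right h.regime h.law_left h.law_right
        hq hr hL hℓ ((hφ.comp_mul hb).comp_sub_const a) hD hΛ hs hN hNL
    _ ≤ _ := by
        gcongr
        exact integral_smoothTransition_le_measureReal
          (((h.rows_right.measurable_softRisk hN hℓ R s).sub_const a).const_mul b)

theorem MatchedDesigns.measureReal_le_softRisk_le {N : Finset (Fin p → ℝ)}
    (h : MatchedDesigns P P' X G μ ν B Sig d r M K θ) (hq : ∀ k, 0 ≤ q k) (hr : qBar q + 3 ≤ r)
    (hL : 1 ≤ L) (hℓ : ∀ i, SmoothLoss q D (Λ i) (ℓ i))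
    (hφ : SmoothTest κ Real.smoothTransition) (hD : 1 ≤ D) (hΛ : ∀ i, 1 ≤ Λ i) (hs : 0 < s)
    (hN : N.Nonempty) (hNL : ∀ u ∈ N, ‖u‖ ≤ L) {b : ℝ} (hb : 0 < b)
    (hc : ∀ m ∈ Finset.Icc 1 3, (1 / b) ^ m ≤ c) (a : ℝ) :
    P.real {ω | a + b ≤ softRisk N ℓ R s (designMatrix X ω)} ≤
      P'.real {ω | a < softRisk N ℓ R s (designMatrix G ω)} +
        lindebergConst q M K θ * (c * κ) * (1 + s) ^ 2 * D ^ 3 *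
          (avgL q Λ * L ^ (qBar q + 3) * sigmaRate n p d q) := by
  convert h.measureReal_one_le_softRisk_le (R := R) (b := 1 / b) hq hr hL hℓ hφ hD hΛ hs hN hNL
    (by rwa [abs_of_pos (by positivity)]) a using 4
  · rw [one_div, inv_mul_eq_div, one_le_div hb, le_sub_iff_add_le']
  · funext ω
    rw [mul_pos_iff_of_pos_left (by positivity), sub_pos]

theorem MatchedDesigns.measureReal_softRisk_le_le {N : Finset (Fin p → ℝ)}
    (h : MatchedDesigns P P' X G μ ν B Sig d r M K θ) (hq : ∀ k, 0 ≤ q k) (hr : qBar q + 3 ≤ r)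
    (hL : 1 ≤ L) (hℓ : ∀ i, SmoothLoss q D (Λ i) (ℓ i))
    (hφ : SmoothTest κ Real.smoothTransition) (hD : 1 ≤ D) (hΛ : ∀ i, 1 ≤ Λ i) (hs : 0 < s)
    (hN : N.Nonempty) (hNL : ∀ u ∈ N, ‖u‖ ≤ L) {b : ℝ} (hb : 0 < b)
    (hc : ∀ m ∈ Finset.Icc 1 3, (1 / b) ^ m ≤ c) (a : ℝ) :
    P.real {ω | softRisk N ℓ R s (designMatrix X ω) ≤ a - b} ≤
      P'.real {ω | softRisk N ℓ R s (designMatrix G ω) < a} +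
        lindebergConst q M K θ * (c * κ) * (1 + s) ^ 2 * D ^ 3 *
          (avgL q Λ * L ^ (qBar q + 3) * sigmaRate n p d q) := by
  convert h.measureReal_one_le_softRisk_le (R := R) (b := -(1 / b)) hq hr hL hℓ hφ hD hΛ hs hN hNL
    (by rwa [abs_neg, abs_of_pos (by positivity)]) a using 4
  · rw [neg_mul_comm, neg_sub, one_div, inv_mul_eq_div, one_le_div hb, le_sub_comm]
  · funext ω
    rw [neg_mul_comm, neg_sub, mul_pos_iff_of_pos_left (by positivity), sub_pos]

theorem MatchedDesigns.measureReal_mem_le {wX : Ω → Fin p → ℝ} {wG : Ω' → Fin p → ℝ}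
    {S : Set (Fin p → ℝ)} (h : MatchedDesigns P P' X G μ ν B Sig d r M K θ) (hq : ∀ k, 0 ≤ q k)
    (hr : qBar q + 3 ≤ r) (hL : 1 ≤ L) (hℓ : ∀ i, SmoothLoss q D (Λ i) (ℓ' i))
    (hφ : SmoothTest κ Real.smoothTransition) (hD : 1 ≤ D) (hΛ : ∀ i, 1 ≤ Λ i) (hs : 0 < s)
    (hσ : 0 ≤ sigmaRate n p d q) (hδ : δ ∈ Ioo 0 (omegaRate n p d q)) (hR : Continuous R)
    (hℓℓ' : ∀ i x, |ℓ' i x - ℓ i x| ≤ e) (hρ₀ : 0 < ρ₀)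
    (herr : regModulus R L δ + 3 * p * logPlus (L / δ) / (n * s) + e ≤ 3 * (ρ₀ / 32))
    (hc : ∀ m ∈ Finset.Icc 1 3, (1 / (ρ₀ / 4)) ^ m ≤ c)
    (hwX : ∀ᵐ ω ∂P, IsRiskMinimizer ℓ R (designMatrix X ω) (wX ω))
    (hwG : ∀ᵐ ω ∂P', IsRiskMinimizer ℓ R (designMatrix G ω) (wG ω))
    (hεX : P.real {ω | L < ‖wX ω‖} ≤ ε) (hεG : P'.real {ω | L < ‖wG ω‖} ≤ ε)
    (hmin : P'.real {ω | ((z + ρ₀ : ℝ) : EReal) ≤ minRisk ℓ R univ (designMatrix G ω)} ≤ ε)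
    (hminS : P'.real {ω | minRisk ℓ R S (designMatrix G ω) ≤ ((z + 2 * ρ₀ : ℝ) : EReal)} ≤ ε)
    (hne : (S ∩ {w | ‖w‖ ≤ L}).Nonempty) :
    P.real {ω | wX ω ∈ S} ≤ 4 * ε +
      2 * (lindebergConst q M K θ * (c * κ) * (1 + s) ^ 2 * D ^ 3 *
        (avgL q Λ * L ^ (qBar q + 3) * sigmaRate n p d q)) +
      3 * (netConst q K θ * D * (avgL q Λ * L ^ (qBar q + 3) * sigmaRate n p d q) /
        (ρ₀ / 32)) := by
  have D_nonneg : 0 ≤ D := zero_le_one.trans hD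
  have approx {T : Set (Fin p → ℝ)} := exists_softRisk_isApproxInf_of_lipBound_lt (T := T) hq hR hℓ
    D_nonneg hΛ hL hδ.1 hs h.regime.n_pos hℓℓ' hρ₀ herr
  obtain ⟨N₁, hN₁, hN₁L, approx₁⟩ := approx (T := {w | ‖w‖ ≤ L}) (fun _ hw => hw)
    (hne.mono inter_subset_right)
  obtain ⟨N₂, hN₂, hN₂L, approx₂⟩ := approx (fun w hw => hw.2) hne
  have hr' : qBar q + 1 ≤ r := le_trans (by gcongr; norm_num) hr
  have Λ_nonneg (i : Fin n) : 0 ≤ Λ i := zero_le_one.trans (hΛ i)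
  have tail (A : Fin n → Fin p → ℝ)
      (hA : ¬ (IsApproxInf (ρ₀ / 8) (fun w => risk ℓ R w (Matrix.of A)) {w | ‖w‖ ≤ L}
          (softRisk N₁ ℓ' R s (Matrix.of A)) ∧
        IsApproxInf (ρ₀ / 8) (fun w => risk ℓ R w (Matrix.of A)) (S ∩ {w | ‖w‖ ≤ L})
          (softRisk N₂ ℓ' R s (Matrix.of A)))) : ρ₀ / 32 ≤ δ * lipBound q D L Λ A :=
    not_lt.1 fun small => hA ⟨approx₁ A small, approx₂ A small⟩
  exact measureReal_mem_le_of_isApproxInf hwX hwG (by simpa using hεX) (by simpa using hεG)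
    ((measureReal_mono fun ω => tail fun i => X i ω).trans
      (h.rows_left.measureReal_le_mul_lipBound_le h.regime h.law_left hq hr' D_nonneg hL Λ_nonneg
        hσ hδ.1.le hδ.2.le (by positivity)))
    ((measureReal_mono fun ω => tail fun i => G i ω).trans
      (h.rows_right.measureReal_le_mul_lipBound_le h.regime h.law_right hq hr' D_nonneg hL Λ_nonneg
        hσ hδ.1.le hδ.2.le (by positivity)))
    (h.measureReal_le_softRisk_le hq hr hL hℓ hφ hD hΛ hs hN₁ hN₁L (by positivity) hc)
    (h.measureReal_softRisk_le_le hq hr hL hℓ hφ hD hΛ hs hN₂ hN₂L (by positivity) hc) hmin hminS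

end MatchedDesigns

section LambdaMax

variable {p : ℕ} {Sig : Matrix (Fin p) (Fin p) ℝ} {M : ℝ}

theorem posSemidef_algebraMap_sub_of_lambdaMax_le (hSig : Sig.IsHermitian)
    (hM : lambdaMax Sig ≤ M) : (algebraMap ℝ (Matrix (Fin p) (Fin p) ℝ) M - Sig).PosSemidef := by
  refine Matrix.posSemidef_iff_isHermitian_and_spectrum_nonneg.2
    ⟨(IsSelfAdjoint.algebraMap _ (.all M)).sub hSig, ?_⟩
  rw [← spectrum.singleton_sub_eq]
  rintro _ ⟨_, rfl, x, hx, rfl⟩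
  exact sub_nonneg.2 ((le_csSup Matrix.finite_real_spectrum.bddAbove hx).trans hM)

theorem dotProduct_mulVec_le_of_lambdaMax_le (hSig : Sig.IsHermitian) (hM : lambdaMax Sig ≤ M)
    (v : Fin p → ℝ) : v ⬝ᵥ Sig.mulVec v ≤ M * (v ⬝ᵥ v) := by
  have nonneg := (posSemidef_algebraMap_sub_of_lambdaMax_le hSig hM).dotProduct_mulVec_nonneg v
  rwa [Matrix.sub_mulVec, dotProduct_sub, Algebra.algebraMap_eq_smul_one, Matrix.smul_mulVec,
    Matrix.one_mulVec, dotProduct_smul, star_trivial, smul_eq_mul, sub_nonneg] at nonneg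

theorem diag_le_of_lambdaMax_le (hSig : Sig.IsHermitian) (hM : lambdaMax Sig ≤ M) (j : Fin p) :
    Sig j j ≤ M := by
  simpa using dotProduct_mulVec_le_of_lambdaMax_le hSig hM (Pi.single j 1)

end LambdaMax

section IndepBlocks

variable {p k n r : ℕ} {B : Fin k → Finset (Fin p)} {Sig : Matrix (Fin p) (Fin p) ℝ} {K : ℝ}
  {Ω : Type*} [MeasurableSpace Ω] {P : Measure Ω} {V : Ω → Fin p → ℝ}

/-- The cells `B` partition the coordinates of `V`, and the subvectors of `V` on the different
cells are independent. -/
structure HasIndepBlocks (P : Measure Ω) (V : Ω → Fin p → ℝ) (B : Fin k → Finset (Fin p)) :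
    Prop where
  disjoint : ∀ a b, a ≠ b → Disjoint (B a) (B b)
  cover : ∀ j, ∃ a, j ∈ B a
  indep : iIndepFun (fun (a : Fin k) (ω : Ω) (j : B a) => V ω j) P

theorem HasIndepBlocks.sum_blockPart (h : HasIndepBlocks P V B) (x : Fin p → ℝ) :
    ∑ a, blockPart (B a) x = x := by
  ext j
  obtain ⟨a, ha⟩ := h.cover j
  rw [Finset.sum_apply, Finset.sum_eq_single_of_mem a (Finset.mem_univ a)]
  · exact if_pos ha
  · exact fun b _ hb => if_neg fun hj => Finset.disjoint_left.1 (h.disjoint a b hb.symm) ha hj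

theorem HasIndepBlocks.iIndepFun_blockPart (h : HasIndepBlocks P V B) :
    iIndepFun (fun a ω => blockPart (B a) (V ω)) P := by
  refine h.indep.comp (fun a (y : B a → ℝ) j => if hj : j ∈ B a then y ⟨j, hj⟩ else 0) fun a => ?_
  refine measurable_pi_iff.2 fun j => ?_
  split_ifs <;> fun_prop

theorem HasIndepBlocks.map_sum_pi_blockPart (h : HasIndepBlocks P V B) (hV : Measurable V) :
    (Measure.pi fun a => (P.map V).map (blockPart (B a))).map (fun x => ∑ a, x a) = P.map V := by
  have measurable (a : Fin k) : Measurable fun ω => blockPart (B a) (V ω) :=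
    (measurable_blockPart (B a)).comp hV
  have map_eq (a : Fin k) :
      (P.map V).map (blockPart (B a)) = P.map fun ω => blockPart (B a) (V ω) :=
    Measure.map_map (measurable_blockPart _) hV
  have : IsProbabilityMeasure P := h.iIndepFun_blockPart.isProbabilityMeasure
  simp only [map_eq]
  rw [← (iIndepFun_iff_map_fun_eq_pi_map fun a => (measurable a).aemeasurable).1
    h.iIndepFun_blockPart, Measure.map_map (by fun_prop) (measurable_pi_iff.2 measurable)]
  congr 1
  ext1 ω
  exact h.sum_blockPart (V ω)

theorem HasIndepBlocks.rowLaw (h : HasIndepBlocks P V B) (hV : Measurable V)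
    (memLp : ∀ j, MemLp (fun ω => V ω j) (r : ℝ≥0∞) P) (mean : ∀ j, ∫ ω, V ω j ∂P = 0)
    (cov : ∀ i j, ∫ ω, V ω i * V ω j ∂P = Sig i j / n)
    (moment : ∀ j, ∀ l ≤ r, ∫ ω, |V ω j| ^ l ∂P ≤ K / Real.sqrt n ^ l) :
    RowLaw B Sig n r K (P.map V) where
  blocks := h.map_sum_pi_blockPart hV
  memLp j :=
    (memLp_map_measure_iff (measurable_pi_apply j).aestronglyMeasurable hV.aemeasurable).2 (memLp j)
  mean j := by
    rw [integral_map hV.aemeasurable (measurable_pi_apply j).aestronglyMeasurable, mean j]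
  cov i j := by
    rw [integral_map hV.aemeasurable (by fun_prop), cov i j]
  moment j l hl := by
    rw [integral_map hV.aemeasurable
      (Measurable.aestronglyMeasurable (f := fun x : Fin p → ℝ => |x j| ^ l) (by fun_prop))]
    exact moment j l hl

end IndepBlocks

section Moments

variable {n r l : ℕ} {Ω : Type*} [MeasurableSpace Ω] {P : Measure Ω} {Z : Ω → ℝ} {C : ℝ}

theorem integral_abs_pow_le_one_add [IsProbabilityMeasure P] (hZ : MemLp Z (r : ℝ≥0∞) P)
    (hl : l ≤ r) : ∫ ω, |Z ω| ^ l ∂P ≤ 1 + ∫ ω, |Z ω| ^ r ∂P := by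
  have pow_le (x : ℝ) : |x| ^ l ≤ 1 + |x| ^ r := by
    rcases le_total |x| 1 with hx | hx
    · exact (pow_le_one₀ (abs_nonneg x) hx).trans (le_add_of_nonneg_right (by positivity))
    · exact (pow_le_pow_right₀ hx hl).trans (le_add_of_nonneg_left zero_le_one)
  have integrable : Integrable (fun ω => |Z ω| ^ r) P := integrable_pow_of_memLp hZ.abs le_rfl
  calc ∫ ω, |Z ω| ^ l ∂P ≤ ∫ ω, 1 + |Z ω| ^ r ∂P :=
        integral_mono (integrable_pow_of_memLp hZ.abs hl)
          ((integrable_const 1).fun_add integrable) fun ω => pow_le (Z ω)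
    _ = 1 + ∫ ω, |Z ω| ^ r ∂P := by
        rw [integral_add (integrable_const 1) integrable, integral_const, probReal_univ, one_smul]

theorem integral_abs_pow_le_div_sqrt_pow [IsProbabilityMeasure P] (hn : 0 < n)
    (hZ : MemLp Z (r : ℝ≥0∞) P) (hC : ∫ ω, |Real.sqrt n * Z ω| ^ r ∂P ≤ C) (hl : l ≤ r) :
    ∫ ω, |Z ω| ^ l ∂P ≤ (1 + C) / Real.sqrt n ^ l := by
  have sqrt_pos : 0 < Real.sqrt n := Real.sqrt_pos.2 (mod_cast hn)
  rw [le_div_iff₀' (by positivity), ← integral_const_mul]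
  calc ∫ ω, Real.sqrt n ^ l * |Z ω| ^ l ∂P = ∫ ω, |Real.sqrt n * Z ω| ^ l ∂P := by
        simp only [abs_mul, abs_of_pos sqrt_pos, mul_pow]
    _ ≤ 1 + ∫ ω, |Real.sqrt n * Z ω| ^ r ∂P :=
        integral_abs_pow_le_one_add (hZ.const_mul (Real.sqrt n)) hl
    _ ≤ 1 + C := by gcongr

theorem integral_abs_pow_le_of_eLpNorm_le (hr : r ≠ 0) (hZ : MemLp Z (r : ℝ≥0∞) P)
    (hC : eLpNorm Z (r : ℝ≥0∞) P ≤ ENNReal.ofReal C) (hC0 : 0 ≤ C) :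
    ∫ ω, |Z ω| ^ r ∂P ≤ C ^ r := by
  have integral_nonneg : 0 ≤ ∫ ω, |Z ω| ^ r ∂P := integral_nonneg fun ω => by positivity
  rw [hZ.eLpNorm_eq_integral_rpow_norm (mod_cast hr) (ENNReal.natCast_ne_top r),
    ENNReal.ofReal_le_ofReal_iff hC0] at hC
  simp only [ENNReal.toReal_natCast, Real.rpow_natCast, Real.norm_eq_abs] at hC
  calc ∫ ω, |Z ω| ^ r ∂P = ((∫ ω, |Z ω| ^ r ∂P) ^ (r : ℝ)⁻¹) ^ r :=
        (Real.rpow_inv_natCast_pow integral_nonneg hr).symm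
    _ ≤ C ^ r := by gcongr

theorem integral_abs_pow_gaussianReal (v : NNReal) (r : ℕ) :
    ∫ y, |y| ^ r ∂gaussianReal 0 v =
      Real.sqrt v ^ r * ∫ y, |y| ^ r ∂gaussianReal 0 1 := by
  have map_eq : (gaussianReal 0 1).map (fun x => Real.sqrt v * x) = gaussianReal 0 v := by
    rw [gaussianReal_map_const_mul, mul_zero, mul_one]
    congr 1
    ext
    exact Real.sq_sqrt v.coe_nonneg
  rw [← map_eq, integral_map (by fun_prop) (by fun_prop), ← integral_const_mul]
  simp only [abs_mul, abs_of_nonneg (Real.sqrt_nonneg _), mul_pow]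

end Moments

section Covariates

variable {n p k d : ℕ} {q : Fin 4 → ℝ} {M θ : ℝ} {Sig : Matrix (Fin p) (Fin p) ℝ}
  {B : Fin k → Finset (Fin p)} {Ω : Type*} [MeasurableSpace Ω] {P : Measure Ω}
  {X : Fin n → Ω → Fin p → ℝ}

theorem qBar_add_three_le_qStar (q : Fin 4 → ℝ) : qBar q + 3 ≤ qStar q := by
  have le_two_pow (h : ℕ) : 2 * h + 3 ≤ 2 ^ (h + 2) := by
    induction h with
    | zero => norm_num
    | succ h ih => rw [add_right_comm, pow_succ]; omega
  rw [qStar, qBar_eq_two_mul_qHalf, show (2 * qHalf q + 4) / 2 = qHalf q + 2 by omega]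
  exact le_two_pow _

/-- A bound for the moments, up to order `q*`, of the entries of `√n X_i` and of `√n G_i`. -/
noncomputable def momentConst (q : Fin 4 → ℝ) (M : ℝ) : ℝ :=
  1 + (|M| ^ qStar q + Real.sqrt |M| ^ qStar q * ∫ y, |y| ^ qStar q ∂gaussianReal 0 1)

theorem one_le_momentConst (q : Fin 4 → ℝ) (M : ℝ) : 1 ≤ momentConst q M := by
  have : 0 ≤ ∫ y, |y| ^ qStar q ∂gaussianReal 0 1 := integral_nonneg fun y => by positivity
  exact le_add_of_nonneg_right (by positivity)

theorem CovariateAssumption.iidRows (h : CovariateAssumption P X Sig q M d) (i : Fin n) :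
    IidRows P X (P.map (X i)) where
  measurable := h.measurable
  indep := h.indep
  law j := (h.identDistrib j i).map_eq

theorem CovariateAssumption.rowLaw [IsProbabilityMeasure P]
    (h : CovariateAssumption P X Sig q M d) {i : Fin n} (hB : HasIndepBlocks P (X i) B) :
    RowLaw B Sig n (qStar q) (momentConst q M) (P.map (X i)) := by
  have n_pos : 0 < n := i.pos
  have measurable := h.measurable i
  have memLp_sqrt_mul (j : Fin p) : MemLp (fun ω => Real.sqrt n * X i ω j) (qStar q : ℝ≥0∞) P :=
    ⟨by fun_prop, (h.moment_le i j).trans_lt ENNReal.ofReal_lt_top⟩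
  have memLp (j : Fin p) : MemLp (fun ω => X i ω j) (qStar q : ℝ≥0∞) P := by
    have sqrt_ne_zero : Real.sqrt n ≠ 0 := (Real.sqrt_pos.2 (mod_cast n_pos)).ne'
    simpa only [inv_mul_cancel_left₀ sqrt_ne_zero]
      using (memLp_sqrt_mul j).const_mul (Real.sqrt n)⁻¹
  refine hB.rowLaw measurable memLp (h.mean i) (h.second_moment i) fun j l hl =>
    integral_abs_pow_le_div_sqrt_pow n_pos (memLp j) ?_ hl
  have : 0 ≤ ∫ y, |y| ^ qStar q ∂gaussianReal 0 1 := integral_nonneg fun y => by positivity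
  exact (integral_abs_pow_le_of_eLpNorm_le (by have := qBar_add_three_le_qStar q; omega)
    (memLp_sqrt_mul j) ((h.moment_le i j).trans (ENNReal.ofReal_le_ofReal (le_abs_self M)))
    (abs_nonneg M)).trans (le_add_of_nonneg_right (by positivity))

theorem CovariateAssumption.cov_eq_zero (h : CovariateAssumption P X Sig q M d) {i : Fin n}
    (hB : HasIndepBlocks P (X i) B) {a b : Fin k} (hab : a ≠ b) {j l : Fin p} (hj : j ∈ B a)
    (hl : l ∈ B b) : Sig j l = 0 := by
  have measurable := h.measurable i
  have independent : IndepFun (fun ω => X i ω j) (fun ω => X i ω l) P :=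
    (hB.indep.indepFun hab).comp (φ := fun y : B a → ℝ => y ⟨j, hj⟩)
      (ψ := fun y : B b → ℝ => y ⟨l, hl⟩) (by fun_prop) (by fun_prop)
  have integral_mul := independent.integral_fun_mul_eq_mul_integral (by fun_prop) (by fun_prop)
  rw [h.second_moment, h.mean, zero_mul] at integral_mul
  exact (div_eq_zero_iff.1 integral_mul).resolve_right (mod_cast i.pos.ne')

end Covariates

section GaussianDesign

variable {n p k d r : ℕ} {q : Fin 4 → ℝ} {M θ : ℝ} {Sig : Matrix (Fin p) (Fin p) ℝ}
  {B : Fin k → Finset (Fin p)} {Ω : Type*} [MeasurableSpace Ω] {P : Measure Ω}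
  {G : Fin n → Ω → Fin p → ℝ}

namespace IsGaussianDesign

theorem measurable_toLp (h : IsGaussianDesign P G Sig) (i : Fin n) :
    Measurable fun ω => WithLp.toLp 2 (G i ω) :=
  (WithLp.measurable_toLp 2 _).comp (h.measurable i)

theorem iidRows (h : IsGaussianDesign P G Sig) (i : Fin n) : IidRows P G (P.map (G i)) where
  measurable := h.measurable
  indep := h.indep
  law j := by
    have map_ofLp (j : Fin n) : P.map (G j) =
        (P.map fun ω => WithLp.toLp 2 (G j ω)).map
          (WithLp.ofLp : EuclideanSpace ℝ (Fin p) → Fin p → ℝ) := by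
      rw [Measure.map_map (WithLp.measurable_ofLp 2 _) (h.measurable_toLp j)]
      rfl
    rw [map_ofLp j, map_ofLp i, h.law j, h.law i]

theorem hasLaw_eval (h : IsGaussianDesign P G Sig) (hSig : Sig.PosSemidef) (i : Fin n)
    (j : Fin p) : HasLaw (fun ω => G i ω j) (gaussianReal 0 (Sig j j / n).toNNReal) P := by
  have measurable := h.measurable i
  have map_eq := (measurePreserving_eval_multivariateGaussian (μ := 0)
    (hSig.smul (by positivity : 0 ≤ 1 / (n : ℝ))) (i := j)).map_eq
  rw [← h.law i, Measure.map_map (by fun_prop) (h.measurable_toLp i)] at map_eq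
  rw [Matrix.smul_apply, smul_eq_mul, one_div_mul_eq_div] at map_eq
  exact ⟨by fun_prop, map_eq⟩

theorem memLp_eval (h : IsGaussianDesign P G Sig) (hSig : Sig.PosSemidef) (i : Fin n) (j : Fin p)
    (r : ℕ) : MemLp (fun ω => G i ω j) (r : ℝ≥0∞) P := by
  have law := h.hasLaw_eval hSig i j
  have memLp : MemLp id (r : ℝ≥0∞) (P.map fun ω => G i ω j) :=
    law.map_eq ▸ memLp_id_gaussianReal r
  exact (memLp_map_measure_iff (by fun_prop) law.aemeasurable).1 memLp

theorem integral_eval (h : IsGaussianDesign P G Sig) (hSig : Sig.PosSemidef) (i : Fin n)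
    (j : Fin p) : ∫ ω, G i ω j ∂P = 0 := by
  rw [(h.hasLaw_eval hSig i j).integral_eq, integral_id_gaussianReal]

theorem covariance_eval (h : IsGaussianDesign P G Sig) (hSig : Sig.PosSemidef) (i : Fin n)
    (j l : Fin p) : cov[fun ω => G i ω j, fun ω => G i ω l; P] = Sig j l / n := by
  have cov_eq := covariance_eval_multivariateGaussian (μ := 0)
    (hSig.smul (by positivity : 0 ≤ 1 / (n : ℝ))) j l
  rwa [← h.law i, covariance_map_fun (by fun_prop) (by fun_prop)
    (h.measurable_toLp i).aemeasurable, Matrix.smul_apply, smul_eq_mul,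
    one_div_mul_eq_div] at cov_eq

theorem integral_eval_mul_eval [IsProbabilityMeasure P] (h : IsGaussianDesign P G Sig)
    (hSig : Sig.PosSemidef) (i : Fin n) (j l : Fin p) :
    ∫ ω, G i ω j * G i ω l ∂P = Sig j l / n := by
  have memLp (j : Fin p) : MemLp (fun ω => G i ω j) 2 P := mod_cast h.memLp_eval hSig i j 2
  have cov_eq := covariance_eq_sub (memLp j) (memLp l)
  rw [h.covariance_eval hSig, h.integral_eval hSig, zero_mul, sub_zero] at cov_eq
  exact cov_eq.symm

theorem integral_abs_sqrt_mul_eval_pow (h : IsGaussianDesign P G Sig) (hSig : Sig.PosSemidef)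
    (i : Fin n) (j : Fin p) (r : ℕ) : ∫ ω, |Real.sqrt n * G i ω j| ^ r ∂P =
      Real.sqrt (Sig j j) ^ r * ∫ y, |y| ^ r ∂gaussianReal 0 1 := by
  have sqrt_pos : 0 < Real.sqrt n := Real.sqrt_pos.2 (mod_cast i.pos)
  have diag_nonneg : 0 ≤ Sig j j := hSig.diag_nonneg
  have integral_eq : ∫ ω, |G i ω j| ^ r ∂P = ∫ y, |y| ^ r ∂gaussianReal 0 (Sig j j / n).toNNReal :=
    (h.hasLaw_eval hSig i j).integral_comp (f := fun y => |y| ^ r) (by fun_prop)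
  simp only [abs_mul, mul_pow, abs_of_pos sqrt_pos]
  rw [integral_const_mul, integral_eq, integral_abs_pow_gaussianReal,
    Real.coe_toNNReal _ (div_nonneg diag_nonneg n.cast_nonneg), Real.sqrt_div diag_nonneg,
    ← mul_assoc, ← mul_pow, mul_div_cancel₀ _ sqrt_pos.ne']

theorem hasIndepBlocks [IsProbabilityMeasure P] (h : IsGaussianDesign P G Sig)
    (hSig : Sig.PosSemidef) (i : Fin n)
    (disjoint : ∀ a b, a ≠ b → Disjoint (B a) (B b)) (cover : ∀ j, ∃ a, j ∈ B a)
    (uncorrelated : ∀ a b, a ≠ b → ∀ j ∈ B a, ∀ l ∈ B b, Sig j l = 0) :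
    HasIndepBlocks P (G i) B where
  disjoint := disjoint
  cover := cover
  indep := by
    have gaussian : HasGaussianLaw (fun ω => WithLp.toLp 2 (G i ω)) P :=
      ⟨by rw [h.law i]; infer_instance⟩
    refine HasGaussianLaw.iIndepFun_of_covariance_eval (X := fun a (j : B a) ω => G i ω j)
      ?_ fun a b hab j l => ?_
    · exact gaussian.map_fun (ContinuousLinearMap.pi fun a => ContinuousLinearMap.pi
        fun j : B a => (EuclideanSpace.proj (j : Fin p) : EuclideanSpace ℝ (Fin p) →L[ℝ] ℝ))
    · rw [h.covariance_eval hSig, uncorrelated a b hab j j.2 l l.2, zero_div]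

theorem rowLaw [IsProbabilityMeasure P] (h : IsGaussianDesign P G Sig) (hSig : Sig.PosSemidef)
    (hM : lambdaMax Sig ≤ M) {i : Fin n} (hB : HasIndepBlocks P (G i) B) :
    RowLaw B Sig n (qStar q) (momentConst q M) (P.map (G i)) := by
  refine hB.rowLaw (h.measurable i) (h.memLp_eval hSig i · _) (h.integral_eval hSig i)
    (h.integral_eval_mul_eval hSig i) fun j l hl =>
      integral_abs_pow_le_div_sqrt_pow i.pos (h.memLp_eval hSig i j _) ?_ hl
  have : 0 ≤ ∫ y, |y| ^ qStar q ∂gaussianReal 0 1 := integral_nonneg fun y => by positivity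
  have diag_le : Sig j j ≤ |M| :=
    (diag_le_of_lambdaMax_le hSig.isHermitian hM j).trans (le_abs_self M)
  rw [h.integral_abs_sqrt_mul_eval_pow hSig]
  exact le_add_of_nonneg_of_le (by positivity) (by gcongr)

end IsGaussianDesign

theorem CovariateAssumption.exists_matchedDesigns {X : Fin n → Ω → Fin p → ℝ} {Ω' : Type*}
    [MeasurableSpace Ω'] {P' : Measure Ω'} {G : Fin n → Ω' → Fin p → ℝ} [IsProbabilityMeasure P]
    [IsProbabilityMeasure P'] (hX : CovariateAssumption P X Sig q M d)
    (hG : IsGaussianDesign P' G Sig) (hn : 0 < n) (hp : 0 < p) (hθ : 1 ≤ θ)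
    (hpn : (p : ℝ) ≤ θ * n) : ∃ (k : ℕ) (B : Fin k → Finset (Fin p)) (μ ν : Measure (Fin p → ℝ)),
      IsProbabilityMeasure μ ∧ IsProbabilityMeasure ν ∧
      MatchedDesigns P P' X G μ ν B Sig d (qStar q) |M| (momentConst q M) θ := by
  have i : Fin n := ⟨0, hn⟩
  have hSig := hX.posDef.posSemidef
  obtain ⟨k, -, B, disjoint, cover, card_le, indep⟩ := hX.blockDependent i
  have blocks : HasIndepBlocks P (X i) B := ⟨disjoint, cover, indep⟩
  have gaussianBlocks : HasIndepBlocks P' (G i) B := hG.hasIndepBlocks hSig i disjoint cover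
    fun a b hab j hj l hl => hX.cov_eq_zero blocks hab hj hl
  have one_le_d : 1 ≤ d := by
    obtain ⟨a, ha⟩ := cover ⟨0, hp⟩
    exact (Finset.card_pos.2 ⟨_, ha⟩).trans_le (card_le a)
  refine ⟨k, B, P.map (X i), P'.map (G i),
    Measure.isProbabilityMeasure_map (hX.measurable i).aemeasurable,
    Measure.isProbabilityMeasure_map (hG.measurable i).aemeasurable, ⟨⟨disjoint, card_le⟩, hn,
      one_le_d, hθ, hpn, one_le_momentConst q M, abs_nonneg M,
      dotProduct_mulVec_le_of_lambdaMax_le hSig.isHermitian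
        (hX.lambdaMax_le.trans (le_abs_self M))⟩,
    hX.iidRows i, hG.iidRows i, hX.rowLaw blocks, hG.rowLaw hSig hX.lambdaMax_le gaussianBlocks⟩

end GaussianDesign

section Loss

variable {n : ℕ} {q : Fin 4 → ℝ} {ρbar ρ : ℝ} {Λ : Fin n → ℝ} {Dℓ Mℓ : ℝ → ℝ}
  {ℓ : Fin n → ℝ → ℝ}

theorem LossAssumption.exists_smoothLoss (h : LossAssumption q ρbar Λ Dℓ Mℓ ℓ)
    (hρ : ρ ∈ Ioo 0 ρbar) : ∃ ℓ' : Fin n → ℝ → ℝ,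
      (∀ i, SmoothLoss q (Dℓ ρ) (Λ i) (ℓ' i)) ∧ ∀ i x, |ℓ' i x - ℓ i x| ≤ Mℓ ρ := by
  obtain ⟨ℓs, hs⟩ := h.smooth_approx
  refine ⟨fun i => ℓs i ρ, fun i => ?_, fun i => (hs ρ hρ i).2.2.1⟩
  obtain ⟨nonneg, contDiff, close, deriv_div_le⟩ := hs ρ hρ i
  refine ⟨nonneg, contDiff, fun k hk x => ?_, fun x => ?_⟩
  · have deriv_div_le := deriv_div_le k hk x
    have := Real.rpow_nonneg (nonneg x) (q k)
    rwa [abs_of_nonneg (nonneg x), div_le_iff₀ (by positivity)] at deriv_div_le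
  · have growth := h.growth i x
    rw [div_le_iff₀ (by positivity)] at growth
    linarith [(abs_le.1 (close x)).2, (h.M_mem ρ hρ).2, le_abs_self (ℓ i x), h.one_le_L i]

theorem avgL_pos (q : Fin 4 → ℝ) (hn : 0 < n) (hΛ : ∀ i, 0 < Λ i) : 0 < avgL q Λ := by
  have : Nonempty (Fin n) := ⟨⟨0, hn⟩⟩
  exact mul_pos (by positivity) (Finset.sum_pos (fun i _ => Real.rpow_pos_of_pos (hΛ i) _)
    Finset.univ_nonempty)

end Loss

section Numeric

theorem zpow_neg_three (x : ℝ) : x ^ (-3 : ℤ) = (1 / x) ^ 3 := by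
  rw [one_div, inv_pow, zpow_neg, zpow_ofNat]

theorem pow_le_max_one_pow {x : ℝ} (hx : 0 ≤ x) {m k : ℕ} (hmk : m ≤ k) :
    x ^ m ≤ max 1 (x ^ k) := by
  rcases le_total x 1 with le_one | one_le
  · exact (pow_le_one₀ hx le_one).trans (le_max_left _ _)
  · exact (pow_le_pow_right₀ one_le hmk).trans (le_max_right _ _)

theorem one_div_div_four_pow_le {ρ₀ : ℝ} (hρ₀ : 0 < ρ₀) {m : ℕ} (hm : m ∈ Finset.Icc 1 3) :
    (1 / (ρ₀ / 4)) ^ m ≤ 64 * max 1 (ρ₀ ^ (-3 : ℤ)) := by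
  have m_le := (Finset.mem_Icc.1 hm).2
  calc (1 / (ρ₀ / 4)) ^ m = 4 ^ m * (1 / ρ₀) ^ m := by rw [one_div_div, ← mul_pow, mul_one_div]
    _ ≤ 4 ^ 3 * max 1 ((1 / ρ₀) ^ 3) := by
        gcongr
        · norm_num
        · exact pow_le_max_one_pow (by positivity) m_le
    _ = 64 * max 1 (ρ₀ ^ (-3 : ℤ)) := by rw [zpow_neg_three]; norm_num

theorem one_div_le_max_one_zpow {ρ₀ : ℝ} (hρ₀ : 0 < ρ₀) : 1 / ρ₀ ≤ max 1 (ρ₀ ^ (-3 : ℤ)) := by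
  have := pow_le_max_one_pow (one_div_nonneg.2 hρ₀.le) (m := 1) (k := 3) (by norm_num)
  rwa [pow_one, ← zpow_neg_three] at this

theorem rpow_div_three_pow_three {a : ℝ} (ha : 0 ≤ a) (b : ℝ) : (a ^ (b / 3)) ^ 3 = a ^ b := by
  rw [← Real.rpow_mul_natCast ha, Nat.cast_ofNat, div_mul_cancel₀ b three_ne_zero]

end Numeric

section SmoothingRate

variable {n p d : ℕ} {q : Fin 4 → ℝ} {ρbar L δ B η t : ℝ} {Λ : Fin n → ℝ} {Dℓ Mℓ : ℝ → ℝ}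
  {R : (Fin p → ℝ) → ℝ}

/-- The part of the rate due to the smoothing of the minimum over a net of mesh `δ`. It balances
the entropy term `logPlus (L / δ) / s` against the Lindeberg term `s ^ 2 * B`, where
`B = avgL q Λ * L ^ (qBar q + 3) * sigmaRate n p d q`. -/
noncomputable def smoothingRate (p d : ℕ) (q : Fin 4 → ℝ) (Λ : Fin n → ℝ) (L δ : ℝ) : ℝ :=
  avgL q Λ ^ ((1 : ℝ) / 3) * L ^ (((qBar q : ℝ) + 3) / 3) *
    logPlus (L / δ) ^ ((2 : ℝ) / 3) * sigmaRate n p d q ^ ((1 : ℝ) / 3)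

theorem smoothingRate_pos (hn : 0 < n) (hp : 0 < p) (hd : 0 < d) (hΛ : ∀ i, 0 < Λ i)
    (hL : 0 < L) (δ : ℝ) : 0 < smoothingRate p d q Λ L δ := by
  have log_pos : 0 < logPlus (L / δ) := zero_lt_one.trans_le (one_le_logPlus _)
  have avg_pos := avgL_pos q hn hΛ
  have sigma_pos := sigmaRate_pos q hn hp hd
  unfold smoothingRate
  positivity

theorem smoothingRate_pow_three (hn : 0 < n) (hp : 0 < p) (hd : 0 < d) (hΛ : ∀ i, 0 < Λ i)
    (hL : 0 < L) (δ : ℝ) : smoothingRate p d q Λ L δ ^ 3 =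
      avgL q Λ * L ^ (qBar q + 3) * sigmaRate n p d q * logPlus (L / δ) ^ 2 := by
  have log_nonneg : 0 ≤ logPlus (L / δ) := zero_le_one.trans (one_le_logPlus _)
  have rpow_eq : L ^ ((qBar q : ℝ) + 3) = L ^ (qBar q + 3) := mod_cast Real.rpow_natCast L _
  simp only [smoothingRate, mul_pow, rpow_div_three_pow_three, (avgL_pos q hn hΛ).le, hL.le,
    (sigmaRate_pos q hn hp hd).le, log_nonneg, rpow_eq, Real.rpow_one, Real.rpow_two]
  ring

theorem sq_one_add_div_mul_le (hη : 0 < η) (hη1 : η ≤ 1) (ht : 1 ≤ t) (h : η ^ 3 = B * t ^ 2) :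
    (1 + t / η) ^ 2 * B ≤ 4 * η ∧ B ≤ η := by
  have : 0 < t := zero_lt_one.trans_le ht
  have B_eq : B = η ^ 3 / t ^ 2 := eq_div_of_mul_eq (by positivity) h.symm
  have one_le : 1 ≤ t / η := (one_le_div hη).2 (hη1.trans ht)
  have B_nonneg : 0 ≤ B := B_eq ▸ by positivity
  have balanced : (t / η) ^ 2 * B = η := by rw [B_eq]; field_simp
  constructor
  · calc (1 + t / η) ^ 2 * B ≤ (t / η + t / η) ^ 2 * B := by gcongr
      _ = 4 * η := by rw [← two_mul, mul_pow, mul_assoc, balanced]; norm_num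
  · calc B ≤ (t / η) ^ 2 * B := le_mul_of_one_le_left B_nonneg (one_le_pow₀ one_le)
      _ = η := balanced

theorem le_add_mul_rate {a b C : ℝ} (hC : 0 < C) (hρ : 0 < ρbar) (hω : 0 < omegaRate n p d q)
    (hD : ∀ ρ ∈ Ioo 0 ρbar, 0 < Dℓ ρ)
    (h : ∀ ρ ∈ Ioo 0 ρbar, ∀ δ ∈ Ioo 0 (omegaRate n p d q),
      a ≤ b + C * (Mℓ ρ + Dℓ ρ ^ 3 * (regModulus R L δ + smoothingRate p d q Λ L δ))) :
    a ≤ b + C * rate d q ρbar Λ Dℓ Mℓ R L := by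
  have : Nonempty (Ioo 0 ρbar) := (nonempty_Ioo.2 hρ).to_subtype
  have : Nonempty (Ioo 0 (omegaRate n p d q)) := (nonempty_Ioo.2 hω).to_subtype
  rw [← sub_le_iff_le_add', ← div_le_iff₀' hC]
  refine le_ciInf fun ρ => ?_
  have D_pos : 0 < Dℓ ρ ^ 3 := pow_pos (hD ρ ρ.2) 3
  rw [← sub_le_iff_le_add', ← div_le_iff₀' D_pos]
  refine le_ciInf fun δ => ?_
  rw [div_le_iff₀' D_pos, sub_le_iff_le_add', div_le_iff₀' hC, sub_le_iff_le_add']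
  exact h ρ ρ.2 δ δ.2

end SmoothingRate

section Universality

variable {p k n r d : ℕ} {q : Fin 4 → ℝ} {B : Fin k → Finset (Fin p)}
  {Sig : Matrix (Fin p) (Fin p) ℝ} {M K θ D L κ z ρ₀ ε δ e : ℝ} {Λ : Fin n → ℝ}
  {ℓ ℓ' : Fin n → ℝ → ℝ} {R : (Fin p → ℝ) → ℝ} {μ ν : Measure (Fin p → ℝ)}
  {Ω Ω' : Type*} [MeasurableSpace Ω] [MeasurableSpace Ω'] {P : Measure Ω} {P' : Measure Ω'}
  {X : Fin n → Ω → Fin p → ℝ} {G : Fin n → Ω' → Fin p → ℝ}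

/-- The constant in the universality bound, for a test function whose derivatives of order `1`,
`2`, `3` are bounded by `κ`. Its first summand covers the case where the bound exceeds `1`. -/
noncomputable def universalityConst (q : Fin 4 → ℝ) (M K θ κ : ℝ) : ℝ :=
  96 * θ + (512 * (lindebergConst q M K θ * κ) + 96 * netConst q K θ)

theorem lindebergConst_nonneg (hM : 0 ≤ M) (hK : 0 ≤ K) (hθ : 0 ≤ θ) :
    0 ≤ lindebergConst q M K θ := by
  have := rowConst_nonneg (q := q) hM hK hθ
  unfold lindebergConst
  positivity

theorem netConst_nonneg (hK : 0 ≤ K) (hθ : 0 ≤ θ) : 0 ≤ netConst q K θ := by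
  unfold netConst
  positivity

theorem le_universalityConst (hM : 0 ≤ M) (hK : 0 ≤ K) (hθ : 0 ≤ θ) (hκ : 0 ≤ κ) :
    96 * θ ≤ universalityConst q M K θ κ := by
  have := lindebergConst_nonneg (q := q) hM hK hθ
  have := netConst_nonneg (q := q) hK hθ
  exact le_add_of_nonneg_right (by positivity)

theorem BlockRegime.entropy_le (hB : BlockRegime B Sig n d M K θ) {t η : ℝ} (ht : 0 < t)
    (hη : 0 < η) : 3 * p * t / (n * (t / η)) ≤ 3 * (θ * η) := by
  have n_pos : (0 : ℝ) < n := mod_cast hB.n_pos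
  calc 3 * p * t / (n * (t / η)) = 3 * (p / n * η) := by field_simp
    _ ≤ 3 * (θ * η) := by
        gcongr
        exact (div_le_iff₀ n_pos).2 hB.p_le

theorem lindeberg_add_net_le {l m κ₀ s b η E : ℝ} (hl : 0 ≤ l) (hm : 0 ≤ m) (hκ : 0 ≤ κ)
    (hκ₀ : 0 ≤ κ₀) (hD : 1 ≤ D) (hη : 0 ≤ η) (hs : (1 + s) ^ 2 * b ≤ 4 * η) (hb : b ≤ η)
    (hE : D ^ 3 * η ≤ E) (hρ₀ : 0 < ρ₀) (hκρ : 1 / ρ₀ ≤ κ₀) :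
    2 * (l * (64 * κ₀ * κ) * (1 + s) ^ 2 * D ^ 3 * b) + 3 * (m * D * b / (ρ₀ / 32)) ≤
      (512 * (l * κ) + 96 * m) * κ₀ * E := by
  have : 0 ≤ D := zero_le_one.trans hD
  have E_nonneg : 0 ≤ E := le_trans (by positivity) hE
  have lindeberg : D ^ 3 * ((1 + s) ^ 2 * b) ≤ 4 * E := by
    calc D ^ 3 * ((1 + s) ^ 2 * b) ≤ D ^ 3 * (4 * η) := by gcongr
      _ ≤ 4 * E := by linarith
  have net : D * b ≤ E := by
    calc D * b ≤ D * η := by gcongr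
      _ ≤ D ^ 3 * η := by gcongr; exact le_self_pow₀ hD three_ne_zero
      _ ≤ E := hE
  calc _ = 128 * (l * κ * κ₀) * (D ^ 3 * ((1 + s) ^ 2 * b)) + 96 * m * (D * b) * (1 / ρ₀) := by
        field_simp
        ring
    _ ≤ 128 * (l * κ * κ₀) * (4 * E) + 96 * m * E * κ₀ := by gcongr
    _ = (512 * (l * κ) + 96 * m) * κ₀ * E := by ring

theorem bounds_of_mul_le_one {E κ₀ : ℝ} (hE : 0 ≤ E) (hθ : 1 ≤ θ) (hκ₀ : 1 ≤ κ₀) (hρ₀ : 0 < ρ₀)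
    (hκρ : 1 / ρ₀ ≤ κ₀) (h : 96 * θ * κ₀ * E ≤ 1) : 96 * (θ * E) ≤ ρ₀ ∧ E ≤ 1 := by
  have E_le : E ≤ θ * E := le_mul_of_one_le_left hE hθ
  have le_kappa : θ * E ≤ κ₀ * (θ * E) := le_mul_of_one_le_left (hE.trans E_le) hκ₀
  refine ⟨?_, by linarith⟩
  have : 1 / ρ₀ * (96 * (θ * E)) ≤ 1 :=
    (mul_le_mul_of_nonneg_right hκρ (by linarith)).trans (by linarith)
  rwa [one_div, inv_mul_le_iff₀ hρ₀, mul_one] at this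

variable [IsProbabilityMeasure P] [IsProbabilityMeasure P'] [IsProbabilityMeasure μ]
  [IsProbabilityMeasure ν]

theorem MatchedDesigns.measureReal_mem_le_of_mul_le_one {wX : Ω → Fin p → ℝ}
    {wG : Ω' → Fin p → ℝ} {S : Set (Fin p → ℝ)} {E : ℝ}
    (h : MatchedDesigns P P' X G μ ν B Sig d r M K θ) (hq : ∀ k, 0 ≤ q k) (hp : 0 < p)
    (hr : qBar q + 3 ≤ r) (hL : 1 ≤ L) (hℓ : ∀ i, SmoothLoss q D (Λ i) (ℓ' i))
    (hφ : SmoothTest κ Real.smoothTransition) (hD : 1 ≤ D) (hΛ : ∀ i, 1 ≤ Λ i)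
    (hδ : δ ∈ Ioo 0 (omegaRate n p d q)) (hR : Continuous R)
    (hℓℓ' : ∀ i x, |ℓ' i x - ℓ i x| ≤ e) (hρ₀ : 0 < ρ₀)
    (hwX : ∀ᵐ ω ∂P, IsRiskMinimizer ℓ R (designMatrix X ω) (wX ω))
    (hwG : ∀ᵐ ω ∂P', IsRiskMinimizer ℓ R (designMatrix G ω) (wG ω))
    (hεX : P.real {ω | L < ‖wX ω‖} ≤ ε) (hεG : P'.real {ω | L < ‖wG ω‖} ≤ ε)
    (hmin : P'.real {ω | ((z + ρ₀ : ℝ) : EReal) ≤ minRisk ℓ R univ (designMatrix G ω)} ≤ ε)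
    (hminS : P'.real {ω | minRisk ℓ R S (designMatrix G ω) ≤ ((z + 2 * ρ₀ : ℝ) : EReal)} ≤ ε)
    (hne : (S ∩ {w | ‖w‖ ≤ L}).Nonempty) (modulus_le : regModulus R L δ + e ≤ E)
    (smoothing_le : D ^ 3 * smoothingRate p d q Λ L δ ≤ E)
    (small : 96 * θ * max 1 (ρ₀ ^ (-3 : ℤ)) * E ≤ 1) :
    P.real {ω | wX ω ∈ S} ≤
      4 * ε + universalityConst q M K θ κ * max 1 (ρ₀ ^ (-3 : ℤ)) * E := by
  have n_pos := h.regime.n_pos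
  have one_le_d := h.regime.one_le_d
  have one_le_θ := h.regime.one_le_θ
  have θ_nonneg : 0 ≤ θ := zero_le_one.trans one_le_θ
  have K_nonneg : 0 ≤ K := zero_le_one.trans h.regime.one_le_K
  have L_pos : 0 < L := zero_lt_one.trans_le hL
  have Λ_pos (i : Fin n) : 0 < Λ i := zero_lt_one.trans_le (hΛ i)
  have one_le_κ₀ : 1 ≤ max 1 (ρ₀ ^ (-3 : ℤ)) := le_max_left _ _
  have inv_le_κ₀ := one_div_le_max_one_zpow hρ₀
  have one_le_log := one_le_logPlus (L / δ)
  have log_pos : 0 < logPlus (L / δ) := zero_lt_one.trans_le one_le_log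
  have η_pos := smoothingRate_pos (q := q) n_pos hp one_le_d Λ_pos L_pos δ
  have η_pow := smoothingRate_pow_three (q := q) n_pos hp one_le_d Λ_pos L_pos δ
  set η := smoothingRate p d q Λ L δ
  have η_le : η ≤ E := (le_mul_of_one_le_left η_pos.le (one_le_pow₀ hD)).trans smoothing_le
  have E_nonneg : 0 ≤ E := η_pos.le.trans η_le
  obtain ⟨E_le_ρ₀, E_le_one⟩ :=
    bounds_of_mul_le_one E_nonneg one_le_θ one_le_κ₀ hρ₀ inv_le_κ₀ small
  obtain ⟨lindeberg_le, net_le⟩ :=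
    sq_one_add_div_mul_le η_pos (η_le.trans E_le_one) one_le_log η_pow
  have error_le : regModulus R L δ + 3 * p * logPlus (L / δ) / (n * (logPlus (L / δ) / η)) + e ≤
      3 * (ρ₀ / 32) := by
    have entropy_le := h.regime.entropy_le log_pos η_pos
    have := mul_le_mul_of_nonneg_left η_le θ_nonneg
    have := le_mul_of_one_le_left E_nonneg one_le_θ
    linarith
  have comparison := h.measureReal_mem_le hq hr hL hℓ hφ hD hΛ (div_pos log_pos η_pos)
    (sigmaRate_pos q n_pos hp one_le_d).le hδ hR hℓℓ' hρ₀ error_le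
    (fun m => one_div_div_four_pow_le hρ₀) hwX hwG hεX hεG hmin hminS hne
  have comparison_le := lindeberg_add_net_le
    (lindebergConst_nonneg (q := q) h.regime.M_nonneg K_nonneg θ_nonneg)
    (netConst_nonneg (q := q) K_nonneg θ_nonneg) hφ.bound_nonneg (zero_le_one.trans one_le_κ₀) hD
    η_pos.le lindeberg_le net_le smoothing_le hρ₀ inv_le_κ₀
  have slack_nonneg : 0 ≤ 96 * θ * max 1 (ρ₀ ^ (-3 : ℤ)) * E := by positivity
  unfold universalityConst
  linarith

theorem MatchedDesigns.measureReal_mem_le_of_smoothLoss {wX : Ω → Fin p → ℝ}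
    {wG : Ω' → Fin p → ℝ} {S : Set (Fin p → ℝ)}
    (h : MatchedDesigns P P' X G μ ν B Sig d r M K θ) (hq : ∀ k, 0 ≤ q k) (hp : 0 < p)
    (hr : qBar q + 3 ≤ r) (hL : 1 ≤ L) (hℓ : ∀ i, SmoothLoss q D (Λ i) (ℓ' i))
    (hφ : SmoothTest κ Real.smoothTransition) (hD : 1 ≤ D) (hΛ : ∀ i, 1 ≤ Λ i)
    (hδ : δ ∈ Ioo 0 (omegaRate n p d q)) (hR : Continuous R) (he : 0 ≤ e)
    (hℓℓ' : ∀ i x, |ℓ' i x - ℓ i x| ≤ e) (hρ₀ : 0 < ρ₀)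
    (hwX : ∀ᵐ ω ∂P, IsRiskMinimizer ℓ R (designMatrix X ω) (wX ω))
    (hwG : ∀ᵐ ω ∂P', IsRiskMinimizer ℓ R (designMatrix G ω) (wG ω))
    (hεX : P.real {ω | L < ‖wX ω‖} ≤ ε) (hεG : P'.real {ω | L < ‖wG ω‖} ≤ ε)
    (hmin : P'.real {ω | ((z + ρ₀ : ℝ) : EReal) ≤ minRisk ℓ R univ (designMatrix G ω)} ≤ ε)
    (hminS : P'.real {ω | minRisk ℓ R S (designMatrix G ω) ≤ ((z + 2 * ρ₀ : ℝ) : EReal)} ≤ ε) :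
    P.real {ω | wX ω ∈ S} ≤ 4 * ε + universalityConst q M K θ κ * max 1 (ρ₀ ^ (-3 : ℤ)) *
      (e + D ^ 3 * (regModulus R L δ + smoothingRate p d q Λ L δ)) := by
  have ε_nonneg : 0 ≤ ε := measureReal_nonneg.trans hεX
  have θ_nonneg : 0 ≤ θ := zero_le_one.trans h.regime.one_le_θ
  have const_le := le_universalityConst (q := q) h.regime.M_nonneg
    (zero_le_one.trans h.regime.one_le_K) θ_nonneg hφ.bound_nonneg
  have const_nonneg := (mul_nonneg (by norm_num) θ_nonneg).trans const_le
  have η_pos := smoothingRate_pos (q := q) h.regime.n_pos hp h.regime.one_le_d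
    (fun i => zero_lt_one.trans_le (hΛ i)) (zero_lt_one.trans_le hL) δ
  have modulus_nonneg := regModulus_nonneg R L δ
  have : 0 ≤ D := zero_le_one.trans hD
  set η := smoothingRate p d q Λ L δ
  set E := e + D ^ 3 * (regModulus R L δ + η)
  have : 0 ≤ E := by positivity
  rcases (S ∩ {w | ‖w‖ ≤ L}).eq_empty_or_nonempty with empty | nonempty
  · have subset : {ω | wX ω ∈ S} ⊆ {ω | L < ‖wX ω‖} := ofPred_subset_ofPred.2 fun ω mem_S =>
      not_le.1 fun norm_le => eq_empty_iff_forall_notMem.1 empty (wX ω) ⟨mem_S, norm_le⟩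
    calc P.real {ω | wX ω ∈ S} ≤ ε := (measureReal_mono subset).trans hεX
      _ ≤ 4 * ε + universalityConst q M K θ κ * max 1 (ρ₀ ^ (-3 : ℤ)) * E :=
        le_add_of_le_of_nonneg (by linarith) (by positivity)
  rcases le_total (96 * θ * max 1 (ρ₀ ^ (-3 : ℤ)) * E) 1 with small | large
  · have modulus_le : regModulus R L δ ≤ D ^ 3 * regModulus R L δ :=
      le_mul_of_one_le_left modulus_nonneg (one_le_pow₀ hD)
    have smoothing_nonneg : 0 ≤ D ^ 3 * η := by positivity
    exact h.measureReal_mem_le_of_mul_le_one hq hp hr hL hℓ hφ hD hΛ hδ hR hℓℓ' hρ₀ hwX hwG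
      hεX hεG hmin hminS nonempty (by linarith) (by linarith) small
  · calc P.real {ω | wX ω ∈ S} ≤ 1 := measureReal_le_one
      _ ≤ 96 * θ * max 1 (ρ₀ ^ (-3 : ℤ)) * E := large
      _ ≤ universalityConst q M K θ κ * max 1 (ρ₀ ^ (-3 : ℤ)) * E := by gcongr
      _ ≤ 4 * ε + universalityConst q M K θ κ * max 1 (ρ₀ ^ (-3 : ℤ)) * E :=
        le_add_of_nonneg_left (by linarith)

end Universality

end BlockUniversality

open BlockUniversality in
theorem theorem2_general (q : Fin 4 → ℝ) (hq : ∀ k, 0 ≤ q k) (M θ : ℝ) :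
    ∃ C₀ : ℝ, 0 < C₀ ∧
      ∀ (n p d : ℕ), 0 < n → 0 < p → (p : ℝ) ≤ θ * n →
      ∀ (ℓ : Fin n → ℝ → ℝ) (R : (Fin p → ℝ) → ℝ), Continuous R →
      ∀ (ρbar : ℝ) (Lℓ : Fin n → ℝ) (Dℓ Mℓ : ℝ → ℝ),
        LossAssumption q ρbar Lℓ Dℓ Mℓ ℓ →
      ∀ (Sig : Matrix (Fin p) (Fin p) ℝ)
        (Ω : Type*) [MeasurableSpace Ω] (P : Measure Ω) [IsProbabilityMeasure P]
        (X : Fin n → Ω → Fin p → ℝ),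
        CovariateAssumption P X Sig q M d →
      ∀ (Ω' : Type*) [MeasurableSpace Ω'] (P' : Measure Ω') [IsProbabilityMeasure P']
        (G : Fin n → Ω' → Fin p → ℝ),
        IsGaussianDesign P' G Sig →
      ∀ (wX : Ω → Fin p → ℝ) (wG : Ω' → Fin p → ℝ),
        (∀ᵐ ω ∂P, IsRiskMinimizer ℓ R (designMatrix X ω) (wX ω)) →
        (∀ᵐ ω ∂P', IsRiskMinimizer ℓ R (designMatrix G ω) (wG ω)) →
      ∀ (S : Set (Fin p → ℝ)) (z ρ₀ L ε : ℝ), 0 < ρ₀ → 1 ≤ L →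
        max (P'.real {ω | L < ‖wG ω‖}) (P.real {ω | L < ‖wX ω‖}) ≤ ε →
        max
          (P'.real {ω | ((z + ρ₀ : ℝ) : EReal) ≤ minRisk ℓ R univ (designMatrix G ω)})
          (P'.real {ω | minRisk ℓ R S (designMatrix G ω) ≤ ((z + 2 * ρ₀ : ℝ) : EReal)}) ≤ ε →
        P.real {ω | wX ω ∈ S} ≤
          4 * ε + C₀ * max 1 (ρ₀ ^ (-3 : ℤ)) * rate d q ρbar Lℓ Dℓ Mℓ R L := by
  obtain ⟨κ, hκ⟩ := exists_smoothTest_smoothTransition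
  have one_le_θ : 1 ≤ max 1 θ := le_max_left 1 θ
  have const_pos : 0 < universalityConst q |M| (momentConst q M) (max 1 θ) κ :=
    lt_of_lt_of_le (by positivity) (le_universalityConst (abs_nonneg M)
      (zero_le_one.trans (one_le_momentConst q M)) (zero_le_one.trans one_le_θ) hκ.bound_nonneg)
  refine ⟨_, const_pos, ?_⟩
  intro n p d hn hp hpn ℓ R hR ρbar Lℓ Dℓ Mℓ hℓ Sig Ω _ P _ X hX Ω' _ P' _ G hG wX wG hwX hwG
    S z ρ₀ L ε hρ₀ hL hloc hgap
  obtain ⟨k, B, μ, ν, _, _, designs⟩ := hX.exists_matchedDesigns hG hn hp one_le_θ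
    (hpn.trans (by gcongr; exact le_max_right 1 θ))
  have omega_pos : 0 < omegaRate n p d q := mul_pos (Real.rpow_pos_of_pos (mod_cast hn) _)
    (sigmaRate_pos q hn hp designs.regime.one_le_d)
  refine le_add_mul_rate (by positivity) hℓ.rhoBar_mem.1 omega_pos
    (fun ρ hρ => zero_lt_one.trans_le (hℓ.one_le_D ρ hρ)) fun ρ hρ δ hδ => ?_
  obtain ⟨ℓ', smooth, close⟩ := hℓ.exists_smoothLoss hρ
  exact designs.measureReal_mem_le_of_smoothLoss hq hp (qBar_add_three_le_qStar q) hL smooth hκ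
    (hℓ.one_le_D ρ hρ) hℓ.one_le_L hδ hR (hℓ.M_mem ρ hρ).1 close hρ₀ hwX hwG
    (le_of_max_le_right hloc) (le_of_max_le_left hloc) (le_of_max_le_left hgap)
    (le_of_max_le_right hgap)

theorem theorem2 (τ : ℝ) (hτ : τ ∈ Set.Ioo (0 : ℝ) 1) (q : Fin 4 → ℝ)
    (hq : ∀ k, 0 ≤ q k) (M : ℝ) :
    ∃ C₀ : ℝ, 0 < C₀ ∧
      ∀ (n p d : ℕ), 0 < n → τ ≤ (p : ℝ) / n → (p : ℝ) / n ≤ 1 / τ →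
      ∀ (ℓ : Fin n → ℝ → ℝ) (R : (Fin p → ℝ) → ℝ),
        (∀ i, ConvexOn ℝ Set.univ (ℓ i)) → ConvexOn ℝ Set.univ R →
      ∀ (ρbar : ℝ) (Lℓ : Fin n → ℝ) (Dℓ Mℓ : ℝ → ℝ),
        BlockUniversality.LossAssumption q ρbar Lℓ Dℓ Mℓ ℓ →
      ∀ (Sig : Matrix (Fin p) (Fin p) ℝ)
        (Ω : Type*) [MeasurableSpace Ω] (P : Measure Ω) [IsProbabilityMeasure P]
        (X : Fin n → Ω → Fin p → ℝ),
        BlockUniversality.CovariateAssumption P X Sig q M d →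
      ∀ (Ω' : Type*) [MeasurableSpace Ω'] (P' : Measure Ω') [IsProbabilityMeasure P']
        (G : Fin n → Ω' → Fin p → ℝ),
        BlockUniversality.IsGaussianDesign P' G Sig →
      ∀ (wX : Ω → Fin p → ℝ) (wG : Ω' → Fin p → ℝ),
        AEMeasurable wX P → AEMeasurable wG P' →
        (∀ᵐ ω ∂P, BlockUniversality.IsRiskMinimizer ℓ R
          (BlockUniversality.designMatrix X ω) (wX ω)) →
        (∀ᵐ ω ∂P', BlockUniversality.IsRiskMinimizer ℓ R
          (BlockUniversality.designMatrix G ω) (wG ω)) →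
      ∀ S : Set (Fin p → ℝ), MeasurableSet S →
      ∀ z ρ₀ L ε : ℝ, 0 < ρ₀ → 1 ≤ L → ε ∈ Set.Ico (0 : ℝ) (1 / 4) →
        max (P'.real {ω | L < ‖wG ω‖}) (P.real {ω | L < ‖wX ω‖}) ≤ ε →
        max
          (P'.real {ω | ((z + ρ₀ : ℝ) : EReal) ≤ BlockUniversality.minRisk ℓ R Set.univ
            (BlockUniversality.designMatrix G ω)})
          (P'.real {ω | BlockUniversality.minRisk ℓ R S
            (BlockUniversality.designMatrix G ω) ≤ ((z + 2 * ρ₀ : ℝ) : EReal)}) ≤ ε →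
        P.real {ω | wX ω ∈ S} ≤
          4 * ε + C₀ * max 1 (ρ₀ ^ (-3 : ℤ)) *
            BlockUniversality.rate d q ρbar Lℓ Dℓ Mℓ R L := by
  obtain ⟨C₀, C₀_pos, bound⟩ := theorem2_general q hq M (1 / τ)
  refine ⟨C₀, C₀_pos, ?_⟩
  intro n p d hn τ_le le_τ ℓ R _ hR ρbar Lℓ Dℓ Mℓ hℓ Sig Ω _ P _ X hX Ω' _ P' _ G hG wX wG _ _
    hwX hwG S _ z ρ₀ L ε hρ₀ hL _
  have n_pos : (0 : ℝ) < n := mod_cast hn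
  have p_pos : (0 : ℝ) < p := (div_pos_iff_of_pos_right n_pos).1 (hτ.1.trans_le τ_le)
  exact bound n p d hn (mod_cast p_pos) ((div_le_iff₀ n_pos).1 le_τ) ℓ R
    hR.locallyLipschitz.continuous ρbar Lℓ Dℓ Mℓ hℓ Sig Ω P X hX Ω' P' G hG wX wG hwX hwG
    S z ρ₀ L ε hρ₀ hL
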